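/- **Categories with covering families.** A covering family structure on a small category $\mathcal C$ is a collection of finite (possibly empty) families $\{A_i\to B\}_{i\in I}$ of maps with common target, called covering families, that contains every singleton $\{\mathrm{id}_A\colon A\to A\}$ and is closed under composition: if $\{g_j\colon B_j\to C\}_{j\in J}$ and $\{f_{ij}\colon A_{ij}\to B_j\}_{i\in I_j}$ for all $j\in J$ are covering families, so is $\{g_j\circ f_{ij}\}_{j\in J,\,i\in I_j}$. A category with covering families has in addition a basepoint object $*$ with $\mathrm{Hom}(*,*)=\{1_*\}$, $\mathrm{Hom}(c,*)=\varnothing$ for $c\neq *$, and such that $\{*\to *\}_{i\in I}$ is a covering family for every finite set $I$. Write $\mathcal C^\circ$ for the full subcategory of objects $c\ne *$, and $X^\circ$ for the set of non-basepoint elements of a pointed set $X$. For a pointed set $X$, let $X\wedge\mathcal C=\bigvee_{X^\circ}\mathcal C$: the non-basepoint objects are the pairs $(x,c)$ with $x\in X^\circ$, $c\in\mathcal C^\circ$; apart from maps out of the basepoint, there are only the maps within each copy of $\mathcal C^\circ$; and a family is covering if it lies in a single copy of $\mathcal C$ and is covering there. This is functorial in $X$. The category of covers $\mathcal W(\mathcal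 C)$ has as objects the finite tuples $\{A_i\}_{i\in I}$ of objects of $\mathcal C^\circ$; a morphism $\{A_i\}_{i\in I}\to\{B_j\}_{j\in J}$ is a map $f\colon I\to J$ together with a covering family $\{A_i\to B_j\}_{i\in f^{-1}(j)}$ for each $j\in J$. Its basepoint is the empty tuple. The K-theory spectrum $K(\mathcal C)$ is the spectrum associated to the $\Gamma$-space $X\mapsto |N_\bullet\mathcal W(X\wedge\mathcal C)|$, where $X$ runs over finite pointed sets: its $k$-th level is the realization of the simplicial set $p\mapsto N_p\mathcal W(S^k_p\wedge\mathcal C)$, with $S^k_\bullet=(S^1_\bullet)^{\wedge k}$ and $S^1_\bullet=\Delta[1]/\partial\Delta[1]$ the simplicial circle, and its bonding maps are induced by the maps $-\wedge s\colon S^k_p\to S^k_p\wedge S^1_p$ for $s\in S^1_p$. **The example.** Let $A$ be an abelian group. Let $\mathcal EA_*$ be the category with covering families whose objects are the elements of $A$ together with a basepoint object $*$; between any two elements of $A$ there is exactly one map, there is exactly one map $*\to a$ for each $a\in A$, there is no map $a\to *$, and $\mathrm{Hom}(*,*)=\{1_*\}$. A family of maps to $a\in A$ is covering if and only if the sum of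 those of its sources that are elements of $A$ is equal to $a$; every family $\{*\to *\}_{i\in I}$ is covering. The Eilenberg–MacLane spectrum $HA$ is the spectrum associated, in the same way, to the $\Gamma$-space $X\mapsto X\otimes A=\bigoplus_{x\in X^\circ}A$ with values in discrete spaces, in which a map of pointed sets deletes the summands sent to the basepoint and acts on the indices of the others. **Lemma.** For every abelian group $A$ there is an equivalence of spectra $$K(\mathcal EA_*)\simeq HA .$$ More precisely, the assignments $$\mathcal W(X\wedge\mathcal EA_*)\to X\otimes A,\qquad \{(x_i,a_i)\}_{i\in I}\mapsto\Bigl(\sum_{i\in I,\ x_i=x}a_i\Bigr)_{x\in X^\circ}$$ on objects define a map of $\Gamma$-spaces $|N_\bullet\mathcal W(X\wedge\mathcal EA_*)|\to X\otimes A$ that is a weak homotopy equivalence for every finite pointed set $X$, and the induced map of spectra $K(\mathcal EA_*)\to HA$ is a stable equivalence, that is, it induces a bijection (hence an isomorphism) on $\pi_n$ for all $n\in\mathbb Z$. -/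

import Mathlib

open CategoryTheory Opposite

universe u

noncomputable section

namespace CoverK

/-! ### Categories with covering families -/

/-- A small category with a covering family structure. A family of maps with common target is
indexed by a finite type; being a covering family does not depend on the names of the indices. -/
structure CovCat : Type (u + 1) where
  carrier : Type u
  [cat : SmallCategory carrier]
  /-- the covering families `{f i : A i ⟶ B}` for `i` in `I` -/
  IsCover : ∀ {I : Type} [Finite I] {B : carrier} (A : I → carrier), (∀ i, A i ⟶ B) → Prop
  cover_reindex : ∀ {I J : Type} [Finite I] [Finite J] (e : J ≃ I) {B : carrier}
    (A : I → carrier) (f : ∀ i, A i ⟶ B), IsCover A f → IsCover (fun j => A (e j)) (fun j => f (e j))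
  cover_id : ∀ A : carrier, IsCover (I := Unit) (fun _ => A) (fun _ => 𝟙 A)
  cover_comp : ∀ {J : Type} [Finite J] {I : J → Type} [∀ j, Finite (I j)] {C : carrier}
    (B : J → carrier) (g : ∀ j, B j ⟶ C) (A : ∀ j, I j → carrier) (f : ∀ j i, A j i ⟶ B j),
    IsCover B g → (∀ j, IsCover (A j) (f j)) →
      IsCover (I := Σ j, I j) (fun p => A p.1 p.2) (fun p => f p.1 p.2 ≫ g p.1)

attribute [instance] CovCat.cat

/-- A category with covering families: a small category with a covering family structure and a
basepoint object satisfying axioms (B) and (C). -/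
structure CatFam : Type (u + 1) extends CovCat.{u} where
  base : carrier
  base_hom : ∀ f : base ⟶ base, f = 𝟙 base
  eq_base : ∀ {c : carrier}, (c ⟶ base) → c = base
  cover_base : ∀ (I : Type) [Finite I], IsCover (fun _ : I => base) (fun _ => 𝟙 base)

namespace CatFam

/-- A morphism of categories with covering families: a functor that preserves covering families
and the basepoint. -/
@[ext]
structure Hom (C D : CatFam.{u}) where
  functor : C.carrier ⥤ D.carrier
  map_base : functor.obj C.base = D.base
  map_cover : ∀ {I : Type} [Finite I] {B : C.carrier} (A : I → C.carrier) (f : ∀ i, A i ⟶ B),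
    C.IsCover A f → D.IsCover (fun i => functor.obj (A i)) (fun i => functor.map (f i))

instance : Category CatFam.{u} where
  Hom := Hom
  id C := ⟨𝟭 _, rfl, fun _ _ h => h⟩
  comp F G := ⟨F.functor ⋙ G.functor, by simp [F.map_base, G.map_base],
    fun A f h => G.map_cover _ _ (F.map_cover A f h)⟩

variable (C : CatFam.{u})

lemma isCover_eqToHom {I : Type} [Finite I] {B B' : C.carrier} (A A' : I → C.carrier)
    (f : ∀ i, A i ⟶ B) (hA : ∀ i, A' i = A i) (hB : B = B') (h : C.IsCover A f) :
    C.IsCover A' (fun i => eqToHom (hA i) ≫ f i ≫ eqToHom hB) := by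
  obtain rfl : A' = A := funext hA
  subst hB
  simpa using h

lemma isCover_to_base {I : Type} [Finite I] {B : C.carrier} (hB : B = C.base) (A : I → C.carrier)
    (f : ∀ i, A i ⟶ B) : C.IsCover A f := by
  subst hB
  obtain rfl : A = fun _ => C.base := funext fun i => C.eq_base (f i)
  obtain rfl : f = fun _ => 𝟙 C.base := funext fun i => C.base_hom (f i)
  exact C.cover_base I

/-- Removing basepoints from a covering family leaves a covering family. -/
lemma isCover_drop {I J : Type} [Finite I] [Finite J] {B : C.carrier} (A : I → C.carrier)
    (f : ∀ i, A i ⟶ B) (h : C.IsCover A f) (e : J → I) (he : Function.Injective e)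
    (he' : ∀ i, A i ≠ C.base → ∃ j, e j = i) :
    C.IsCover (fun j => A (e j)) (fun j => f (e j)) := by
  have key : ∀ i, C.IsCover (I := {j : J // e j = i}) (fun _ => A i) (fun _ => 𝟙 (A i)) := by
    intro i
    by_cases hi : ∃ j, e j = i
    · obtain ⟨j, rfl⟩ := hi
      exact C.cover_reindex (I := Unit) (J := {j' : J // e j' = e j})
        ⟨fun _ => (), fun _ => ⟨j, rfl⟩, fun x => Subtype.ext (he x.2.symm), fun _ => rfl⟩
        (fun _ => A (e j)) (fun _ => 𝟙 _) (C.cover_id _)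
    · exact C.isCover_to_base (by by_contra h'; exact hi (he' i h')) _ _
  have h2 := C.cover_comp A f (fun i (_ : {j : J // e j = i}) => A i) (fun i _ => 𝟙 _) h key
  have h3 := C.cover_reindex (J := J) (I := Σ i, {j : J // e j = i})
    ⟨fun j => ⟨e j, j, rfl⟩, fun p => p.2.1, fun _ => rfl, by rintro ⟨_, _, rfl⟩; rfl⟩ _ _ h2
  simpa using h3

end CatFam

/-! ### Adding an initial basepoint -/

section AddInitial

variable {C : Type u}

/-- The object of `C` underlying a non-basepoint object of `C_*`. -/
def under (X : WithInitial C) (h : X ≠ .star) : C :=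
  match X, h with
  | .of c, _ => c
  | .star, h => absurd rfl h

lemma of_under (X : WithInitial C) (h : X ≠ .star) : WithInitial.of (under X h) = X := by
  cases X with
  | of c => rfl
  | star => exact absurd rfl h

variable [SmallCategory C]

/-- The morphism of `C` underlying a morphism between non-basepoint objects of `C_*`. -/
def underHom {X Y : WithInitial C} (hX : X ≠ .star) (hY : Y ≠ .star) (f : X ⟶ Y) :
    under X hX ⟶ under Y hY :=
  WithInitial.down (eqToHom (of_under X hX) ≫ f ≫ eqToHom (of_under Y hY).symm)

lemma underHom_id {X : WithInitial C} (hX : X ≠ .star) : underHom hX hX (𝟙 X) = 𝟙 _ := by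
  simp [underHom]

lemma underHom_comp {X Y Z : WithInitial C} (hX : X ≠ .star) (hY : Y ≠ .star) (hZ : Z ≠ .star)
    (f : X ⟶ Y) (g : Y ⟶ Z) :
    underHom hX hZ (f ≫ g) = underHom hX hY f ≫ underHom hY hZ g := by
  simp [underHom, ← WithInitial.down_comp]

lemma ne_star_of_hom {X Y : WithInitial C} (f : X ⟶ Y) (hX : X ≠ .star) : Y ≠ .star := by
  rintro rfl
  cases X with
  | of c => exact WithInitial.false_of_to_star f
  | star => exact hX rfl

end AddInitial

/-- The category with covering families `C_*` obtained from `C` by adding an initial basepoint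
`*` (with no maps `c ⟶ *` for `c ≠ *`). A family of maps to `c ≠ *` is a covering family iff
removing all the maps `* ⟶ c` gives a covering family in `C`; all families of maps to `*` are
covering families (they consist of identities of `*`). -/
def addInitial (C : CovCat.{u}) : CatFam.{u} where
  carrier := WithInitial C.carrier
  IsCover {I _ B} A f := ∀ hB : B ≠ .star,
    C.IsCover (I := {i : I // A i ≠ .star}) (fun i => under (A i) i.2)
      (fun i => underHom i.2 hB (f i))
  cover_reindex {I J _ _} e {B} A f h hB :=
    C.cover_reindex (e.subtypeEquiv (fun _ => Iff.rfl) :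
      {j : J // A (e j) ≠ .star} ≃ {i : I // A i ≠ .star}) _ _ (h hB)
  cover_id A hA := by
    have := C.cover_reindex (I := Unit) (J := {i : Unit // A ≠ .star})
      ⟨fun _ => (), fun _ => ⟨(), hA⟩, fun _ => rfl, fun _ => rfl⟩ _ _ (C.cover_id (under A hA))
    simpa only [underHom_id] using this
  cover_comp {J _ I _ Z} B g A f hg hf hZ := by
    have h := C.cover_comp (J := {j : J // B j ≠ .star})
      (I := fun j => {i : I j.1 // A j.1 i ≠ .star}) _ _
      (fun j i => under (A j.1 i.1) i.2) (fun j i => underHom i.2 j.2 (f j.1 i.1))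
      (hg hZ) (fun j => hf j.1 j.2)
    have h2 := C.cover_reindex (J := {p : Σ j, I j // A p.1 p.2 ≠ .star})
      ⟨fun p => ⟨⟨p.1.1, ne_star_of_hom (f p.1.1 p.1.2) p.2⟩, ⟨p.1.2, p.2⟩⟩,
        fun q => ⟨⟨q.1.1, q.2.1⟩, q.2.2⟩, fun _ => rfl, fun _ => rfl⟩ _ _ h
    refine cast (congrArg _ (funext fun p => ?_)) h2
    exact (underHom_comp p.2 (ne_star_of_hom (f p.1.1 p.1.2) p.2) hZ _ _).symm
  base := .star
  base_hom f := Subsingleton.elim _ _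
  eq_base {c} f := by
    by_contra hc
    exact ne_star_of_hom f hc rfl
  cover_base I _ h := absurd rfl h

/-! ### The chaotic category of an abelian group -/

/-- The objects of the chaotic category `EA`: the elements of `A`. -/
@[ext]
structure EObj (A : Type u) : Type u where
  val : A

/-- There is exactly one morphism between any two objects of `EA`. -/
instance (A : Type u) : SmallCategory (EObj A) where
  Hom _ _ := PUnit
  id _ := ⟨⟩
  comp _ _ := ⟨⟩

/-- The chaotic category `EA`, in which `{a i ⟶ a}` is a covering family iff `∑ i, a i = a`. -/
def EA (A : Type u) [AddCommGroup A] : CovCat.{u} where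
  carrier := EObj A
  IsCover {_ _ b} a _ := ∑ᶠ i, (a i).val = b.val
  cover_reindex e b a f h := by
    rw [← h]
    exact finsum_comp_equiv e (f := fun i => (a i).val)
  cover_id a := by simp [finsum_unique]
  cover_comp {J _ I _ c} b g a f hg hf := by
    have := Fintype.ofFinite J
    have := fun j => Fintype.ofFinite (I j)
    rw [← hg, finsum_eq_sum_of_fintype, finsum_eq_sum_of_fintype, Fintype.sum_sigma]
    refine Finset.sum_congr rfl fun j _ => ?_
    rw [← hf j, finsum_eq_sum_of_fintype]

/-- The category with covering families `EA_*`. -/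
def EAstar (A : Type u) [AddCommGroup A] : CatFam.{u} := addInitial (EA A)

/-! ### The smash product of a pointed set with a category with covering families -/

/-- An object of `X ∧ C`: the basepoint, or a pair of non-basepoint elements of `X` and `C`. -/
@[ext]
structure SmashObj (X : Pointed.{0}) (C : CatFam.{u}) : Type u where
  label : X
  obj : C.carrier
  compat : label = X.point ↔ obj = C.base

/-- A morphism of `X ∧ C`: a morphism of `C` together with a morphism between the labels in `X`,
viewed as a discrete category with basepoint made initial. -/
@[ext]
structure SmashHom {X : Pointed.{0}} {C : CatFam.{u}} (P Q : SmashObj X C) : Type u where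
  hom : P.obj ⟶ Q.obj
  label_eq : P.label = X.point ∨ P.label = Q.label

@[simps]
instance (X : Pointed.{0}) (C : CatFam.{u}) : SmallCategory (SmashObj X C) where
  Hom := SmashHom
  id P := ⟨𝟙 P.obj, Or.inr rfl⟩
  comp f g := ⟨f.hom ≫ g.hom, by
    rcases f.label_eq with h | h
    · exact Or.inl h
    · rw [h]; exact g.label_eq⟩
  id_comp f := SmashHom.ext (Category.id_comp f.hom)
  comp_id f := SmashHom.ext (Category.comp_id f.hom)
  assoc f g h := SmashHom.ext (Category.assoc f.hom g.hom h.hom)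

/-- The category with covering families `X ∧ C`. A family of maps with common target lies in a
single copy of `C`; it is a covering family iff it is one in that copy of `C`. -/
def smash (X : Pointed.{0}) (C : CatFam.{u}) : CatFam.{u} where
  carrier := SmashObj X C
  IsCover {I _ B} A f :=
    C.IsCover (fun i => SmashObj.obj (A i)) (fun i => SmashHom.hom (P := A i) (Q := B) (f i))
  cover_reindex e _ _ _ h := C.cover_reindex e _ _ h
  cover_id A := C.cover_id A.obj
  cover_comp _ _ _ _ hg hf := C.cover_comp _ _ _ _ hg hf
  base := ⟨X.point, C.base, by simp⟩
  base_hom f := SmashHom.ext (C.base_hom f.hom)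
  eq_base {P} f := by
    have h := C.eq_base f.hom
    exact SmashObj.ext (P.compat.2 h) h
  cover_base I _ := C.cover_base I

section SmashMap

variable {X Y : Pointed.{0}} (f : X ⟶ Y) {C : CatFam.{u}}

open Classical in
/-- Apply `f` to the label of an object; if the result is the basepoint of `Y`, the whole object
becomes the basepoint of `Y ∧ C`. -/
def smashObjMap (P : SmashObj X C) : SmashObj Y C where
  label := f.toFun P.label
  obj := if f.toFun P.label = Y.point then C.base else P.obj
  compat := by
    by_cases h : f.toFun P.label = Y.point
    · simp [h]
    · simp only [h, if_false, false_iff]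
      intro h'
      exact h (by rw [P.compat.2 h', f.map_point])

lemma smashObjMap_obj_of_eq {P : SmashObj X C} (h : f.toFun P.label = Y.point) :
    (smashObjMap f P).obj = C.base := if_pos h

lemma smashObjMap_obj_of_ne {P : SmashObj X C} (h : f.toFun P.label ≠ Y.point) :
    (smashObjMap f P).obj = P.obj := if_neg h

lemma map_label_eq_point {P Q : SmashObj X C} (φ : P ⟶ Q)
    (h : f.toFun Q.label = Y.point) : f.toFun P.label = Y.point := by
  rcases φ.label_eq with h' | h'
  · rw [h', f.map_point]
  · rw [h', h]

lemma smashObjMap_source {P Q : SmashObj X C} (φ : P ⟶ Q)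
    (h : f.toFun Q.label ≠ Y.point) : (smashObjMap f P).obj = P.obj := by
  by_cases hP : f.toFun P.label = Y.point
  · rw [smashObjMap_obj_of_eq f hP]
    rcases φ.label_eq with h' | h'
    · exact (P.compat.1 h').symm
    · exact absurd (h' ▸ hP) h
  · exact smashObjMap_obj_of_ne f hP

open Classical in
/-- The action of `f` on morphisms: the identity on the copies of `C` that are not collapsed, and
the identity of the basepoint on those that are. -/
def smashHomMap {P Q : SmashObj X C} (φ : P ⟶ Q) : smashObjMap f P ⟶ smashObjMap f Q where
  hom :=
    if h : f.toFun Q.label = Y.point then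
      eqToHom ((smashObjMap_obj_of_eq f (map_label_eq_point f φ h)).trans
        (smashObjMap_obj_of_eq f h).symm)
    else
      eqToHom (smashObjMap_source f φ h) ≫ φ.hom ≫ eqToHom (smashObjMap_obj_of_ne f h).symm
  label_eq := by
    rcases φ.label_eq with h | h
    · left; show f.toFun P.label = _; rw [h, f.map_point]
    · right; show f.toFun P.label = f.toFun Q.label; rw [h]

lemma hom_ext_of_target_base {c d : C.carrier} (hd : d = C.base) (φ ψ : c ⟶ d) : φ = ψ := by
  subst hd
  obtain rfl := C.eq_base φ
  rw [C.base_hom φ, C.base_hom ψ]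

lemma smashHomMap_hom_of_ne {P Q : SmashObj X C} (φ : P ⟶ Q) (h : f.toFun Q.label ≠ Y.point) :
    (smashHomMap f φ).hom =
      eqToHom (smashObjMap_source f φ h) ≫ φ.hom ≫ eqToHom (smashObjMap_obj_of_ne f h).symm :=
  dif_neg h

/-- The functor underlying the morphism `X ∧ C ⟶ Y ∧ C` induced by `f`. -/
def smashFunctor (C : CatFam.{u}) : SmashObj X C ⥤ SmashObj Y C where
  obj := smashObjMap f
  map := smashHomMap f
  map_id P := by
    apply SmashHom.ext
    by_cases h : f.toFun P.label = Y.point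
    · exact hom_ext_of_target_base (smashObjMap_obj_of_eq f h) _ _
    · simp [smashHomMap_hom_of_ne f _ h]
  map_comp {P Q R} φ ψ := by
    apply SmashHom.ext
    by_cases h : f.toFun R.label = Y.point
    · exact hom_ext_of_target_base (smashObjMap_obj_of_eq f h) _ _
    by_cases h' : f.toFun Q.label = Y.point
    · have hQ : Q.obj = C.base := by
        rw [← smashObjMap_source f ψ h, smashObjMap_obj_of_eq f h']
      have : (smashHomMap f φ).hom = eqToHom (smashObjMap_source f (φ ≫ ψ) h) ≫ φ.hom ≫
          eqToHom (smashObjMap_source f ψ h).symm :=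
        hom_ext_of_target_base (smashObjMap_obj_of_eq f h') _ _
      simp [smashHomMap_hom_of_ne f _ h, this]
    · simp [smashHomMap_hom_of_ne f _ h, smashHomMap_hom_of_ne f _ h']

/-- The morphism `X ∧ C ⟶ Y ∧ C` induced by a map of pointed sets `X ⟶ Y`. -/
def smashMap (C : CatFam.{u}) : CatFam.Hom (smash X C) (smash Y C) where
  functor := smashFunctor f C
  map_base := SmashObj.ext f.map_point (smashObjMap_obj_of_eq f f.map_point)
  map_cover {I _ B} A φ h := by
    change ∀ i, SmashHom (A i) B at φ
    change SmashObj X C at B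
    change I → SmashObj X C at A
    by_cases hB : f.toFun B.label = Y.point
    · exact C.isCover_to_base (smashObjMap_obj_of_eq f hB) _ _
    · have := C.isCover_eqToHom (fun i => (A i).obj) (fun i => (smashObjMap f (A i)).obj)
        (fun i => (φ i).hom) (fun i => smashObjMap_source f (φ i) hB)
        (smashObjMap_obj_of_ne f hB).symm h
      show C.IsCover (fun i => (smashObjMap f (A i)).obj) (fun i => (smashHomMap f (φ i)).hom)
      refine cast (congrArg _ (funext fun i => ?_)) this
      exact (smashHomMap_hom_of_ne f (φ i) hB).symm

end SmashMap

lemma smashObjMap_id {X : Pointed.{0}} {C : CatFam.{u}} (P : SmashObj X C) :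
    smashObjMap (𝟙 X) P = P := by
  apply SmashObj.ext
  · rfl
  · by_cases h : (𝟙 X : X ⟶ X).toFun P.label = X.point
    · rw [smashObjMap_obj_of_eq _ h]
      exact (P.compat.1 h).symm
    · exact smashObjMap_obj_of_ne _ h

lemma smashObjMap_comp {X Y Z : Pointed.{0}} (f : X ⟶ Y) (g : Y ⟶ Z) {C : CatFam.{u}}
    (P : SmashObj X C) : smashObjMap (f ≫ g) P = smashObjMap g (smashObjMap f P) := by
  apply SmashObj.ext
  · rfl
  · by_cases h : g.toFun (f.toFun P.label) = Z.point
    · rw [smashObjMap_obj_of_eq _ h, smashObjMap_obj_of_eq]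
      exact h
    · have h' : f.toFun P.label ≠ Y.point := fun h' => h (by rw [h', g.map_point])
      rw [smashObjMap_obj_of_ne _ h, smashObjMap_obj_of_ne, smashObjMap_obj_of_ne f h']
      exact h

lemma smashHom_eqToHom {X : Pointed.{0}} {C : CatFam.{u}} {P Q : SmashObj X C} (h : P = Q) :
    (eqToHom h : P ⟶ Q).hom = eqToHom (congrArg SmashObj.obj h) := by
  subst h
  rfl

/-- The functor `X ↦ X ∧ C` from pointed sets to categories with covering families. -/
def smashing (C : CatFam.{u}) : Pointed.{0} ⥤ CatFam.{u} where
  obj X := smash X C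
  map f := smashMap f C
  map_id X := by
    apply CatFam.Hom.ext
    refine CategoryTheory.Functor.ext (C := SmashObj X C) (D := SmashObj X C)
      smashObjMap_id fun P Q φ => SmashHom.ext ?_
    change (smashHomMap (𝟙 X) φ).hom = (eqToHom _ ≫ φ ≫ eqToHom _ : smashObjMap (𝟙 X) P ⟶ _).hom
    by_cases h : (𝟙 X : X ⟶ X).toFun Q.label = X.point
    · exact hom_ext_of_target_base (smashObjMap_obj_of_eq _ h) _ _
    · rw [smashHomMap_hom_of_ne _ _ h]
      simp [smashHom_eqToHom]
      congr 2
      exact (smashHom_eqToHom (smashObjMap_id Q).symm).symm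
  map_comp {X Y Z} f g := by
    apply CatFam.Hom.ext
    refine CategoryTheory.Functor.ext (C := SmashObj X C) (D := SmashObj Z C)
      (smashObjMap_comp f g) fun P Q φ => SmashHom.ext ?_
    change (smashHomMap (f ≫ g) φ).hom = (eqToHom _ ≫ smashHomMap g (smashHomMap f φ) ≫ eqToHom _ :
      smashObjMap (f ≫ g) P ⟶ _).hom
    by_cases h : g.toFun (f.toFun Q.label) = Z.point
    · exact hom_ext_of_target_base (smashObjMap_obj_of_eq _ h) _ _
    · have h' : f.toFun Q.label ≠ Y.point := fun h' => h (by rw [h', g.map_point])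
      rw [smashHomMap_hom_of_ne (f ≫ g) φ h]
      simp [smashHom_eqToHom, smashHomMap_hom_of_ne g (smashHomMap f φ) h,
        smashHomMap_hom_of_ne f φ h']
      congr 2
      exact (eqToHom_trans _ _).symm.trans
        (congrArg (_ ≫ ·) (smashHom_eqToHom (smashObjMap_comp f g Q).symm).symm)

/-! ### The category of covers -/

/-- An object of the category of covers `W(C)`: a finite tuple of objects of `C°`. The tuple is
indexed by a finite set `I` of natural numbers; it is stored as a sequence that takes the value `*`
outside `I` (and an object of `C°` at each element of `I`). -/
@[ext]
structure Cov (C : CatFam.{u}) : Type u where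
  tuple : ℕ → C.carrier
  finite : {i | tuple i ≠ C.base}.Finite

/-- The finite index set `I` of a tuple. -/
def Cov.Idx {C : CatFam.{u}} (A : Cov C) : Type := {i : ℕ // A.tuple i ≠ C.base}

instance {C : CatFam.{u}} (A : Cov C) : Finite A.Idx := A.finite.to_subtype

/-- The object of `C°` at an index of a tuple. -/
def Cov.at {C : CatFam.{u}} (A : Cov C) (i : A.Idx) : C.carrier := A.tuple i.1

/-- A morphism in the category of covers: a map `f : I → J` of index sets and, for each `j` in `J`,
a covering family `{A i ⟶ B j}` indexed by the `i` with `f i = j`. -/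
structure CovHom {C : CatFam.{u}} (A B : Cov C) : Type u where
  idx : A.Idx → B.Idx
  map : ∀ (i : A.Idx) (j : B.Idx), idx i = j → (A.at i ⟶ B.at j)
  cover : ∀ j : B.Idx, C.IsCover (I := {i : A.Idx // idx i = j}) (fun i => A.at i.1)
    (fun i => map i.1 j i.2)

lemma CovHom.ext' {C : CatFam.{u}} {A B : Cov C} {f g : CovHom A B} (h : ∀ i, f.idx i = g.idx i)
    (h' : ∀ i j (hf : f.idx i = j) (hg : g.idx i = j), f.map i j hf = g.map i j hg) : f = g := by
  obtain ⟨f1, f2, f3⟩ := f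
  obtain ⟨g1, g2, g3⟩ := g
  obtain rfl : f1 = g1 := funext h
  obtain rfl : f2 = g2 := by
    funext i j hij
    exact h' i j hij hij
  rfl

instance (C : CatFam.{u}) : SmallCategory (Cov C) where
  Hom := CovHom
  id A :=
    { idx := id
      map := fun i j h => eqToHom (congrArg A.at h)
      cover := fun j => by
        have := C.cover_reindex (J := {i : A.Idx // id i = j}) (I := Unit)
          ⟨fun _ => (), fun _ => ⟨j, rfl⟩, fun x => Subtype.ext x.2.symm, fun _ => rfl⟩ _ _
          (C.cover_id (A.at j))
        have := C.isCover_eqToHom _ (fun i : {i : A.Idx // id i = j} => A.at i.1) _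
          (fun i => congrArg A.at i.2) rfl this
        simpa using this }
  comp {A B D} f g :=
    { idx := g.idx ∘ f.idx
      map := fun i k h => f.map i (f.idx i) rfl ≫ g.map (f.idx i) k h
      cover := fun k => by
        have := C.cover_reindex (J := {i : A.Idx // g.idx (f.idx i) = k})
          (I := Σ j : {j : B.Idx // g.idx j = k}, {i : A.Idx // f.idx i = j.1})
          ⟨fun i => ⟨⟨f.idx i.1, i.2⟩, ⟨i.1, rfl⟩⟩, fun p => ⟨p.2.1, (congrArg g.idx p.2.2).trans p.1.2⟩,
            fun _ => rfl, by
              rintro ⟨⟨j, hj⟩, ⟨i, hi⟩⟩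
              change f.idx i = j at hi
              subst hi
              rfl⟩ _ _
          (C.cover_comp _ _ _ _ (g.cover k) (fun j => f.cover j.1))
        exact this }
  id_comp f := CovHom.ext' (fun _ => rfl) (fun _ _ _ _ => Category.id_comp _)
  comp_id f := CovHom.ext' (fun _ => rfl) (fun i j hf hg => by cases hg; exact Category.comp_id _)
  assoc f g h := CovHom.ext' (fun _ => rfl) (fun _ _ _ _ => Category.assoc _ _ _)

/-- The basepoint of the category of covers: the empty tuple. -/
def Cov.empty (C : CatFam.{u}) : Cov C := ⟨fun _ => C.base, by simp⟩

section CovMap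

variable {C D : CatFam.{u}} (F : CatFam.Hom C D)

/-- Apply `F` to the entries of a tuple; the entries sent to the basepoint are dropped. -/
def Cov.mapObj (A : Cov C) : Cov D where
  tuple i := F.functor.obj (A.tuple i)
  finite := A.finite.subset fun i hi h => hi (by rw [h]; exact F.map_base)

/-- The indices of `F A` are among those of `A`. -/
def Cov.incl (A : Cov C) (i : (A.mapObj F).Idx) : A.Idx :=
  ⟨i.1, fun h => i.2 ((congrArg F.functor.obj h).trans F.map_base)⟩

lemma ne_base_of_hom {c d : C.carrier} (f : c ⟶ d) (h : c ≠ C.base) : d ≠ C.base := by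
  rintro rfl
  exact h (C.eq_base f)

/-- The map of index sets of `F f`: the restriction of the one of `f`. -/
def Cov.mapIdx {A B : Cov C} (f : A ⟶ B) (i : (A.mapObj F).Idx) : (B.mapObj F).Idx :=
  ⟨(f.idx (A.incl F i)).1,
    ne_base_of_hom (C := D) (F.functor.map (f.map (A.incl F i) _ rfl)) i.2⟩

/-- The functor `W(C) ⥤ W(D)` induced by a morphism of categories with covering families. -/
def Cov.map : Cov C ⥤ Cov D where
  obj := Cov.mapObj F
  map {A B} f :=
    { idx := Cov.mapIdx F f
      map := fun i j h => F.functor.map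
        (f.map (A.incl F i) (B.incl F j) (congrArg (B.incl F) h))
      cover := fun j => by
        have h := F.map_cover _ _ (f.cover (B.incl F j))
        refine D.isCover_drop _ _ h
          (fun i : {i : (A.mapObj F).Idx // Cov.mapIdx F f i = j} =>
            (⟨A.incl F i.1, congrArg (B.incl F) i.2⟩ :
              {i : A.Idx // f.idx i = B.incl F j})) ?_ ?_
        · intro i i' h
          exact Subtype.ext (Subtype.ext (congrArg (fun x => x.1.1) h))
        · intro i hi
          exact ⟨⟨⟨i.1.1, hi⟩, Subtype.ext (congrArg (fun x : B.Idx => x.1) i.2)⟩, rfl⟩ }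
  map_id A := CovHom.ext' (fun _ => rfl) (fun i j hf hg => by cases hg; exact F.functor.map_id _)
  map_comp f g := CovHom.ext' (fun _ => rfl) (fun i j hf hg => by
    cases hg; exact F.functor.map_comp _ _)

lemma Cov.map_empty : (Cov.map F).obj (Cov.empty C) = Cov.empty D :=
  Cov.ext (funext fun _ => F.map_base)

end CovMap

/-- The pointed simplicial set `N W(C)`, functorially in `C`. -/
def nerveW : CatFam.{u} ⥤ SimplicialObject Pointed.{u} where
  obj C :=
    { obj := fun n => ⟨(nerve (Cov C)).obj n, (Functor.const _).obj (Cov.empty C)⟩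
      map := fun θ => ⟨(nerve (Cov C)).map θ, rfl⟩ }
  map F :=
    { app := fun n => ⟨(nerveMap (Cov.map F)).app n, by
        refine CategoryTheory.Functor.ext (fun _ => Cov.map_empty F) fun i j f => ?_
        change (Cov.map F).map (𝟙 _) = eqToHom _ ≫ 𝟙 _ ≫ eqToHom _
        rw [CategoryTheory.Functor.map_id]
        exact ((congrArg (_ ≫ ·) (Category.id_comp _)).trans (eqToHom_trans _ _)).symm⟩
      naturality := fun _ _ θ => Pointed.Hom.ext (by
        funext x
        exact (ConcreteCategory.congr_hom ((nerveMap (Cov.map F)).naturality θ) x)) }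
  map_id C := rfl
  map_comp F G := rfl

/-! ### Γ-spaces and simplicial spheres -/

/-- The category of finite pointed sets. -/
abbrev FinPtd : Type 1 := ObjectProperty.FullSubcategory (fun X : Pointed.{0} => Finite X)

instance (X : FinPtd) : Finite X.obj := X.property

/-- A Γ-space: a functor from finite pointed sets to pointed simplicial sets that sends one-point
sets to one-point simplicial sets. -/
structure GammaSpace : Type (u + 1) where
  functor : FinPtd ⥤ SimplicialObject Pointed.{u}
  reduced : ∀ X : FinPtd, Subsingleton X.obj → ∀ n, Subsingleton ((functor.obj X).obj n)

instance (X : Pointed.{0}) [Subsingleton X] (C : CatFam.{u}) : Subsingleton (Cov (smash X C)) where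
  allEq A B := by
    have h : ∀ P Q : SmashObj X C, P = Q := fun P Q => by
      apply SmashObj.ext
      · exact Subsingleton.elim _ _
      · rw [P.compat.1 (Subsingleton.elim _ _), Q.compat.1 (Subsingleton.elim _ _)]
    exact Cov.ext (funext fun i => h _ _)

instance (X : Pointed.{0}) [Subsingleton X] (C : CatFam.{u}) (A B : Cov (smash X C)) :
    Subsingleton (A ⟶ B) where
  allEq f g := by
    have h : ∀ i : A.Idx, False := fun i => by
      have : A = Cov.empty (smash X C) := Subsingleton.elim _ _
      subst this
      exact i.2 rfl
    exact CovHom.ext' (fun i => (h i).elim) (fun i => (h i).elim)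

/-- The Γ-space `X ↦ N W(X ∧ C)`. -/
def gammaK (C : CatFam.{u}) : GammaSpace.{u} where
  functor := ObjectProperty.ι _ ⋙ smashing C ⋙ nerveW
  reduced X hX n := by
    refine ⟨fun (F G : Fin (n.unop.len + 1) ⥤ Cov (smash X.obj C)) => ?_⟩
    exact CategoryTheory.Functor.ext (fun _ => Subsingleton.elim _ _)
      fun _ _ _ => Subsingleton.elim _ _

section EilenbergMacLane

variable (A : Type u) [AddCommGroup A]

/-- The pointed set `X ⊗ A`, the direct sum of copies of `A` indexed by the non-basepoint elements
of `X`. A map of pointed sets deletes the summands sent to the basepoint and acts on the indices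
of the others. -/
def tensor : Pointed.{0} ⥤ Pointed.{u} where
  obj X := ⟨{x : X // x ≠ X.point} →₀ A, 0⟩
  map {X Y} f := ⟨fun a => Finsupp.subtypeDomain (fun y => y ≠ Y.point)
    (Finsupp.mapDomain (fun x : {x : X // x ≠ X.point} => f.toFun x.1) a), by simp⟩
  map_id X := by
    apply Pointed.Hom.ext
    funext a
    ext x
    exact Finsupp.mapDomain_apply Subtype.val_injective a x
  map_comp {X Y Z} f g := by
    apply Pointed.Hom.ext
    funext a
    change _ = Finsupp.subtypeDomain _ (Finsupp.mapDomain _ (Finsupp.subtypeDomain _ _))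
    induction a using Finsupp.induction_linear with
    | zero => simp
    | add a b ha hb =>
      simp only [Finsupp.mapDomain_add, Finsupp.subtypeDomain_add] at ha hb ⊢
      rw [ha, hb]
    | single x a =>
      by_cases h : f.toFun x.1 = Y.point
      · have h1 : Finsupp.subtypeDomain (fun y => y ≠ Y.point)
            (Finsupp.single (f.toFun x.1) a) = 0 := by
          ext y
          exact Finsupp.single_eq_of_ne (fun h' => y.2 (h'.trans h))
        have h2 : Finsupp.subtypeDomain (fun z => z ≠ Z.point)
            (Finsupp.single (g.toFun (f.toFun x.1)) a) = 0 := by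
          ext z
          exact Finsupp.single_eq_of_ne (fun h' => z.2 (h'.trans (by rw [h, g.map_point])))
        simp [h1, h2]
      · have h1 : Finsupp.subtypeDomain (fun y => y ≠ Y.point)
            (Finsupp.single (f.toFun x.1) a) = Finsupp.single ⟨f.toFun x.1, h⟩ a := by
          classical
          ext y
          simp [Finsupp.single_apply, Subtype.ext_iff]
        simp [h1]

/-- The Γ-space `X ↦ X ⊗ A` (discrete), which defines the Eilenberg–MacLane spectrum. -/
def gammaH : GammaSpace.{u} where
  functor := ObjectProperty.ι _ ⋙ tensor A ⋙ Functor.const _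
  reduced X hX n := by
    refine ⟨fun (a b : {x : X.obj // x ≠ X.obj.point} →₀ A) => ?_⟩
    have := hX
    exact Finsupp.ext fun x => absurd (Subsingleton.elim _ _) x.2

end EilenbergMacLane

/-- The relation on `X × Y` that identifies all points of `X ∨ Y` with each other. -/
def wedgeRel (X Y : Pointed.{0}) (p q : X × Y) : Prop :=
  (p.1 = X.point ∨ p.2 = Y.point) ∧ (q.1 = X.point ∨ q.2 = Y.point)

/-- The smash product `X × Y / X ∨ Y` of finite pointed sets. -/
def smashPtd (X Y : FinPtd) : FinPtd :=
  ⟨⟨Quot (wedgeRel X.obj Y.obj), Quot.mk _ (X.obj.point, Y.obj.point)⟩,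
    Finite.of_surjective _ Quot.mk_surjective⟩

/-- The map of smash products induced by two maps of finite pointed sets. -/
def smashPtdMap {X X' Y Y' : FinPtd} (f : X ⟶ X') (g : Y ⟶ Y') : smashPtd X Y ⟶ smashPtd X' Y' :=
  ObjectProperty.homMk
    ⟨Quot.map (Prod.map f.hom.toFun g.hom.toFun) (by
      rintro ⟨x, y⟩ ⟨x', y'⟩ ⟨h, h'⟩
      refine ⟨?_, ?_⟩
      · rcases h with h | h
        · exact Or.inl ((congrArg f.hom.toFun h).trans f.hom.map_point)
        · exact Or.inr ((congrArg g.hom.toFun h).trans g.hom.map_point)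
      · rcases h' with h | h
        · exact Or.inl ((congrArg f.hom.toFun h).trans f.hom.map_point)
        · exact Or.inr ((congrArg g.hom.toFun h).trans g.hom.map_point)),
      congrArg (Quot.mk _) (Prod.ext f.hom.map_point g.hom.map_point)⟩

/-- The map `X ⟶ X ∧ Y`, `x ↦ x ∧ y`, for a fixed `y`. -/
def smashWith {X Y : FinPtd} (y : Y.obj) : X ⟶ smashPtd X Y :=
  ObjectProperty.homMk ⟨fun x => Quot.mk _ (x, y), Quot.sound ⟨Or.inl rfl, Or.inl rfl⟩⟩

/-- The dimensionwise smash product of simplicial finite pointed sets. -/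
def smashSimplicial (S T : SimplicialObject FinPtd) : SimplicialObject FinPtd where
  obj n := smashPtd (S.obj n) (T.obj n)
  map θ := smashPtdMap (S.map θ) (T.map θ)
  map_id n := by
    apply ObjectProperty.hom_ext
    apply Pointed.Hom.ext
    funext x
    obtain ⟨⟨x, y⟩, rfl⟩ := Quot.mk_surjective x
    simp [smashPtdMap, smashPtd]
    rfl
  map_comp θ η := by
    apply ObjectProperty.hom_ext
    apply Pointed.Hom.ext
    funext x
    obtain ⟨⟨x, y⟩, rfl⟩ := Quot.mk_surjective x
    simp [smashPtdMap, smashPtd]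
    rfl

/-- The `n`-simplices of the standard simplicial interval `Δ[1]`. -/
abbrev Delta1 (n : SimplexCategoryᵒᵖ) : Type := unop n ⟶ SimplexCategory.mk 1

/-- Two simplices of `Δ[1]` that lie in the boundary, that is, are constant maps. -/
def boundaryRel (n : SimplexCategoryᵒᵖ) (α β : Delta1 n) : Prop :=
  (∀ i j, α i = α j) ∧ (∀ i j, β i = β j)

/-- The simplicial circle `Δ[1] / ∂Δ[1]`. -/
def circle : SimplicialObject FinPtd where
  obj n := ⟨⟨Quot (boundaryRel n), Quot.mk _ (SimplexCategory.const _ _ 0)⟩,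
    Finite.of_surjective _ Quot.mk_surjective⟩
  map θ := ObjectProperty.homMk
    ⟨Quot.map (fun α => θ.unop ≫ α) (fun _ _ h => ⟨fun i j => h.1 _ _, fun i j => h.2 _ _⟩), rfl⟩
  map_id n := by
    apply ObjectProperty.hom_ext
    apply Pointed.Hom.ext
    funext x
    obtain ⟨x, rfl⟩ := Quot.mk_surjective x
    simp
    rfl
  map_comp θ η := by
    apply ObjectProperty.hom_ext
    apply Pointed.Hom.ext
    funext x
    obtain ⟨x, rfl⟩ := Quot.mk_surjective x
    simp
    rfl

/-- The pointed set `S⁰` with two elements. -/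
def sphereZero : FinPtd := ⟨⟨Bool, false⟩, inferInstanceAs (Finite Bool)⟩

/-- The simplicial `k`-sphere, the `k`-fold smash power of the simplicial circle. -/
def sphere : ℕ → SimplicialObject FinPtd
  | 0 => (Functor.const _).obj sphereZero
  | k + 1 => smashSimplicial (sphere k) circle

/-- Level `k` of the spectrum associated to a Γ-space `F`, as a pointed simplicial set:
the diagonal `p ↦ F(S^k_p)_p`. -/
def GammaSpace.level (F : GammaSpace.{u}) (k : ℕ) : SimplicialObject Pointed.{u} where
  obj p := (F.functor.obj ((sphere k).obj p)).obj p
  map θ := (F.functor.map ((sphere k).map θ)).app _ ≫ (F.functor.obj _).map θ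
  map_id p := by simp
  map_comp θ η := by simp

/-! ### Triangulating prisms

For a point `u` of the topological simplex `Δⁿ` and `a = 1 - t` in `[0,1]`, the mass of `u` is cut
at height `a` into a lower part and an upper part. The point `(u, t)` of `Δⁿ × [0,1]` then lies in
the `i`-th simplex of the standard triangulation of the prism, where the lower part is supported
on `{0, …, i}` and the upper part on `{i, …, n}`. -/

section Prism

/-- Push forward of a function along a map of finite sets. -/
abbrev push {α β : Type} [Fintype α] [Fintype β] (f : α → β) : (α → ℝ) →ₗ[ℝ] (β → ℝ) :=
  FunOnFinite.linearMap ℝ ℝ f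

lemma push_congr {α β : Type} [Fintype α] [Fintype β] {f g : α → β} {w : α → ℝ}
    (h : ∀ j, w j ≠ 0 → f j = g j) : push f w = push g w := by
  classical
  funext b
  simp only [FunOnFinite.linearMap_apply_apply, Finset.sum_filter]
  refine Finset.sum_congr rfl fun j _ => ?_
  by_cases hj : w j = 0
  · simp [hj]
  · rw [h j hj]

lemma push_eq_self {α : Type} [Fintype α] {f : α → α} {w : α → ℝ}
    (h : ∀ j, w j ≠ 0 → f j = j) : push f w = w := by
  rw [push_congr (g := id) h]
  simp [push, FunOnFinite.linearMap_id]

lemma push_push {α β γ : Type} [Fintype α] [Fintype β] [Fintype γ] (f : α → β) (g : β → γ)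
    (w : α → ℝ) : push g (push f w) = push (g ∘ f) w := by
  simp [push, FunOnFinite.linearMap_comp]

lemma push_apply_eq_zero {α β : Type} [Fintype α] [Fintype β] {f : α → β} {w : α → ℝ} {b : β}
    (h : ∀ j, f j = b → w j = 0) : push f w b = 0 := by
  classical
  rw [FunOnFinite.linearMap_apply_apply]
  exact Finset.sum_eq_zero fun j hj => h j (Finset.mem_filter.1 hj).2

lemma push_nonneg {α β : Type} [Fintype α] [Fintype β] {f : α → β} {w : α → ℝ}
    (h : ∀ j, 0 ≤ w j) (b : β) : 0 ≤ push f w b := by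
  classical
  rw [FunOnFinite.linearMap_apply_apply]
  exact Finset.sum_nonneg fun j _ => h j

lemma sum_push {α β : Type} [Fintype α] [Fintype β] (f : α → β) (w : α → ℝ) :
    ∑ b, push f w b = ∑ a, w a := by
  classical
  simp only [FunOnFinite.linearMap_apply_apply]
  exact Finset.sum_fiberwise Finset.univ f w

/-- The mass of `{j | j < l}`. -/
def cum {N : ℕ} (u : Fin N → ℝ) (l : ℕ) : ℝ := ∑ j : Fin N, if (j : ℕ) < l then u j else 0

/-- The part of the mass below height `a`. -/
def low {N : ℕ} (a : ℝ) (u : Fin N → ℝ) (j : Fin N) : ℝ := min (cum u (j + 1)) a - min (cum u j) a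

/-- The part of the mass above height `a`. -/
def high {N : ℕ} (a : ℝ) (u : Fin N → ℝ) (j : Fin N) : ℝ := u j - low a u j

variable {N M : ℕ} {u : Fin N → ℝ} {a : ℝ}

lemma cum_succ (u : Fin N → ℝ) (j : Fin N) : cum u (j + 1) = cum u j + u j := by
  have : u j = ∑ i, if i = j then u i else 0 := by simp
  rw [cum, cum, this, ← Finset.sum_add_distrib]
  refine Finset.sum_congr rfl fun i _ => ?_
  rcases lt_trichotomy (i : ℕ) (j : ℕ) with h | h | h
  · have h' : i ≠ j := fun e => by simp [e] at h
    simp [h, h', Nat.lt_succ_of_lt h]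
  · have h' : i = j := Fin.ext h
    simp [h']
  · have h' : i ≠ j := fun e => by simp [e] at h
    simp [h', not_lt.2 h.le, show ¬ ((i : ℕ) < j + 1) by lia]

lemma cum_zero (u : Fin N → ℝ) : cum u 0 = 0 := by simp [cum]

lemma cum_mono (hu : ∀ j, 0 ≤ u j) : Monotone (cum u) := fun l m h =>
  Finset.sum_le_sum fun j _ => by
    by_cases h1 : (j : ℕ) < l
    · simp [h1, lt_of_lt_of_le h1 h]
    · simp only [h1, if_false]
      split_ifs
      · exact hu j
      · exact le_rfl

lemma low_nonneg (hu : ∀ j, 0 ≤ u j) (j : Fin N) : 0 ≤ low a u j :=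
  sub_nonneg.2 (min_le_min_right a (cum_mono hu (Nat.le_succ _)))

lemma high_nonneg (hu : ∀ j, 0 ≤ u j) (j : Fin N) : 0 ≤ high a u j := by
  have h1 := cum_succ u j
  have h2 := hu j
  rw [high, low]
  rcases le_total (cum u (j + 1)) a with h | h <;> rcases le_total (cum u j) a with h' | h' <;>
    simp only [min_eq_left h, min_eq_right h, min_eq_left h', min_eq_right h'] <;> linarith

lemma cum_low (ha : 0 ≤ a) (u : Fin N → ℝ) (l : ℕ) (hl : l ≤ N) :
    cum (low a u) l = min (cum u l) a := by
  induction l with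
  | zero => simp [cum_zero, ha]
  | succ l ih =>
    have h1 := cum_succ (low a u) ⟨l, hl⟩
    have h2 := ih (by lia)
    simp only at h1
    rw [h1, h2, low]
    ring

/-- Preimages of initial segments under a monotone map are initial segments. -/
lemma exists_initial {θ : Fin N → Fin M} (hθ : Monotone θ) (l : ℕ) :
    ∃ b ≤ N, ∀ j : Fin N, (θ j : ℕ) < l ↔ (j : ℕ) < b := by
  classical
  by_cases h : ∃ k : ℕ, ∃ hk : k < N, l ≤ (θ ⟨k, hk⟩ : ℕ)
  · obtain ⟨hk, hk'⟩ := Nat.find_spec h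
    refine ⟨Nat.find h, hk.le, fun j => ⟨fun hj => ?_, fun hj => ?_⟩⟩
    · by_contra hc
      have : θ ⟨Nat.find h, hk⟩ ≤ θ j := hθ (not_lt.1 hc)
      have : (θ ⟨Nat.find h, hk⟩ : ℕ) ≤ θ j := this
      lia
    · by_contra hc
      exact Nat.find_min h hj ⟨j.2, not_lt.1 hc⟩
  · push Not at h
    exact ⟨N, le_rfl, fun j => ⟨fun _ => j.2, fun _ => h j j.2⟩⟩

lemma cum_push (θ : Fin N → Fin M) (u : Fin N → ℝ) (l : ℕ) :
    cum (push θ u) l = ∑ j, if (θ j : ℕ) < l then u j else 0 := by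
  classical
  rw [cum]
  have : ∀ b : Fin M, (if (b : ℕ) < l then push θ u b else 0) =
      ∑ j with θ j = b, if (θ j : ℕ) < l then u j else 0 := by
    intro b
    rw [FunOnFinite.linearMap_apply_apply]
    split_ifs with h
    · exact Finset.sum_congr rfl fun j hj => by rw [(Finset.mem_filter.1 hj).2, if_pos h]
    · exact (Finset.sum_eq_zero fun j hj => by rw [(Finset.mem_filter.1 hj).2, if_neg h]).symm
  rw [Finset.sum_congr rfl fun b _ => this b]
  exact Finset.sum_fiberwise Finset.univ θ _

lemma push_low (ha : 0 ≤ a) {θ : Fin N → Fin M} (hθ : Monotone θ) (u : Fin N → ℝ) :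
    push θ (low a u) = low a (push θ u) := by
  have key : ∀ l, cum (push θ (low a u)) l = min (cum (push θ u) l) a := by
    intro l
    obtain ⟨b, hb, h⟩ := exists_initial hθ l
    rw [cum_push, cum_push]
    simp only [h]
    exact cum_low ha u b hb
  funext j
  have := cum_succ (push θ (low a u)) j
  rw [key, key] at this
  rw [low]
  linarith

lemma push_high (ha : 0 ≤ a) {θ : Fin N → Fin M} (hθ : Monotone θ) (u : Fin N → ℝ) :
    push θ (high a u) = high a (push θ u) := by
  have : high a u = u - low a u := rfl
  rw [this, map_sub, push_low ha hθ]
  rfl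

/-- `(u, 1 - a)` lies in the `i`-th simplex of the prism. -/
def InPrism (a : ℝ) (u : Fin N → ℝ) (i : Fin N) : Prop :=
  (∀ j, i < j → low a u j = 0) ∧ (∀ j, j < i → high a u j = 0)

lemma exists_inPrism [NeZero N] (hu : ∀ j, 0 ≤ u j) (ha : 0 ≤ a) : ∃ i, InPrism a u i := by
  classical
  have h0 : (Finset.univ.filter fun j : Fin N => cum u j ≤ a).Nonempty :=
    ⟨0, by simp [cum_zero, ha]⟩
  refine ⟨(Finset.univ.filter fun j : Fin N => cum u j ≤ a).max' h0, fun j hj => ?_,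
    fun j hj => ?_⟩
  · have h1 : a < cum u j := by
      by_contra hc
      exact absurd (Finset.le_max' _ j (by simpa using hc)) (not_le.2 hj)
    have h2 : a ≤ cum u (j + 1) := h1.le.trans (cum_mono hu (Nat.le_succ _))
    rw [low, min_eq_right h1.le, min_eq_right h2, sub_self]
  · have h1 : cum u ((Finset.univ.filter fun j : Fin N => cum u j ≤ a).max' h0 : Fin N) ≤ a := by
      have := Finset.max'_mem _ h0
      simpa using this
    have h2 : cum u (j + 1) ≤ a := (cum_mono hu hj).trans h1
    have h3 : cum u j ≤ a := (cum_mono hu (Nat.le_succ _)).trans h2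
    rw [high, low, min_eq_left h2, min_eq_left h3, cum_succ]
    ring

lemma inPrism_push (ha : 0 ≤ a) {θ : Fin N → Fin M} (hθ : Monotone θ) {i : Fin N}
    (h : InPrism a u i) : InPrism a (push θ u) (θ i) := by
  constructor
  · intro j hj
    rw [← push_low ha hθ]
    refine push_apply_eq_zero fun k hk => h.1 k ?_
    by_contra hc
    exact absurd (hθ (not_lt.1 hc)) (not_le.2 (hk ▸ hj))
  · intro j hj
    rw [← push_high ha hθ]
    refine push_apply_eq_zero fun k hk => h.2 k ?_
    by_contra hc
    exact absurd (hθ (not_lt.1 hc)) (not_le.2 (hk ▸ hj))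

/-- The barycentric coordinates of `(u, 1 - a)` in the simplex of the prism that contains it. -/
def prismCoord (a : ℝ) (u : Fin N → ℝ) : Fin (N + 1) → ℝ :=
  push Fin.castSucc (low a u) + push Fin.succ (high a u)

lemma prismCoord_mem (hu : u ∈ stdSimplex ℝ (Fin N)) : prismCoord a u ∈ stdSimplex ℝ (Fin (N + 1)) := by
  refine ⟨fun j => add_nonneg (push_nonneg (low_nonneg hu.1) j) (push_nonneg (high_nonneg hu.1) j),
    ?_⟩
  simp only [prismCoord, Pi.add_apply, Finset.sum_add_distrib, sum_push]
  rw [← Finset.sum_add_distrib, ← hu.2]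
  exact Finset.sum_congr rfl fun j _ => by rw [high]; ring

lemma prismCoord_support {i i' : Fin N} (h : InPrism a u i) (h' : InPrism a u i')
    {l : Fin (N + 1)} (hl : prismCoord a u l ≠ 0) : l ≤ i.castSucc ∨ i'.succ ≤ l := by
  by_contra! hc
  refine hl ?_
  rw [prismCoord, Pi.add_apply, push_apply_eq_zero, push_apply_eq_zero, add_zero]
  · intro j hj
    refine h'.2 j ?_
    have := hc.2
    rw [← hj] at this
    exact Fin.succ_lt_succ_iff.1 this
  · intro j hj
    refine h.1 j ?_
    have := hc.1
    rw [← hj] at this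
    exact Fin.castSucc_lt_castSucc_iff.1 this

/-- The map induced by `θ` on the vertices of the prism simplex with index `i`. -/
def prismMap (θ : Fin N → Fin M) (i : Fin N) (l : Fin (N + 1)) : Fin (M + 1) :=
  if l ≤ i.castSucc then (θ (i.predAbove l)).castSucc else (θ (i.predAbove l)).succ

lemma prismCoord_push (ha : 0 ≤ a) {θ : Fin N → Fin M} (hθ : Monotone θ) {i : Fin N}
    (h : InPrism a u i) : push (prismMap θ i) (prismCoord a u) = prismCoord a (push θ u) := by
  rw [prismCoord, prismCoord, map_add, push_push, push_push, ← push_low ha hθ, ← push_high ha hθ,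
    push_push, push_push]
  congr 1
  · refine push_congr fun j hj => ?_
    have hji : j ≤ i := by
      by_contra hc
      exact hj (h.1 j (not_le.1 hc))
    simp [prismMap, hji, Fin.predAbove_castSucc_of_le _ _ hji]
  · refine push_congr fun j hj => ?_
    have hji : i ≤ j := by
      by_contra hc
      exact hj (h.2 j (not_le.1 hc))
    have h2 : ¬ (j.succ ≤ i.castSucc) := by
      rw [Fin.le_def]
      have : (i : ℕ) ≤ j := hji
      simp
      lia
    simp only [Function.comp_apply, prismMap, if_neg h2]
    rw [Fin.predAbove_succ_of_le _ _ hji]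

end Prism

/-! ### Geometric realization and homotopies -/

section Realization

/-- The topological simplex of dimension `n`. -/
abbrev Simp (n : SimplexCategoryᵒᵖ) : Type := stdSimplex ℝ (Fin (n.unop.len + 1))

/-- The point of the realization `|X|` with barycentric coordinates `s` in the simplex `x`. -/
def realPoint {X : SSet.{u}} {n : SimplexCategoryᵒᵖ} (x : X.obj n) : C(Simp n, SSet.toTop.obj X) :=
  TopCat.toSSetObjEquiv _ _ ((sSetTopAdj.unit.app X).app n x)

lemma realPoint_map {X : SSet.{u}} {n m : SimplexCategoryᵒᵖ} (θ : n ⟶ m) (x : X.obj n)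
    (s : Simp m) : realPoint (X.map θ x) s = realPoint x (stdSimplex.map θ.unop s) := by
  have := ConcreteCategory.congr_hom ((sSetTopAdj.unit.app X).naturality θ) x
  exact congrArg (fun y => TopCat.toSSetObjEquiv _ _ y s) this

lemma realPoint_app {X Y : SSet.{u}} (g : X ⟶ Y) {n : SimplexCategoryᵒᵖ} (x : X.obj n)
    (s : Simp n) : SSet.toTop.map g (realPoint x s) = realPoint (g.app n x) s := by
  have := NatTrans.congr_app (sSetTopAdj.unit.naturality g) n
  have := ConcreteCategory.congr_hom this x
  exact (congrArg (fun y => TopCat.toSSetObjEquiv _ _ y s) this).symm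

/-- The continuous map `|X| ⟶ Z` adjoint to a map from `X` to the singular simplicial set of `Z`. -/
def realDesc {X : SSet.{u}} {Z : TopCat.{u}} (f : X ⟶ TopCat.toSSet.obj Z) :
    SSet.toTop.obj X ⟶ Z :=
  (sSetTopAdj.homEquiv X Z).symm f

lemma realDesc_realPoint {X : SSet.{u}} {Z : TopCat.{u}} (f : X ⟶ TopCat.toSSet.obj Z)
    {n : SimplexCategoryᵒᵖ} (x : X.obj n) (s : Simp n) :
    realDesc f (realPoint x s) = TopCat.toSSetObjEquiv _ _ (f.app n x) s := by
  have h : f = sSetTopAdj.unit.app X ≫ TopCat.toSSet.map (realDesc f) := by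
    have := (sSetTopAdj.homEquiv X Z).apply_symm_apply f
    rw [sSetTopAdj.homEquiv_unit] at this
    exact this.symm
  conv_rhs => rw [h]
  rfl

lemma real_hom_ext {X : SSet.{u}} {Z : TopCat.{u}} {f g : SSet.toTop.obj X ⟶ Z}
    (h : ∀ (n : SimplexCategoryᵒᵖ) (x : X.obj n) (s : Simp n),
      f (realPoint x s) = g (realPoint x s)) : f = g := by
  apply (sSetTopAdj.homEquiv X Z).injective
  rw [sSetTopAdj.homEquiv_unit, sSetTopAdj.homEquiv_unit]
  ext n x
  apply (TopCat.toSSetObjEquiv Z n).injective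
  ext s
  exact h n x s

variable {X Y : SSet.{u}}

/-- A simplicial map `X × Δ[1] ⟶ Y`. -/
structure Pairing (X Y : SSet.{u}) where
  app : ∀ {n : SimplexCategoryᵒᵖ}, X.obj n → Delta1 n → Y.obj n
  naturality : ∀ {n m : SimplexCategoryᵒᵖ} (θ : n ⟶ m) (x : X.obj n) (α : Delta1 n),
    Y.map θ (app x α) = app (X.map θ x) (θ.unop ≫ α)

/-- The degeneracy `[n+1] ⟶ [n]` that repeats `i`. -/
def degen (n : SimplexCategory) (i : Fin (n.len + 1)) : SimplexCategory.mk (n.len + 1) ⟶ n :=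
  SimplexCategory.Hom.mk ⟨i.predAbove, Fin.predAbove_right_monotone i⟩

/-- The map `[n+1] ⟶ [1]` that takes the value `0` exactly on `{0, …, i}`. -/
def cutoff (n : SimplexCategory) (i : Fin (n.len + 1)) :
    SimplexCategory.mk (n.len + 1) ⟶ SimplexCategory.mk 1 :=
  SimplexCategory.Hom.mk ⟨fun l => if l ≤ i.castSucc then 0 else 1, fun l m h => by
    dsimp only
    by_cases h1 : m ≤ i.castSucc
    · rw [if_pos h1, if_pos (h.trans h1)]
    · rw [if_neg h1]
      exact Fin.le_last _⟩

lemma degen_val (n : SimplexCategory) (i : Fin (n.len + 1)) (l : Fin (n.len + 2)) :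
    ((degen n i l : Fin (n.len + 1)) : ℕ) = if l ≤ i.castSucc then (l : ℕ) else l - 1 := by
  change ((i.predAbove l : Fin (n.len + 1)) : ℕ) = _
  split_ifs with h
  · rw [Fin.predAbove_of_le_castSucc _ _ h]; rfl
  · rw [Fin.predAbove_of_castSucc_lt _ _ (not_le.1 h)]; rfl

lemma cutoff_apply (n : SimplexCategory) (i : Fin (n.len + 1)) (l : Fin (n.len + 2)) :
    cutoff n i l = if l ≤ i.castSucc then 0 else 1 := rfl

/-- The simplex of `Y` that is the image of the `i`-th simplex of the prism on `x`. -/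
def Pairing.prism (b : Pairing X Y) {n : SimplexCategoryᵒᵖ} (x : X.obj n)
    (i : Fin (n.unop.len + 1)) : Y.obj (op (SimplexCategory.mk (n.unop.len + 1))) :=
  b.app (X.map (degen n.unop i).op x) (cutoff n.unop i)

/-- The point of the topological simplex of dimension `n + 1` that corresponds to `(u, 1 - a)`. -/
def prismPt {n : SimplexCategoryᵒᵖ} (a : ℝ) (u : Simp n) :
    Simp (op (SimplexCategory.mk (n.unop.len + 1))) :=
  ⟨prismCoord a u.1, prismCoord_mem u.2⟩

/-- Two simplices that agree on a face have the same realization there. -/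
lemma realPoint_eq_of_retract {n : SimplexCategoryᵒᵖ} (y y' : Y.obj n) (s : Simp n)
    (r : n.unop ⟶ n.unop) (hr : ∀ l, s l ≠ 0 → r l = l) (h : Y.map r.op y = Y.map r.op y') :
    realPoint y s = realPoint y' s := by
  have hs : stdSimplex.map r s = s := stdSimplex.ext (push_eq_self hr)
  have h1 := realPoint_map r.op y s
  have h2 := realPoint_map r.op y' s
  simp only [Quiver.Hom.unop_op] at h1 h2
  rw [hs] at h1 h2
  rw [← h1, ← h2, h]

lemma prism_indep_aux (b : Pairing X Y) {n : SimplexCategoryᵒᵖ} (x : X.obj n) (a : ℝ) (u : Simp n)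
    {i i' : Fin (n.unop.len + 1)} (hii : i < i') (h : InPrism a u.1 i) (h' : InPrism a u.1 i') :
    realPoint (b.prism x i) (prismPt a u) = realPoint (b.prism x i') (prismPt a u) := by
  have hmono : Monotone (fun l : Fin (n.unop.len + 2) =>
      if l ≤ i.castSucc ∨ i'.succ ≤ l then l else i.castSucc) := by
    intro l m hlm
    dsimp only
    have : (i : ℕ) < i' := hii
    split_ifs <;> simp only [Fin.le_def, Fin.val_castSucc, Fin.val_succ] at * <;> lia
  let r : SimplexCategory.mk (n.unop.len + 1) ⟶ SimplexCategory.mk (n.unop.len + 1) :=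
    SimplexCategory.Hom.mk ⟨_, hmono⟩
  have hr : ∀ l, r l = if l ≤ i.castSucc ∨ i'.succ ≤ l then l else i.castSucc := fun _ => rfl
  refine realPoint_eq_of_retract _ _ _ r (fun l hl => ?_) ?_
  · rw [hr, if_pos]
    exact prismCoord_support h h' hl
  · have hi : (i : ℕ) < i' := hii
    have e1 : r ≫ degen n.unop i = r ≫ degen n.unop i' := by
      apply SimplexCategory.Hom.ext
      ext l
      change ((degen n.unop i (r l) : Fin (n.unop.len + 1)) : ℕ) = degen n.unop i' (r l)
      rw [degen_val, degen_val, hr]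
      split_ifs <;> simp only [Fin.le_def, Fin.val_castSucc, Fin.val_succ] at * <;> lia
    have e2 : r ≫ cutoff n.unop i = r ≫ cutoff n.unop i' := by
      apply SimplexCategory.Hom.ext
      refine OrderHom.ext _ _ (funext fun l => ?_)
      change cutoff n.unop i (r l) = cutoff n.unop i' (r l)
      rw [cutoff_apply, cutoff_apply, hr]
      simp only [Fin.le_def, Fin.val_castSucc, Fin.val_succ]
      split_ifs <;> simp only [Fin.val_castSucc] at * <;> first | rfl | (exfalso; lia)
    simp only [Pairing.prism, b.naturality, ← ConcreteCategory.comp_apply, ← X.map_comp, ← op_comp]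
    rw [e1]
    exact congrArg _ e2

lemma prism_indep (b : Pairing X Y) {n : SimplexCategoryᵒᵖ} (x : X.obj n) (a : ℝ) (u : Simp n)
    {i i' : Fin (n.unop.len + 1)} (h : InPrism a u.1 i) (h' : InPrism a u.1 i') :
    realPoint (b.prism x i) (prismPt a u) = realPoint (b.prism x i') (prismPt a u) := by
  rcases lt_trichotomy i i' with hi | rfl | hi
  · exact prism_indep_aux b x a u hi h h'
  · rfl
  · exact (prism_indep_aux b x a u hi h' h).symm

lemma height_nonneg (t : unitInterval) : 0 ≤ 1 - (t : ℝ) := sub_nonneg.2 t.2.2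

/-- The image in `|Y|` of the point `(u, t)` of the prism on the simplex `x` of `X`. -/
def Pairing.fn (b : Pairing X Y) {n : SimplexCategoryᵒᵖ} (x : X.obj n)
    (p : Simp n × unitInterval) : SSet.toTop.obj Y :=
  realPoint (b.prism x (exists_inPrism p.1.2.1 (height_nonneg p.2)).choose)
    (prismPt (1 - (p.2 : ℝ)) p.1)

lemma Pairing.fn_eq (b : Pairing X Y) {n : SimplexCategoryᵒᵖ} (x : X.obj n)
    (u : Simp n) (t : unitInterval) {i : Fin (n.unop.len + 1)} (h : InPrism (1 - (t : ℝ)) u.1 i) :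
    b.fn x (u, t) = realPoint (b.prism x i) (prismPt (1 - (t : ℝ)) u) :=
  prism_indep b x _ u (exists_inPrism u.2.1 (height_nonneg t)).choose_spec h

lemma continuous_low {n : SimplexCategoryᵒᵖ} (j : Fin (n.unop.len + 1)) :
    Continuous fun p : Simp n × unitInterval => low (1 - (p.2 : ℝ)) p.1.1 j := by
  unfold low cum
  have h : ∀ l : ℕ, Continuous fun p : Simp n × unitInterval =>
      ∑ j : Fin (n.unop.len + 1), if (j : ℕ) < l then p.1.1 j else 0 := by
    intro l
    refine continuous_finsetSum _ fun j _ => ?_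
    split_ifs
    · exact (continuous_apply j).comp (continuous_subtype_val.comp continuous_fst)
    · exact continuous_const
  have h2 : Continuous fun p : Simp n × unitInterval => 1 - (p.2 : ℝ) := by fun_prop
  exact ((h _).min h2).sub ((h _).min h2)

lemma continuous_high {n : SimplexCategoryᵒᵖ} (j : Fin (n.unop.len + 1)) :
    Continuous fun p : Simp n × unitInterval => high (1 - (p.2 : ℝ)) p.1.1 j :=
  ((continuous_apply j).comp (continuous_subtype_val.comp continuous_fst)).sub (continuous_low j)

lemma continuous_prismPt {n : SimplexCategoryᵒᵖ} :
    Continuous fun p : Simp n × unitInterval => prismPt (1 - (p.2 : ℝ)) p.1 := by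
  refine Continuous.subtype_mk ?_ _
  exact ((FunOnFinite.continuous_linearMap ℝ ℝ _).comp (continuous_pi continuous_low)).add
    ((FunOnFinite.continuous_linearMap ℝ ℝ _).comp (continuous_pi continuous_high))

lemma isClosed_inPrism {n : SimplexCategoryᵒᵖ} (i : Fin (n.unop.len + 1)) :
    IsClosed {p : Simp n × unitInterval | InPrism (1 - (p.2 : ℝ)) p.1.1 i} := by
  simp only [InPrism, Set.ofPred_and, Set.ofPred_forall]
  exact (isClosed_iInter fun j => isClosed_iInter fun _ =>
      isClosed_eq (continuous_low j) continuous_const).inter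
    (isClosed_iInter fun j => isClosed_iInter fun _ =>
      isClosed_eq (continuous_high j) continuous_const)

lemma Pairing.continuous_fn (b : Pairing X Y) {n : SimplexCategoryᵒᵖ} (x : X.obj n) :
    Continuous (b.fn x) := by
  refine (locallyFinite_of_finite fun i : Fin (n.unop.len + 1) =>
    {p : Simp n × unitInterval | InPrism (1 - (p.2 : ℝ)) p.1.1 i}).continuous ?_
    isClosed_inPrism fun i => ?_
  · refine Set.eq_univ_of_forall fun p => Set.mem_iUnion.2 ?_
    exact exists_inPrism p.1.2.1 (height_nonneg p.2)
  · refine ContinuousOn.congr (f := fun p : Simp n × unitInterval =>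
      realPoint (b.prism x i) (prismPt (1 - (p.2 : ℝ)) p.1)) ?_ fun p hp => b.fn_eq x p.1 p.2 hp
    exact ((realPoint (b.prism x i)).continuous.comp continuous_prismPt).continuousOn

lemma predAbove_le_of_le {N : ℕ} {i : Fin N} {l : Fin (N + 1)} (h : l ≤ i.castSucc) :
    i.predAbove l ≤ i := by
  rw [Fin.predAbove_of_le_castSucc _ _ h, Fin.le_def]
  exact h

lemma le_predAbove_of_lt {N : ℕ} {i : Fin N} {l : Fin (N + 1)} (h : ¬ l ≤ i.castSucc) :
    i ≤ i.predAbove l := by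
  rw [Fin.predAbove_of_castSucc_lt _ _ (not_le.1 h), Fin.le_def]
  have : (i : ℕ) < l := not_le.1 h
  simp only [Fin.val_pred]
  lia

lemma Pairing.fn_map (b : Pairing X Y) {n m : SimplexCategoryᵒᵖ} (θ : n ⟶ m) (x : X.obj n)
    (u : Simp m) (t : unitInterval) :
    b.fn (X.map θ x) (u, t) = b.fn x (stdSimplex.map θ.unop u, t) := by
  obtain ⟨i, hi⟩ := exists_inPrism u.2.1 (height_nonneg t)
  have hmono : Monotone θ.unop := θ.unop.toOrderHom.monotone
  have hi' := inPrism_push (height_nonneg t) hmono hi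
  rw [b.fn_eq _ u t hi, b.fn_eq x (stdSimplex.map θ.unop u) t hi']
  have hpm : Monotone (prismMap θ.unop i) := by
    intro l l' h
    have h2 := hmono (Fin.predAbove_right_monotone i h)
    unfold prismMap
    split_ifs with h3 h4 h4
    · exact h2
    · exact (Fin.castSucc_lt_succ_iff.2 h2).le
    · exact absurd (h.trans h4) h3
    · exact Fin.succ_le_succ_iff.2 h2
  let η : SimplexCategory.mk (m.unop.len + 1) ⟶ SimplexCategory.mk (n.unop.len + 1) :=
    SimplexCategory.Hom.mk ⟨_, hpm⟩
  have hη : prismPt (1 - (t : ℝ)) (stdSimplex.map θ.unop u) =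
      stdSimplex.map η (prismPt (1 - (t : ℝ)) u) :=
    stdSimplex.ext (prismCoord_push (height_nonneg t) hmono hi).symm
  have hle : ∀ l, η l ≤ Fin.castSucc (θ.unop i) ↔ l ≤ i.castSucc := by
    intro l
    change prismMap θ.unop i l ≤ _ ↔ _
    unfold prismMap
    split_ifs with h
    · simpa [h] using hmono (predAbove_le_of_le h)
    · simpa [h] using hmono (le_predAbove_of_lt h)
  have e1 : η ≫ degen n.unop (θ.unop i) = degen m.unop i ≫ θ.unop := by
    apply SimplexCategory.Hom.ext
    ext l
    change ((degen n.unop (θ.unop i) (η l) : Fin (n.unop.len + 1)) : ℕ) = θ.unop (i.predAbove l)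
    rw [degen_val]
    simp only [hle]
    change (if _ then ((prismMap θ.unop i l : Fin _) : ℕ) else (prismMap θ.unop i l : ℕ) - 1) = _
    unfold prismMap
    split_ifs <;> rfl
  have e2 : η ≫ cutoff n.unop (θ.unop i) = cutoff m.unop i := by
    apply SimplexCategory.Hom.ext
    refine OrderHom.ext _ _ (funext fun l => ?_)
    change cutoff n.unop (θ.unop i) (η l) = cutoff m.unop i l
    rw [cutoff_apply, cutoff_apply]
    simp only [hle]
  have e3 : b.prism (X.map θ x) i = Y.map η.op (b.prism x (θ.unop i)) := by
    have e1' := congrArg (fun φ => X.map (Quiver.Hom.op φ) x) e1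
    simp only [op_comp, X.map_comp, ConcreteCategory.comp_apply, Quiver.Hom.op_unop] at e1'
    simp only [Pairing.prism, b.naturality]
    rw [e1']
    exact congrArg _ e2.symm
  rw [hη, e3]
  exact realPoint_map η.op _ _

/-- The homotopy of a pairing, as a simplicial map to the singular simplicial set of the space of
paths in `|Y|`. -/
def Pairing.adjoint (b : Pairing X Y) :
    X ⟶ TopCat.toSSet.obj (TopCat.of C(unitInterval, SSet.toTop.obj Y)) where
  app n := ↾fun x => (TopCat.toSSetObjEquiv _ n).symm
    (ContinuousMap.curry ⟨b.fn x, b.continuous_fn x⟩)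
  naturality n m θ := by
    ext x
    apply (TopCat.toSSetObjEquiv _ _).injective
    ext s t
    exact b.fn_map θ x s t

/-- The homotopy `[0,1] × |X| → |Y|` that realizes a simplicial map `X × Δ[1] ⟶ Y`. -/
def Pairing.real (b : Pairing X Y) : C(unitInterval × SSet.toTop.obj X, SSet.toTop.obj Y) :=
  (ContinuousMap.uncurry (TopCat.Hom.hom (realDesc b.adjoint))).comp ContinuousMap.prodSwap

lemma Pairing.real_apply (b : Pairing X Y) {n : SimplexCategoryᵒᵖ} (x : X.obj n) (s : Simp n)
    (t : unitInterval) : b.real (t, realPoint x s) = b.fn x (s, t) := by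
  have h := realDesc_realPoint b.adjoint x s
  exact DFunLike.congr_fun (F := C(unitInterval, SSet.toTop.obj Y)) h t

/-- Two continuous maps from `|X|` that agree on the points of all simplices are equal. -/
lemma real_ext {Z : Type u} [TopologicalSpace Z] {f g : C(SSet.toTop.obj X, Z)}
    (h : ∀ (n : SimplexCategoryᵒᵖ) (x : X.obj n) (s : Simp n),
      f (realPoint x s) = g (realPoint x s)) : f = g :=
  congrArg TopCat.Hom.hom
    (real_hom_ext (X := X) (Z := TopCat.of Z) (f := TopCat.ofHom f) (g := TopCat.ofHom g) h)

end Realization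

/-! ### Spectra -/

/-- A (sequential, topological) spectrum: based spaces `E k` with based maps
`S¹ ∧ E k → E (k + 1)`, where `S¹ = [0,1]/{0,1}`. -/
structure TopSpectrum : Type (u + 1) where
  space : ℕ → TopCat.{u}
  pt : ∀ k, space k
  bond : ∀ k, C(unitInterval × space k, space (k + 1))
  bond_zero : ∀ k x, bond k (0, x) = pt (k + 1)
  bond_one : ∀ k x, bond k (1, x) = pt (k + 1)
  bond_pt : ∀ k t, bond k (t, pt k) = pt (k + 1)

/-- A map of spectra: based maps of levels that commute with the bonding maps. -/
structure TopSpectrum.Hom (E E' : TopSpectrum.{u}) where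
  map : ∀ k, C(E.space k, E'.space k)
  map_pt : ∀ k, map k (E.pt k) = E'.pt k
  map_bond : ∀ k t x, map (k + 1) (E.bond k (t, x)) = E'.bond k (t, map k x)

/-- The image of a based `m`-dimensional loop under a based map. -/
def loopMap {X Y : Type u} [TopologicalSpace X] [TopologicalSpace Y] {x : X} {y : Y} (f : C(X, Y))
    (h : f x = y) {m : ℕ} (α : GenLoop (Fin m) X x) : GenLoop (Fin m) Y y :=
  ⟨f.comp α.1, fun z hz => (congrArg f (α.2 z hz)).trans h⟩

lemma loopMap_homotopic {X Y : Type u} [TopologicalSpace X] [TopologicalSpace Y] {x : X} {y : Y}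
    (f : C(X, Y)) (h : f x = y) {m : ℕ} {α β : GenLoop (Fin m) X x}
    (hαβ : GenLoop.Homotopic α β) : GenLoop.Homotopic (loopMap f h α) (loopMap f h β) :=
  hαβ.map fun H => H.compContinuousMap f

/-- The map on homotopy groups induced by a continuous map. -/
def piMap {X Y : Type u} [TopologicalSpace X] [TopologicalSpace Y] (f : C(X, Y)) (m : ℕ) (x : X) :
    HomotopyGroup.Pi m X x → HomotopyGroup.Pi m Y (f x) :=
  Quotient.map (loopMap f rfl) fun _ _ h => loopMap_homotopic f rfl h

/-- The map on path components induced by a continuous map. -/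
def piZeroMap {X Y : Type u} [TopologicalSpace X] [TopologicalSpace Y] (f : C(X, Y)) :
    ZerothHomotopy X → ZerothHomotopy Y :=
  Quotient.map f fun _ _ h => h.map f.continuous

/-- A weak homotopy equivalence of spaces. -/
def IsWeakEquiv {X Y : Type u} [TopologicalSpace X] [TopologicalSpace Y] (f : C(X, Y)) : Prop :=
  Function.Bijective (piZeroMap f) ∧ ∀ (m : ℕ) (x : X), Function.Bijective (piMap f m x)

/-- A representative of a class in `π_n(E)`, the colimit over `k` of the `π_{k+n}(E k)`: a based
loop of dimension `m = k + n` in `E k`. -/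
structure StableLoop (E : TopSpectrum.{u}) (n : ℤ) : Type u where
  level : ℕ
  dim : ℕ
  dim_eq : (dim : ℤ) = level + n
  loop : GenLoop (Fin dim) (E.space level) (E.pt level)

/-- The suspension of a based loop in `E k`, a based loop of one dimension more in `E (k + 1)`. -/
def suspLoop (E : TopSpectrum.{u}) {k m : ℕ} (α : GenLoop (Fin m) (E.space k) (E.pt k)) :
    GenLoop (Fin (m + 1)) (E.space (k + 1)) (E.pt (k + 1)) :=
  ⟨(E.bond k).comp ⟨fun y => (y 0, α.1 fun i => y i.succ), by fun_prop⟩, by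
    rintro y ⟨i, hi⟩
    change E.bond k (y 0, α.1 fun i => y i.succ) = _
    induction i using Fin.cases with
    | zero =>
      rcases hi with h | h
      · rw [h, E.bond_zero]
      · rw [h, E.bond_one]
    | succ i =>
      have : α.1 (fun i => y i.succ) = E.pt k := α.2 _ ⟨i, hi⟩
      rw [this, E.bond_pt]⟩

/-- Homotopic loops are identified, and each loop is identified with its suspension. -/
inductive StableLoop.Rel (E : TopSpectrum.{u}) (n : ℤ) : StableLoop E n → StableLoop E n → Prop
  | homotopic {k m : ℕ} (h : (m : ℤ) = k + n) (α β : GenLoop (Fin m) (E.space k) (E.pt k)) :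
      GenLoop.Homotopic α β → Rel E n ⟨k, m, h, α⟩ ⟨k, m, h, β⟩
  | susp {k m : ℕ} (h : (m : ℤ) = k + n) (h' : ((m + 1 : ℕ) : ℤ) = (k + 1 : ℕ) + n)
      (α : GenLoop (Fin m) (E.space k) (E.pt k)) :
      Rel E n ⟨k, m, h, α⟩ ⟨k + 1, m + 1, h', suspLoop E α⟩

/-- The underlying set of the `n`-th homotopy group `π_n(E)` of a spectrum, for `n` in `ℤ`. -/
def StablePi (E : TopSpectrum.{u}) (n : ℤ) : Type u := Quot (StableLoop.Rel E n)

/-- The map on homotopy groups induced by a map of spectra. -/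
def TopSpectrum.Hom.stablePi {E E' : TopSpectrum.{u}} (f : E.Hom E') (n : ℤ) :
    StablePi E n → StablePi E' n :=
  Quot.map (fun α => ⟨α.level, α.dim, α.dim_eq, loopMap (f.map _) (f.map_pt _) α.loop⟩) (by
    rintro _ _ (⟨h, α, β, hαβ⟩ | ⟨h, h', α⟩)
    · exact StableLoop.Rel.homotopic _ _ _ (loopMap_homotopic _ _ hαβ)
    · have : loopMap (f.map _) (f.map_pt _) (suspLoop E α) =
          suspLoop E' (loopMap (f.map _) (f.map_pt _) α) := by
        ext y
        exact f.map_bond _ _ _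
      dsimp only
      rw [this]
      exact StableLoop.Rel.susp _ _ _)

/-- A stable equivalence of spectra: a map that induces isomorphisms on all homotopy groups. -/
def TopSpectrum.Hom.IsStableEquiv {E E' : TopSpectrum.{u}} (f : E.Hom E') : Prop :=
  ∀ n : ℤ, Function.Bijective (f.stablePi n)

/-! ### The spectrum associated to a Γ-space -/

/-- The simplicial set underlying a pointed simplicial set. -/
def unpoint (X : SimplicialObject Pointed.{u}) : SSet.{u} where
  obj n := (X.obj n).X
  map θ := ↾(X.map θ).toFun
  map_id n := by ext x; simp
  map_comp θ η := by ext x; simp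

/-- The map of simplicial sets underlying a map of pointed simplicial sets. -/
def unpointMap {X Y : SimplicialObject Pointed.{u}} (f : X ⟶ Y) : unpoint X ⟶ unpoint Y where
  app n := ↾(f.app n).toFun
  naturality n m θ := by
    ext x
    exact congrFun (congrArg Pointed.Hom.toFun (f.naturality θ)) x

/-- The geometric realization of a pointed simplicial set. -/
abbrev realization (X : SimplicialObject Pointed.{u}) : TopCat.{u} := SSet.toTop.obj (unpoint X)

/-- The continuous map that realizes a map of pointed simplicial sets. -/
def realMap {X Y : SimplicialObject Pointed.{u}} (f : X ⟶ Y) : C(realization X, realization Y) :=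
  TopCat.Hom.hom (SSet.toTop.map (unpointMap f))

/-- The basepoint, as a simplex. -/
def ptSimplex (X : SimplicialObject Pointed.{u}) (n : SimplexCategoryᵒᵖ) : (unpoint X).obj n :=
  (X.obj n).point

lemma map_ptSimplex (X : SimplicialObject Pointed.{u}) {n m : SimplexCategoryᵒᵖ} (θ : n ⟶ m) :
    (unpoint X).map θ (ptSimplex X n) = ptSimplex X m := (X.map θ).map_point

/-- The basepoint of the realization of a pointed simplicial set. -/
def realPt (X : SimplicialObject Pointed.{u}) : realization X :=
  realPoint (ptSimplex X (op (SimplexCategory.mk 0))) (stdSimplex.vertex (0 : Fin 1))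

lemma realPoint_pt (X : SimplicialObject Pointed.{u}) (n : SimplexCategoryᵒᵖ) (s : Simp n) :
    realPoint (ptSimplex X n) s = realPt X := by
  let θ : op (SimplexCategory.mk 0) ⟶ n := (SimplexCategory.const n.unop (SimplexCategory.mk 0) 0).op
  rw [← map_ptSimplex X θ, realPoint_map]
  have : Subsingleton (Simp (op (SimplexCategory.mk 0))) :=
    inferInstanceAs (Subsingleton (stdSimplex ℝ (Fin 1)))
  exact congrArg _ (Subsingleton.elim _ _)

lemma realMap_pt {X Y : SimplicialObject Pointed.{u}} (f : X ⟶ Y) :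
    realMap f (realPt X) = realPt Y :=
  (realPoint_app (unpointMap f) _ _).trans
    (congrArg (fun y => realPoint (X := unpoint Y) y _) (f.app _).map_point)

lemma low_zero {N : ℕ} {u : Fin N → ℝ} (hu : ∀ j, 0 ≤ u j) (j : Fin N) : low 0 u j = 0 := by
  have h : ∀ l, 0 ≤ cum u l := fun l => (cum_zero u).symm.le.trans (cum_mono hu (Nat.zero_le l))
  rw [low, min_eq_right (h _), min_eq_right (h _), sub_self]

lemma high_one {N : ℕ} {u : Fin N → ℝ} (hu : u ∈ stdSimplex ℝ (Fin N)) (j : Fin N) :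
    high 1 u j = 0 := by
  have h : ∀ l, cum u l ≤ 1 := fun l => by
    rw [← hu.2, cum]
    refine Finset.sum_le_sum fun j _ => ?_
    split_ifs
    · exact le_rfl
    · exact hu.1 j
  rw [high, low, min_eq_left (h _), min_eq_left (h _), cum_succ]
  ring

lemma inPrism_last {N : ℕ} {u : Fin (N + 1) → ℝ} (hu : u ∈ stdSimplex ℝ (Fin (N + 1))) :
    InPrism 1 u (Fin.last N) :=
  ⟨fun j hj => absurd hj (not_lt.2 (Fin.le_last j)), fun j _ => high_one hu j⟩

section Pairing

variable {X Y : SimplicialObject Pointed.{u}} (b : Pairing (unpoint X) (unpoint Y))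

lemma Pairing.fn_const
    (hb : ∀ (n : SimplexCategoryᵒᵖ) (x : (unpoint X).obj n) (α : Delta1 n), (∀ i j, α i = α j) →
      b.app x α = ptSimplex Y n)
    {n : SimplexCategoryᵒᵖ} (x : (unpoint X).obj n) (u : Simp n)
    (t : unitInterval) {i : Fin (n.unop.len + 1)} (h : InPrism (1 - (t : ℝ)) u.1 i)
    (r : SimplexCategory.mk (n.unop.len + 1) ⟶ SimplexCategory.mk (n.unop.len + 1))
    (hr : ∀ l, prismCoord (1 - (t : ℝ)) u.1 l ≠ 0 → r l = l)
    (hr' : ∀ l l', cutoff n.unop i (r l) = cutoff n.unop i (r l')) :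
    b.fn x (u, t) = realPt Y := by
  rw [b.fn_eq x u t h, ← realPoint_pt Y _ (prismPt (1 - (t : ℝ)) u)]
  refine realPoint_eq_of_retract _ _ _ r hr ?_
  rw [map_ptSimplex, Pairing.prism, b.naturality]
  exact hb _ _ _ hr'

lemma Pairing.real_zero
    (hb : ∀ (n : SimplexCategoryᵒᵖ) (x : (unpoint X).obj n) (α : Delta1 n), (∀ i j, α i = α j) →
      b.app x α = ptSimplex Y n)
    (z : realization X) : b.real (0, z) = realPt Y := by
  have : b.real.comp ((ContinuousMap.const _ 0).prodMk (ContinuousMap.id _)) =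
      ContinuousMap.const _ (realPt Y) := by
    refine real_ext fun n x s => ?_
    change b.real (0, realPoint x s) = _
    rw [b.real_apply]
    have ha : (1 : ℝ) - ((0 : unitInterval) : ℝ) = 1 := by simp
    have hi : InPrism (1 - ((0 : unitInterval) : ℝ)) s.1 (Fin.last n.unop.len) := by
      rw [ha]
      exact inPrism_last s.2
    refine b.fn_const hb x s 0 hi
      (SimplexCategory.Hom.mk ⟨fun l => min l (Fin.last n.unop.len).castSucc,
        fun l m h => min_le_min_right _ h⟩) (fun l hl => ?_) (fun l l' => ?_)
    · refine min_eq_left ?_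
      by_contra hc
      refine hl ?_
      rw [ha, prismCoord, Pi.add_apply, push_apply_eq_zero, push_apply_eq_zero, add_zero]
      · exact fun j _ => high_one s.2 j
      · intro j hj
        exact absurd (hj ▸ Fin.castSucc_le_castSucc_iff.2 (Fin.le_last j)) hc
    · rw [cutoff_apply, cutoff_apply]
      exact (if_pos (min_le_right _ _)).trans (if_pos (min_le_right _ _)).symm
  exact DFunLike.congr_fun this z

lemma Pairing.real_one
    (hb : ∀ (n : SimplexCategoryᵒᵖ) (x : (unpoint X).obj n) (α : Delta1 n), (∀ i j, α i = α j) →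
      b.app x α = ptSimplex Y n)
    (z : realization X) : b.real (1, z) = realPt Y := by
  have : b.real.comp ((ContinuousMap.const _ 1).prodMk (ContinuousMap.id _)) =
      ContinuousMap.const _ (realPt Y) := by
    refine real_ext fun n x s => ?_
    change b.real (1, realPoint x s) = _
    rw [b.real_apply]
    have ha : (1 : ℝ) - ((1 : unitInterval) : ℝ) = 0 := by simp
    have hi : InPrism (1 - ((1 : unitInterval) : ℝ)) s.1 (0 : Fin (n.unop.len + 1)) := by
      rw [ha]
      exact ⟨fun j _ => low_zero s.2.1 j, fun j hj => absurd hj (Fin.not_lt_zero j)⟩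
    refine b.fn_const hb x s 1 hi
      (SimplexCategory.Hom.mk ⟨fun l => max l (0 : Fin (n.unop.len + 1)).succ,
        fun l m h => max_le_max_right _ h⟩) (fun l hl => ?_) (fun l l' => ?_)
    · refine max_eq_left ?_
      by_contra hc
      refine hl ?_
      rw [ha, prismCoord, Pi.add_apply, push_apply_eq_zero, push_apply_eq_zero, add_zero]
      · intro j hj
        exact absurd (hj ▸ Fin.succ_le_succ_iff.2 (Fin.zero_le j)) hc
      · exact fun j _ => low_zero s.2.1 j
    · have h : ∀ l : Fin (n.unop.len + 2),
          ¬ max l (0 : Fin (n.unop.len + 1)).succ ≤ (0 : Fin (n.unop.len + 1)).castSucc :=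
        fun l hc => absurd ((le_max_right _ _).trans hc) (not_le.2 (Fin.castSucc_lt_succ))
      rw [cutoff_apply, cutoff_apply]
      exact (if_neg (h l)).trans (if_neg (h l')).symm
  exact DFunLike.congr_fun this z

lemma Pairing.real_pt
    (hb : ∀ (n : SimplexCategoryᵒᵖ) (α : Delta1 n), b.app (ptSimplex X n) α = ptSimplex Y n)
    (t : unitInterval) : b.real (t, realPt X) = realPt Y := by
  rw [realPt, b.real_apply, Pairing.fn, Pairing.prism, map_ptSimplex, hb, realPoint_pt]

end Pairing

section GammaSpectrum

lemma GammaSpace.map_eq_point (F : GammaSpace.{u}) {X Y : FinPtd} (f : X ⟶ Y)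
    (hf : ∀ x, f.hom.toFun x = Y.obj.point) (n : SimplexCategoryᵒᵖ) (x : ((F.functor.obj X).obj n).X) :
    ((F.functor.map f).app n).toFun x = ((F.functor.obj Y).obj n).point := by
  let P : FinPtd := ⟨⟨PUnit.{1}, ⟨⟩⟩, inferInstanceAs (Finite PUnit)⟩
  let p : X ⟶ P := ObjectProperty.homMk ⟨fun _ => ⟨⟩, rfl⟩
  let q : P ⟶ Y := ObjectProperty.homMk ⟨fun _ => Y.obj.point, rfl⟩
  have h : f = p ≫ q := by
    apply ObjectProperty.hom_ext
    apply Pointed.Hom.ext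
    exact funext hf
  have h2 : Subsingleton ((F.functor.obj P).obj n) :=
    F.reduced P (inferInstanceAs (Subsingleton PUnit)) n
  rw [h, F.functor.map_comp]
  change ((F.functor.map q).app n).toFun (((F.functor.map p).app n).toFun x) = _
  rw [Subsingleton.elim (((F.functor.map p).app n).toFun x) ((F.functor.obj P).obj n).point]
  exact ((F.functor.map q).app n).map_point

/-- The map `S^k_n ⟶ S^{k+1}_n = S^k_n ∧ S^1_n`, `x ↦ x ∧ [α]`. -/
def sphereWith (k : ℕ) {n : SimplexCategoryᵒᵖ} (α : Delta1 n) :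
    (sphere k).obj n ⟶ (sphere (k + 1)).obj n :=
  smashWith (Y := circle.obj n) (show (circle.obj n).obj.X from Quot.mk _ α)

lemma GammaSpace.level_map_comp (F : GammaSpace.{u}) (k : ℕ) {n m : SimplexCategoryᵒᵖ} (θ : n ⟶ m)
    (f : (sphere k).obj n ⟶ (sphere (k + 1)).obj n) (g : (sphere k).obj m ⟶ (sphere (k + 1)).obj m)
    (h : f ≫ (sphere (k + 1)).map θ = (sphere k).map θ ≫ g) :
    (F.functor.map f).app n ≫ (F.level (k + 1)).map θ =
      (F.level k).map θ ≫ (F.functor.map g).app m := by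
  have h3 := congrArg (fun f => (F.functor.map f).app n) h
  simp only [Functor.map_comp, NatTrans.comp_app] at h3
  have h4 := (F.functor.map g).naturality θ
  simp only [GammaSpace.level, Category.assoc]
  rw [h4, reassoc_of% h3]

/-- The simplicial map `F(S^k) × Δ[1] ⟶ F(S^k ∧ S^1)` that sends `(x, α)` to the image of `x` under
the map `- ∧ [α] : S^k_n ⟶ S^k_n ∧ S^1_n`. -/
def GammaSpace.pairing (F : GammaSpace.{u}) (k : ℕ) :
    Pairing (unpoint (F.level k)) (unpoint (F.level (k + 1))) where
  app x α := ((F.functor.map (sphereWith k α)).app _).toFun x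
  naturality θ x α := congrFun (congrArg Pointed.Hom.toFun
    (F.level_map_comp k θ (sphereWith k α) (sphereWith k (θ.unop ≫ α)) rfl)) x

lemma GammaSpace.pairing_const (F : GammaSpace.{u}) (k : ℕ) (n : SimplexCategoryᵒᵖ)
    (x : (unpoint (F.level k)).obj n) (α : Delta1 n) (hα : ∀ i j, α i = α j) :
    (F.pairing k).app x α = ptSimplex (F.level (k + 1)) n :=
  F.map_eq_point _ (fun _ => Quot.sound ⟨Or.inr (Quot.sound ⟨hα, fun _ _ => rfl⟩), Or.inl rfl⟩) n x

lemma GammaSpace.pairing_pt (F : GammaSpace.{u}) (k : ℕ) (n : SimplexCategoryᵒᵖ) (α : Delta1 n) :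
    (F.pairing k).app (ptSimplex (F.level k) n) α = ptSimplex (F.level (k + 1)) n :=
  ((F.functor.map (sphereWith k α)).app n).map_point

/-- The spectrum associated to a Γ-space `F`. Level `k` is the realization of `F(S^k)`, and the
bonding maps are induced by the maps `- ∧ s : S^k ⟶ S^k ∧ S^1`. -/
def GammaSpace.spectrum (F : GammaSpace.{u}) : TopSpectrum.{u} where
  space k := realization (F.level k)
  pt k := realPt (F.level k)
  bond k := (F.pairing k).real
  bond_zero k := (F.pairing k).real_zero (F.pairing_const k)
  bond_one k := (F.pairing k).real_one (F.pairing_const k)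
  bond_pt k := (F.pairing k).real_pt (F.pairing_pt k)

variable {F G : GammaSpace.{u}}

/-- The map in level `k` induced by a map of Γ-spaces. -/
def levelMap (φ : F.functor ⟶ G.functor) (k : ℕ) : F.level k ⟶ G.level k where
  app p := (φ.app ((sphere k).obj p)).app p
  naturality p q θ := by
    have h := NatTrans.congr_app (φ.naturality ((sphere k).map θ)) p
    have h2 := (φ.app ((sphere k).obj q)).naturality θ
    simp only [NatTrans.comp_app] at h
    simp only [GammaSpace.level, Category.assoc, h2]
    rw [reassoc_of% h]

lemma levelMap_prism (φ : F.functor ⟶ G.functor) (k : ℕ) {n : SimplexCategoryᵒᵖ}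
    (x : (unpoint (F.level k)).obj n) (i : Fin (n.unop.len + 1)) :
    (unpointMap (levelMap φ (k + 1))).app _ ((F.pairing k).prism x i) =
      (G.pairing k).prism ((unpointMap (levelMap φ k)).app n x) i := by
  have h : ∀ {m : SimplexCategoryᵒᵖ} (y : (unpoint (F.level k)).obj m) (α : Delta1 m),
      (unpointMap (levelMap φ (k + 1))).app m ((F.pairing k).app y α) =
        (G.pairing k).app ((unpointMap (levelMap φ k)).app m y) α := fun {m} y α => by
    have := NatTrans.congr_app (φ.naturality (sphereWith k α)) m
    exact congrFun (congrArg Pointed.Hom.toFun this) y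
  have h2 := ConcreteCategory.congr_hom
    ((unpointMap (levelMap φ k)).naturality (degen n.unop i).op) x
  refine (h _ _).trans ?_
  exact congrArg (fun y => (G.pairing k).app y (cutoff n.unop i)) h2

/-- The map of spectra induced by a map of Γ-spaces. -/
def spectrumMap (φ : F.functor ⟶ G.functor) : F.spectrum.Hom G.spectrum where
  map k := realMap (levelMap φ k)
  map_pt k := realMap_pt _
  map_bond k t z := by
    have h : ((realMap (levelMap φ (k + 1))).comp (F.pairing k).real).comp
          ((ContinuousMap.const _ t).prodMk (ContinuousMap.id _)) =
        ((G.pairing k).real.comp ((ContinuousMap.const _ t).prodMk (ContinuousMap.id _))).comp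
          (realMap (levelMap φ k)) := by
      refine real_ext fun n x s => ?_
      change realMap (levelMap φ (k + 1)) ((F.pairing k).real (t, realPoint x s)) =
        (G.pairing k).real (t, realMap (levelMap φ k) (realPoint x s))
      have h1 : realMap (levelMap φ k) (realPoint x s) =
        realPoint ((unpointMap (levelMap φ k)).app n x) s := realPoint_app _ _ _
      rw [h1, Pairing.real_apply, Pairing.real_apply, Pairing.fn, Pairing.fn]
      refine (realPoint_app _ _ _).trans (congrArg (fun y => realPoint y _) ?_)
      exact levelMap_prism φ k x _
    exact DFunLike.congr_fun h z

end GammaSpectrum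

/-- The K-theory spectrum `K(C)`. -/
def KTheory (C : CatFam.{u}) : TopSpectrum.{u} := (gammaK C).spectrum

/-- The Eilenberg–MacLane spectrum `HA`. -/
def EMSpectrum (A : Type u) [AddCommGroup A] : TopSpectrum.{u} := (gammaH A).spectrum

/-- The value of an object of `EA_*`, with value `0` for the base object. -/
def EAval {A : Type u} [AddCommGroup A] : (EAstar A).carrier → A
  | .star => 0
  | .of a => a.val

/-- The component at `x` of an element of `X ⊗ A = ⊕_{X°} A`. -/
def tensorCoord {A : Type u} [AddCommGroup A] {X : FinPtd} {n : SimplexCategoryᵒᵖ}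
    (a : ((gammaH A).functor.obj X).obj n) (x : {x : X.obj // x ≠ X.obj.point}) : A :=
  (show {x : X.obj // x ≠ X.obj.point} →₀ A from a) x

end CoverK

end

/-!
The category of covers of `X ∧ EA_*` splits as a disjoint union indexed by `X ⊗ A`: a morphism of
tuples does not change the sums `∑_{x_i = x} a_i` (`total_eq_of_hom`). Each piece has a terminal
object, the tuple with one entry for every non-basepoint element `x` of `X`, the sum at `x`
(`homFullTuple`, `subsingleton_hom_fullTuple`). Hence the nerve of each piece is contractible, and
the map to the discrete space `X ⊗ A` is an equivalence for each `X`.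

The levels of the spectra are diagonals `p ↦ N_p W(S^k_p ∧ EA_*)`, so what is needed is a
realization lemma: a dimensionwise equivalence of bisimplicial sets induces an equivalence of
diagonals. The terminal objects are not natural in `X`. A natural replacement is the cone
`Graded.Cone`, in which a new terminal object is added to each piece: the nerve of the original
category and the discrete set of cone points are both contained in the nerve of the cone, naturally
in `X`. The map that sends a tuple to its sums is the inclusion into the cone followed by the
projection to the set of cone points, a retraction of the second inclusion. So it suffices to treat
the two inclusions, both of which are deformation retracts in each dimension
(`Graded.Terminals.kanAcyclic_nerveIncl`, `Graded.kanAcyclic_baseIncl`).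

For inclusions, the property `KanAcyclic` (a lifting property against all Kan complexes, including
relative homotopies) takes the place of weak equivalences. It holds for deformation retracts, it is
stable under pushouts, composition, sequential unions and pushout-products with inclusions, and it
satisfies the cancellation property `KanAcyclic.of_comp`. The skeletal filtration of the diagonal
is built from these operations, which gives the realization lemma `kanAcyclic_diagonalSub`. An
acyclic map of simplicial sets realizes to a homotopy equivalence of spaces, because singular
simplicial sets are Kan complexes (`kanComplex_toSSet`) and simplicial homotopies realize to
homotopies (`KanAcyclic.isHomotopyEquiv_topMap`).

Finally, a homotopy equivalence is bijective on homotopy groups at all basepoints, although the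
homotopies may move the basepoints (`isWeakEquiv_of_isHomotopyEquiv`), and a map of spectra that is
a weak equivalence in each level is bijective on the colimits that define the stable homotopy
groups (`isStableEquiv_of_levelwise`).
-/

noncomputable section

namespace CoverK

/-! ### Maps with the extension property for fibrant simplicial sets -/

section Simplicial

open MonoidalCategory SSet Limits Simplicial modelCategoryQuillen

section Gluing

variable {Y Z : SSet.{u}}

lemma exists_extension_of_anodyne [KanComplex Z] {P : Y.Subcomplex} (hP : anodyneExtensions P.ι)
    (f : (P : SSet.{u}) ⟶ Z) : ∃ g : Y ⟶ Z, P.ι ≫ g = f := by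
  have := hP _ (HomotopicalAlgebra.mem_fibrations (terminal.from Z))
  have sq : CommSq f P.ι (terminal.from Z) (terminal.from _) := ⟨Subsingleton.elim _ _⟩
  exact ⟨sq.lift, sq.fac_left⟩

/-- The `n`-simplex of `Δ[1]` that is constant with value `e`. -/
abbrev endSimplex (e : Fin 2) (n : SimplexCategoryᵒᵖ) : (Δ[1] : SSet.{u}).obj n :=
  (Δ[1] : SSet.{u}).map (n.unop.const _ 0).op (stdSimplex.obj₀Equiv.{u}.symm e)

/-- The inclusion of an end of the cylinder. -/
def endIncl (e : Fin 2) {X : SSet.{u}} : X ⟶ X ⊗ Δ[1] where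
  app n := ↾fun x => (x, endSimplex e n)

lemma endIncl_comp_assoc (e : Fin 2) {X Y Z : SSet.{u}} (f : X ⟶ Y) (h : Y ⊗ Δ[1] ⟶ Z) :
    endIncl e ≫ f ▷ Δ[1] ≫ h = f ≫ endIncl e ≫ h := rfl

lemma mem_horn_one_iff (e : Fin 2) {n : SimplexCategoryᵒᵖ} (α : (Δ[1] : SSet.{u}).obj n) :
    α ∈ (Λ[1, e] : (Δ[1] : SSet.{u}).Subcomplex).obj n ↔ α = endSimplex e n := by
  obtain ⟨⟨d⟩⟩ := n
  have h0 : ∀ k : Fin (d + 1), (endSimplex.{u} e (op (.mk d)) : (Δ[1] : SSet.{u}) _⦋d⦌) k = e :=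
    fun k => rfl
  have hl := mem_horn_iff_notMem_range (n := 1) (d := d) α e
  refine hl.trans ⟨?_, ?_⟩
  · rintro ⟨j, hj, hj'⟩
    refine SSet.stdSimplex.ext _ _ fun k => ?_
    have h1 : ∀ a b e : Fin 2, b ≠ e → a ≠ b → a = e := by decide
    exact h1 _ j e hj fun h => hj' ⟨k, h⟩
  · rintro rfl
    have h1 : ∀ e : Fin 2, 1 - e ≠ e := by decide
    exact ⟨1 - e, h1 e, by rintro ⟨k, hk⟩; exact h1 e (hk.symm.trans (h0 k))⟩

/-- The homotopy extension property of Kan complexes. It holds because the inclusion of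
`P × Δ[1] ∪ Y × {e}` in `Y × Δ[1]` is anodyne; the end `{e}` is the horn `Λ[1, e]`. -/
lemma exists_homotopy_extension [KanComplex Z] (e : Fin 2) (P : Y.Subcomplex) (f : Y ⟶ Z)
    (h : (P : SSet.{u}) ⊗ Δ[1] ⟶ Z) (hf : endIncl e ≫ h = P.ι ≫ f) :
    ∃ H : Y ⊗ Δ[1] ⟶ Z, endIncl e ≫ H = f ∧ P.ι ▷ _ ≫ H = h := by
  let B : (Δ[1] : SSet.{u}).Subcomplex := Λ[1, e]
  have sq := Subcomplex.unionProd.isPushout P B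
  have w : P.ι ▷ (B : SSet.{u}) ≫ CartesianMonoidalCategory.fst _ _ ≫ f =
      (P : SSet.{u}) ◁ B.ι ≫ h := by
    ext n ⟨y, α, hα⟩
    obtain rfl := (mem_horn_one_iff e α).1 hα
    exact (ConcreteCategory.congr_hom (NatTrans.congr_app hf n) y).symm
  obtain ⟨H, hH⟩ := exists_extension_of_anodyne (anodyneExtensions_unionProd_ι P B
    (anodyneExtensions.horn_ι e)) (sq.desc _ _ w)
  refine ⟨H, ?_, ?_⟩
  · have h1 := sq.inl_desc _ _ w
    rw [← hH] at h1
    ext n y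
    let y' : (Y ⊗ (B : SSet.{u})).obj n := (y, ⟨endSimplex e n, (mem_horn_one_iff e _).2 rfl⟩)
    exact ConcreteCategory.congr_hom (NatTrans.congr_app h1 n) y'
  · have h1 := sq.inr_desc _ _ w
    rw [← hH] at h1
    exact h1

end Gluing

/-- `i : A ⟶ B` induces a trivial fibration on mapping spaces into Kan complexes, spelled out:
maps to a Kan complex that are defined on `K ⊗ B` and on `L ⊗ A` and agree on `K ⊗ A` extend to
`L ⊗ B`. -/
def KanAcyclic {A B : SSet.{u}} (i : A ⟶ B) : Prop :=
  ∀ (Z : SSet.{u}) [KanComplex Z] (L : SSet.{u}) (K : L.Subcomplex)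
    (f : (K : SSet.{u}) ⊗ B ⟶ Z) (g : L ⊗ A ⟶ Z), (K : SSet.{u}) ◁ i ≫ f = K.ι ▷ A ≫ g →
      ∃ w : L ⊗ B ⟶ Z, K.ι ▷ B ≫ w = f ∧ L ◁ i ≫ w = g

namespace KanAcyclic

variable {A B C : SSet.{u}}

lemma of_isPushout {A' B' : SSet.{u}} {a : A ⟶ A'} {i : A ⟶ B} {i' : A' ⟶ B'} {b : B ⟶ B'}
    (sq : IsPushout a i i' b) (hi : KanAcyclic i) : KanAcyclic i' := by
  intro Z _ L K f g h
  obtain ⟨w, hw1, hw2⟩ := hi Z L K (_ ◁ b ≫ f) (_ ◁ a ≫ g) (by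
    rw [← whiskerLeft_comp_assoc, ← sq.w, whiskerLeft_comp_assoc, h, whisker_exchange_assoc])
  have sqL := sq.map (tensorLeft L)
  have sqK := sq.map (tensorLeft (K : SSet.{u}))
  obtain ⟨v, hv1, hv2⟩ := sqL.exists_desc g w hw2.symm
  refine ⟨v, sqK.hom_ext ?_ ?_, hv1⟩
  · dsimp at hv1 ⊢
    rw [whisker_exchange_assoc, hv1, h]
  · dsimp at hv2 ⊢
    rw [whisker_exchange_assoc, hv2, hw1]

lemma comp {i : A ⟶ B} {j : B ⟶ C} (hi : KanAcyclic i) (hj : KanAcyclic j) :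
    KanAcyclic (i ≫ j) := by
  intro Z _ L K f g h
  obtain ⟨w, hw1, hw2⟩ := hi Z L K (_ ◁ j ≫ f) g (by
    rw [← h, whiskerLeft_comp_assoc])
  obtain ⟨v, hv1, hv2⟩ := hj Z L K f w hw1.symm
  exact ⟨v, hv1, by rw [whiskerLeft_comp_assoc, hv2, hw2]⟩

lemma of_isIso (i : A ⟶ B) [IsIso i] : KanAcyclic i := by
  intro Z _ L K f g h
  refine ⟨L ◁ inv i ≫ g, ?_, by simp [← whiskerLeft_comp_assoc]⟩
  rw [← whisker_exchange_assoc, ← h, ← whiskerLeft_comp_assoc]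
  simp

end KanAcyclic

/-- A homotopy of maps to a Kan complex that is prescribed on `K ⊗ B ∪ L ⊗ A` extends to `L ⊗ B`. -/
lemma exists_homotopy_extension_prod {L B Z : SSet.{u}} [KanComplex Z] (e : Fin 2)
    (K : L.Subcomplex) (A : B.Subcomplex) (F : L ⊗ B ⟶ Z) (f : ((K : SSet.{u}) ⊗ B) ⊗ Δ[1] ⟶ Z)
    (g : (L ⊗ (A : SSet.{u})) ⊗ Δ[1] ⟶ Z)
    (hf : endIncl e ≫ f = K.ι ▷ B ≫ F) (hg : endIncl e ≫ g = L ◁ A.ι ≫ F)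
    (hfg : ((K : SSet.{u}) ◁ A.ι) ▷ Δ[1] ≫ f = (K.ι ▷ (A : SSet.{u})) ▷ Δ[1] ≫ g) :
    ∃ H : (L ⊗ B) ⊗ Δ[1] ⟶ Z, endIncl e ≫ H = F ∧ (K.ι ▷ B) ▷ _ ≫ H = f ∧
      (L ◁ A.ι) ▷ _ ≫ H = g := by
  have sq := Subcomplex.unionProd.isPushout K A
  have sq' := sq.map (tensorRight (Δ[1] : SSet.{u}))
  obtain ⟨h, h1, h2⟩ := sq'.exists_desc g f hfg.symm
  dsimp at h1 h2
  obtain ⟨H, H1, H2⟩ := exists_homotopy_extension e (K.unionProd A) F h (by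
    refine sq.hom_ext ?_ ?_
    · rw [← endIncl_comp_assoc, h1, hg]; rfl
    · rw [← endIncl_comp_assoc, h2, hf]; rfl)
  refine ⟨H, H1, ?_, ?_⟩
  · rw [← h2, ← H2]; rfl
  · rw [← h1, ← H2]; rfl

namespace KanAcyclic

variable {B C : SSet.{u}}

/-- The inclusion of a subcomplex `A` is acyclic if some homotopy of self-maps of `B`, constant on
`A`, connects a map with values in `A` (at the end `e`) to the identity (at the end `e'`). -/
lemma of_deformation (e e' : Fin 2) (A : B.Subcomplex) (h : B ⊗ Δ[1] ⟶ B)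
    (h0 : ∀ n (b : B.obj n), (endIncl e ≫ h).app n b ∈ A.obj n) (h1 : endIncl e' ≫ h = 𝟙 B)
    (hi : A.ι ▷ _ ≫ h = CartesianMonoidalCategory.fst _ _ ≫ A.ι) : KanAcyclic A.ι := by
  intro Z _ L K f g hfg
  let r : B ⟶ A := Subcomplex.lift (endIncl e ≫ h) (by rintro n _ ⟨b, rfl⟩; exact h0 n b)
  have hr : r ≫ A.ι = endIncl e ≫ h := rfl
  have hr' : A.ι ≫ r = 𝟙 _ := by
    rw [← cancel_mono A.ι, Category.assoc, hr, ← endIncl_comp_assoc, hi]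
    rfl
  -- Extend over `L ⊗ B` by means of the retraction `r`; the result agrees with `f` on `K ⊗ B` only
  -- up to the homotopy `h`, so deform it along an extension of that homotopy.
  obtain ⟨H, H1, H2, H3⟩ := exists_homotopy_extension_prod e K A (L ◁ r ≫ g)
    ((α_ _ _ _).hom ≫ _ ◁ h ≫ f) (CartesianMonoidalCategory.fst _ _ ≫ g) (by
      rw [← whisker_exchange_assoc, ← hfg, ← whiskerLeft_comp_assoc, hr]
      rfl) (by
      rw [← whiskerLeft_comp_assoc, hr', whiskerLeft_id, Category.id_comp]
      rfl) (by
      have : (K : SSet.{u}) ◁ A.ι ▷ Δ[1] ≫ (K : SSet.{u}) ◁ h =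
          (K : SSet.{u}) ◁ CartesianMonoidalCategory.fst _ _ ≫ (K : SSet.{u}) ◁ A.ι := by
        rw [← whiskerLeft_comp, ← whiskerLeft_comp, hi]
      rw [associator_naturality_middle_assoc, reassoc_of% this, hfg]
      rfl)
  refine ⟨endIncl e' ≫ H, ?_, ?_⟩
  · rw [← endIncl_comp_assoc, H2]
    have : (K : SSet.{u}) ◁ (endIncl e' ≫ h) ≫ f = f := by
      rw [h1, whiskerLeft_id, Category.id_comp]
    exact this
  · rw [← endIncl_comp_assoc, H3]
    rfl

end KanAcyclic

lemma mem_boundary_one {n : SimplexCategoryᵒᵖ} {α : (Δ[1] : SSet.{u}).obj n}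
    (h : α ∈ (∂Δ[1] : (Δ[1] : SSet.{u}).Subcomplex).obj n) :
    α = endSimplex 0 n ∨ α = endSimplex 1 n := by
  obtain ⟨⟨d⟩⟩ := n
  have hl := (mem_boundary_iff_notMem_range (n := 1) (d := d) α).1 h
  have h0 : ∀ (e : Fin 2) (k : Fin (d + 1)),
    (endSimplex.{u} e (op (.mk d)) : (Δ[1] : SSet.{u}) _⦋d⦌) k = e := fun e k => rfl
  obtain ⟨j, hj⟩ := hl
  have h1 : ∀ a b : Fin 2, a ≠ b → a = 1 - b := by decide
  have h2 : ∀ b : Fin 2, 1 - b = 0 ∨ 1 - b = 1 := by decide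
  have h3 : α = endSimplex (1 - j) (op (.mk d)) :=
    SSet.stdSimplex.ext _ _ fun k => (h1 _ j fun h => hj ⟨k, h⟩).trans (h0 _ k).symm
  rcases h2 j with h | h
  · exact Or.inl (h3.trans (by rw [h]))
  · exact Or.inr (h3.trans (by rw [h]))

lemma endSimplex_ne (n : SimplexCategoryᵒᵖ) : endSimplex.{u} 1 n ≠ endSimplex 0 n := by
  obtain ⟨⟨d⟩⟩ := n
  intro h
  have h1 : (1 : Fin 2) = 0 := congrArg (fun α : (Δ[1] : SSet.{u}) _⦋d⦌ => α 0) h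
  exact absurd h1 (by decide)

open Classical in
/-- The map `Y ⊗ ∂Δ[1] ⟶ Z` given by two maps `Y ⟶ Z`. -/
def boundaryDesc {Y Z : SSet.{u}} (f g : Y ⟶ Z) : Y ⊗ (∂Δ[1] : SSet.{u}) ⟶ Z where
  app n := ↾fun y => if y.2.1 = endSimplex 0 n then f.app n y.1 else g.app n y.1
  naturality n m θ := by
    ext ⟨y, α, hα⟩
    rcases mem_boundary_one hα with rfl | rfl
    · exact (if_pos rfl).trans ((ConcreteCategory.congr_hom (f.naturality θ) y).trans
        (congrArg (Z.map θ) (if_pos rfl).symm))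
    · exact (if_neg (endSimplex_ne m)).trans ((ConcreteCategory.congr_hom (g.naturality θ) y).trans
        (congrArg (Z.map θ) (if_neg (endSimplex_ne n)).symm))

lemma boundaryDesc_zero {Y Z : SSet.{u}} (f g : Y ⟶ Z) {n : SimplexCategoryᵒᵖ} (y : Y.obj n)
    (h) : (boundaryDesc f g).app n (y, ⟨endSimplex 0 n, h⟩) = f.app n y := if_pos rfl

lemma boundaryDesc_one {Y Z : SSet.{u}} (f g : Y ⟶ Z) {n : SimplexCategoryᵒᵖ} (y : Y.obj n)
    (h) : (boundaryDesc f g).app n (y, ⟨endSimplex 1 n, h⟩) = g.app n y :=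
  if_neg (endSimplex_ne n)

lemma endSimplex_mem_boundary (e : Fin 2) (n : SimplexCategoryᵒᵖ) :
    endSimplex.{u} e n ∈ (∂Δ[1] : (Δ[1] : SSet.{u}).Subcomplex).obj n := by
  obtain ⟨⟨d⟩⟩ := n
  refine (mem_boundary_iff_notMem_range (n := 1) (d := d) _).2 ⟨1 - e, ?_⟩
  rintro ⟨k, hk⟩
  have h1 : ∀ e : Fin 2, e ≠ 1 - e := by decide
  exact h1 e hk

namespace KanAcyclic

variable {A B C : SSet.{u}}

/-- Two extensions to `L ⊗ B` of the same map on `K ⊗ B ∪ L ⊗ A` are homotopic relative to it. -/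
lemma exists_homotopy {i : A ⟶ B} (hi : KanAcyclic i) {L Z : SSet.{u}} [KanComplex Z]
    (K : L.Subcomplex) (f g : L ⊗ B ⟶ Z) (hK : K.ι ▷ B ≫ f = K.ι ▷ B ≫ g)
    (hA : L ◁ i ≫ f = L ◁ i ≫ g) :
    ∃ H : (L ⊗ B) ⊗ Δ[1] ⟶ Z, endIncl 0 ≫ H = f ∧ endIncl 1 ≫ H = g ∧
      (K.ι ▷ B) ▷ _ ≫ H = CartesianMonoidalCategory.fst _ _ ≫ K.ι ▷ B ≫ f ∧
      (L ◁ i) ▷ _ ≫ H = CartesianMonoidalCategory.fst _ _ ≫ L ◁ i ≫ f := by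
  -- A relative homotopy is an extension problem for the pair `(L ⊗ Δ[1], K ⊗ Δ[1] ∪ L ⊗ ∂Δ[1])`.
  let N : (Δ[1] : SSet.{u}).Subcomplex := ∂Δ[1]
  have sq := (Subcomplex.unionProd.isPushout K N).map (tensorRight B)
  let τ (X : SSet.{u}) : (X ⊗ Δ[1]) ⊗ B ⟶ (X ⊗ B) ⊗ Δ[1] :=
    CartesianMonoidalCategory.lift
      (CartesianMonoidalCategory.fst _ _ ▷ B)
      (CartesianMonoidalCategory.fst _ _ ≫ CartesianMonoidalCategory.snd _ _)
  let τN : (L ⊗ (N : SSet.{u})) ⊗ B ⟶ (L ⊗ B) ⊗ (N : SSet.{u}) :=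
    CartesianMonoidalCategory.lift
      (CartesianMonoidalCategory.fst _ _ ▷ B)
      (CartesianMonoidalCategory.fst _ _ ≫ CartesianMonoidalCategory.snd _ _)
  obtain ⟨φ, hφ1, hφ2⟩ := sq.exists_desc (τN ≫ boundaryDesc f g)
    (τ _ ≫ CartesianMonoidalCategory.fst _ _ ≫ K.ι ▷ B ≫ f) (by
      ext n ⟨⟨k, α, hα⟩, b⟩
      rcases mem_boundary_one hα with rfl | rfl
      · exact boundaryDesc_zero f g _ _
      · let y : ((K : SSet.{u}) ⊗ B).obj n := (k, b)
        exact (boundaryDesc_one f g _ _).trans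
          (ConcreteCategory.congr_hom (NatTrans.congr_app hK n) y).symm)
  obtain ⟨w, hw1, hw2⟩ := hi Z (L ⊗ Δ[1]) (K.unionProd N) φ
    ((L ⊗ Δ[1]) ◁ i ≫ τ L ≫ CartesianMonoidalCategory.fst _ _ ≫ f) (by
      have sqA := (Subcomplex.unionProd.isPushout K N).map (tensorRight A)
      refine sqA.hom_ext ?_ ?_
      · dsimp at hφ1 ⊢
        rw [← whisker_exchange_assoc, hφ1]
        ext n ⟨⟨l, α, hα⟩, a⟩
        rcases mem_boundary_one hα with rfl | rfl
        · exact boundaryDesc_zero f g _ _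
        · let y : (L ⊗ A).obj n := (l, a)
          exact (boundaryDesc_one f g _ _).trans
            (ConcreteCategory.congr_hom (NatTrans.congr_app hA n) y).symm
      · dsimp at hφ2 ⊢
        rw [← whisker_exchange_assoc, hφ2]
        rfl)
  let σ : (L ⊗ B) ⊗ Δ[1] ⟶ (L ⊗ Δ[1]) ⊗ B :=
    CartesianMonoidalCategory.lift
      (CartesianMonoidalCategory.fst _ _ ▷ _)
      (CartesianMonoidalCategory.fst _ _ ≫ CartesianMonoidalCategory.snd _ _)
  rw [← hw1] at hφ1 hφ2
  refine ⟨σ ≫ w, ?_, ?_, ?_, ?_⟩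
  · ext n ⟨l, b⟩
    let y : (((L ⊗ (N : SSet.{u})) ⊗ B).obj n) :=
      ((l, ⟨endSimplex 0 n, endSimplex_mem_boundary 0 n⟩), b)
    exact (ConcreteCategory.congr_hom (NatTrans.congr_app hφ1 n) y).trans
      (boundaryDesc_zero f g _ _)
  · ext n ⟨l, b⟩
    let y : (((L ⊗ (N : SSet.{u})) ⊗ B).obj n) :=
      ((l, ⟨endSimplex 1 n, endSimplex_mem_boundary 1 n⟩), b)
    exact (ConcreteCategory.congr_hom (NatTrans.congr_app hφ1 n) y).trans
      (boundaryDesc_one f g _ _)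
  · ext n ⟨⟨k, b⟩, α⟩
    let y : ((((K : SSet.{u}) ⊗ (Δ[1] : SSet.{u})) ⊗ B).obj n) := ((k, α), b)
    exact ConcreteCategory.congr_hom (NatTrans.congr_app hφ2 n) y
  · ext n ⟨⟨l, a⟩, α⟩
    let y : (((L ⊗ (Δ[1] : SSet.{u})) ⊗ A).obj n) := ((l, α), a)
    exact ConcreteCategory.congr_hom (NatTrans.congr_app hw2 n) y

/-- Cancellation on the right: if `A ⟶ B` and the composite `A ⟶ B ⟶ C` are acyclic, so is
`B ⟶ C`. An extension of the data on `A` agrees on `B` with the given data up to a homotopy relative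
to `A`, and the homotopy extension property corrects it. -/
lemma of_comp (B : C.Subcomplex) (j : A ⟶ B) (hj : KanAcyclic j)
    (hij : KanAcyclic (j ≫ B.ι)) : KanAcyclic B.ι := by
  intro Z _ L K f g h
  obtain ⟨w, hw1, hw2⟩ := hij Z L K f (L ◁ j ≫ g) (by
    rw [whiskerLeft_comp_assoc, h, whisker_exchange_assoc])
  obtain ⟨H, H0, H1, HK, -⟩ := hj.exists_homotopy K (L ◁ B.ι ≫ w) g (by
    rw [← whisker_exchange_assoc, hw1, h]) (by
    rw [← hw2, whiskerLeft_comp_assoc])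
  obtain ⟨G, G0, GK, GB⟩ := exists_homotopy_extension_prod 0 K B w
    (CartesianMonoidalCategory.fst _ _ ≫ f) H hw1.symm H0 (by
      rw [HK, ← whisker_exchange_assoc, hw1]
      rfl)
  refine ⟨endIncl 1 ≫ G, ?_, ?_⟩
  · rw [← endIncl_comp_assoc, GK]
    rfl
  · rw [← endIncl_comp_assoc, GB, H1]

/-- The pushout-product of an acyclic inclusion with an inclusion is acyclic, because the lifting
property for `A ⟶ B` is required for all pairs `(L, K)`, and pushout-products associate. -/
lemma unionProd {P : SSet.{u}} {A : B.Subcomplex} (hA : KanAcyclic A.ι) (N : P.Subcomplex) :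
    KanAcyclic (A.unionProd N).ι := by
  intro Z _ L K f g h
  have sq := (Subcomplex.unionProd.isPushout K N).map (tensorRight B)
  let τf : ((K : SSet.{u}) ⊗ P) ⊗ B ⟶ (K : SSet.{u}) ⊗ (B ⊗ P) :=
    (α_ _ _ _).hom ≫ _ ◁ (β_ _ _).hom
  let τN : (L ⊗ (N : SSet.{u})) ⊗ B ⟶ L ⊗ (A.unionProd N : SSet.{u}) :=
    (α_ _ _ _).hom ≫ _ ◁ (β_ _ _).hom ≫ _ ◁ Subcomplex.unionProd.ι₁ A N
  let τA : (L ⊗ P) ⊗ (A : SSet.{u}) ⟶ L ⊗ (A.unionProd N : SSet.{u}) :=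
    (α_ _ _ _).hom ≫ _ ◁ (β_ _ _).hom ≫ _ ◁ Subcomplex.unionProd.ι₂ A N
  have sqL := (Subcomplex.unionProd.isPushout A N).map (tensorLeft L)
  obtain ⟨φ, hφ1, hφ2⟩ := sq.exists_desc (τN ≫ g) (τf ≫ f) (by
    ext n ⟨⟨k, p⟩, b⟩
    let y : ((K : SSet.{u}) ⊗ (A.unionProd N : SSet.{u})).obj n :=
      (k, (Subcomplex.unionProd.ι₁ A N).app n (b, p))
    exact (ConcreteCategory.congr_hom (NatTrans.congr_app h n) y).symm)
  obtain ⟨w, hw1, hw2⟩ := hA Z (L ⊗ P) (K.unionProd N) φ (τA ≫ g) (by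
    have sqA := (Subcomplex.unionProd.isPushout K N).map (tensorRight (A : SSet.{u}))
    refine sqA.hom_ext ?_ ?_
    · dsimp at hφ1 ⊢
      rw [← whisker_exchange_assoc, hφ1]
      rfl
    · dsimp at hφ2 ⊢
      rw [← whisker_exchange_assoc, hφ2]
      ext n ⟨⟨k, p⟩, a⟩
      let y : ((K : SSet.{u}) ⊗ (A.unionProd N : SSet.{u})).obj n :=
        (k, (Subcomplex.unionProd.ι₂ A N).app n (a, p))
      exact ConcreteCategory.congr_hom (NatTrans.congr_app h n) y)
  let σ : L ⊗ (B ⊗ P) ⟶ (L ⊗ P) ⊗ B := L ◁ (β_ _ _).hom ≫ (α_ _ _ _).inv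
  rw [← hw1] at hφ1 hφ2
  refine ⟨σ ≫ w, ?_, ?_⟩
  · ext n ⟨k, b, p⟩
    let y : (((K : SSet.{u}) ⊗ P) ⊗ B).obj n := ((k, p), b)
    exact ConcreteCategory.congr_hom (NatTrans.congr_app hφ2 n) y
  · refine sqL.hom_ext ?_ ?_
    · ext n ⟨l, b, p⟩
      let y : ((L ⊗ (N : SSet.{u})) ⊗ B).obj n := ((l, p), b)
      exact ConcreteCategory.congr_hom (NatTrans.congr_app hφ1 n) y
    · ext n ⟨l, a, p⟩
      let y : ((L ⊗ P) ⊗ (A : SSet.{u})).obj n := ((l, p), a)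
      exact ConcreteCategory.congr_hom (NatTrans.congr_app hw2 n) y

/-- Attaching `X` to the subcomplex `P` along a map `x` that is injective outside the preimage of
`P`. -/
lemma of_attach {X Y : SSet.{u}} (x : X ⟶ Y) (P Q : Y.Subcomplex) (hPQ : P ≤ Q)
    (hx : Subcomplex.range x ≤ Q) (hQ : Q ≤ P ⊔ Subcomplex.range x)
    (hinj : ∀ n (a b : X.obj n), x.app n a ∉ P.obj n → x.app n a = x.app n b → a = b)
    (h : KanAcyclic (P.preimage x).ι) : KanAcyclic (Subcomplex.homOfLE hPQ) := by
  have sq : IsPushout (P.fromPreimage x) (P.preimage x).ι (Subcomplex.homOfLE hPQ)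
      (Subcomplex.lift x hx) := by
    refine ⟨⟨rfl⟩, ⟨evaluationJointlyReflectsColimits _ fun n =>
      (PushoutCocone.isColimitMapCoconeEquiv _ _).2 ?_⟩⟩
    refine (Types.isPushout_of_isPullback_of_mono' (X₄ := Q.toSSet.obj n)
      (r := (Subcomplex.homOfLE hPQ).app n) (b := (Subcomplex.lift x hx).app n)
      (t := (P.fromPreimage x).app n) (l := (P.preimage x).ι.app n) ?_ ?_ ?_).isColimit
    · refine (Types.isPullback_iff _ _ _ _).2 ⟨rfl, ?_, ?_⟩
      · rintro a b ⟨-, h2⟩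
        exact Subtype.ext h2
      · rintro ⟨q, hq⟩ a hqa
        have : q = x.app n a := congrArg Subtype.val hqa
        subst this
        exact ⟨⟨a, hq⟩, rfl, rfl⟩
    · refine Set.eq_univ_of_forall ?_
      rintro ⟨q, hq⟩
      rcases hQ n hq with hq' | ⟨a, rfl⟩
      · exact Or.inl ⟨⟨q, hq'⟩, rfl⟩
      · exact Or.inr ⟨a, rfl⟩
    · intro a b ha _ hab
      exact hinj n a b (fun h => ha ⟨⟨a, h⟩, rfl⟩) (congrArg Subtype.val hab)
  exact h.of_isPushout sq

/-- The inclusion of the first term of an exhausting increasing sequence of subcomplexes. -/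
lemma of_sequence {X : SSet.{u}} (P : ℕ → X.Subcomplex) (hP : ∀ m, P m ≤ P (m + 1))
    (hP' : ∀ n (x : X.obj n), ∃ m, x ∈ (P m).obj n)
    (h : ∀ m, KanAcyclic (Subcomplex.homOfLE (hP m))) : KanAcyclic (P 0).ι := by
  intro Z _ L K f g hfg
  -- Choose compatible extensions over the stages one after the other.
  let W (m : ℕ) : Type _ :=
    {w : L ⊗ (P m : SSet.{u}) ⟶ Z // (K : SSet.{u}) ◁ (P m).ι ≫ f = K.ι ▷ (P m : SSet.{u}) ≫ w}
  have step (m : ℕ) (w : W m) : ∃ w' : W (m + 1), L ◁ Subcomplex.homOfLE (hP m) ≫ w'.1 = w.1 := by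
    obtain ⟨v, hv1, hv2⟩ := h m Z L K (_ ◁ (P (m + 1)).ι ≫ f) w.1 (by
      rw [← w.2, ← whiskerLeft_comp_assoc]
      rfl)
    exact ⟨⟨v, hv1.symm⟩, hv2⟩
  choose s hs using step
  let w (m : ℕ) : W m := Nat.rec ⟨g, hfg⟩ s m
  have hw (m : ℕ) : L ◁ Subcomplex.homOfLE (hP m) ≫ (w (m + 1)).1 = (w m).1 := hs m (w m)
  have hmono : Monotone P := monotone_nat_of_le_succ hP
  have key (m k : ℕ) (n : SimplexCategoryᵒᵖ) (l : L.obj n) (x : X.obj n) (hx : x ∈ (P m).obj n) :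
      (w (m + k)).1.app n (l, ⟨x, hmono (Nat.le_add_right m k) n hx⟩) =
        (w m).1.app n (l, ⟨x, hx⟩) := by
    induction k with
    | zero => rfl
    | succ k ih =>
      rw [← ih]
      let y : (L ⊗ (P (m + k) : SSet.{u})).obj n :=
        (l, ⟨x, hmono (Nat.le_add_right m k) n hx⟩)
      exact ConcreteCategory.congr_hom (NatTrans.congr_app (hw (m + k)) n) y
  have key' (m m' : ℕ) (n : SimplexCategoryᵒᵖ) (l : L.obj n) (x : X.obj n) (hx : x ∈ (P m).obj n)
      (hx' : x ∈ (P m').obj n) :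
      (w m).1.app n (l, ⟨x, hx⟩) = (w m').1.app n (l, ⟨x, hx'⟩) := by
    rcases le_total m m' with hm | hm
    · obtain ⟨k, rfl⟩ := Nat.exists_eq_add_of_le hm
      exact (key m k n l x hx).symm
    · obtain ⟨k, rfl⟩ := Nat.exists_eq_add_of_le hm
      exact key m' k n l x hx'
  choose d hd using hP'
  let v : L ⊗ X ⟶ Z :=
    { app := fun n => ↾fun y => (w (d n y.2)).1.app n (y.1, ⟨y.2, hd n y.2⟩)
      naturality := fun n m θ => by
        ext ⟨l, x⟩
        let y : (L ⊗ (P (d n x) : SSet.{u})).obj n := (l, ⟨x, hd n x⟩)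
        refine Eq.trans ?_ (ConcreteCategory.congr_hom ((w (d n x)).1.naturality θ) y)
        exact key' _ _ _ _ _ _ ((P (d n x)).map θ (hd n x)) }
  refine ⟨v, ?_, ?_⟩
  · ext n ⟨k, x⟩
    let y : ((K : SSet.{u}) ⊗ (P (d n x) : SSet.{u})).obj n := (k, ⟨x, hd n x⟩)
    exact (ConcreteCategory.congr_hom (NatTrans.congr_app (w (d n x)).2 n) y).symm
  · ext n ⟨l, x, hx⟩
    exact key' _ 0 _ _ _ _ hx

end KanAcyclic

/-! ### Diagonals of bisimplicial sets -/

/-- The diagonal of a bisimplicial set; the latter is encoded as a simplicial object in simplicial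
sets. -/
def diagonal (M : SimplicialObject SSet.{u}) : SSet.{u} where
  obj p := (M.obj p).obj p
  map θ := (M.map θ).app _ ≫ (M.obj _).map θ
  map_id p := by simp
  map_comp θ η := by simp

section Latching

variable (M : SimplicialObject SSet.{u}) (D : ∀ m, (M.obj m).Subcomplex)
  (hD : ∀ {n m : SimplexCategoryᵒᵖ} (θ : n ⟶ m), D n ≤ (D m).preimage (M.map θ))

lemma column_map_comp {n m l : SimplexCategory} (θ : n ⟶ m) (η : m ⟶ l) {p : SimplexCategoryᵒᵖ}
    (y : (M.obj (op l)).obj p) :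
    (M.map θ.op).app p ((M.map η.op).app p y) = (M.map (θ ≫ η).op).app p y := by
  rw [op_comp, M.map_comp]
  rfl

lemma column_map_id {n : SimplexCategory} {p : SimplexCategoryᵒᵖ} (θ : n ⟶ n) (h : θ = 𝟙 n)
    (y : (M.obj (op n)).obj p) : (M.map θ.op).app p y = y := by
  rw [h, op_id, M.map_id]
  rfl

/-- The subcomplex of `M_m` generated by `D_m` and by the simplices that are degenerate along an
operator identifying two of the vertices `0, …, k`. For `k = m` it is the union of `D_m` and the
usual latching object. -/
def latching (m : SimplexCategory) (k : ℕ) : (M.obj (op m)).Subcomplex where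
  obj p := {z | z ∈ (D (op m)).obj p ∨ ∃ (n : SimplexCategory) (θ : m ⟶ n) (i j : Fin (m.len + 1))
    (y : (M.obj (op n)).obj p), i < j ∧ j.val ≤ k ∧ θ i = θ j ∧ (M.map θ.op).app p y = z}
  map {p q} η := by
    rintro z (hz | ⟨n, θ, i, j, y, hij, hk, hθ, rfl⟩)
    · exact Or.inl ((D (op m)).map η hz)
    · exact Or.inr ⟨n, θ, i, j, (M.obj _).map η y, hij, hk, hθ,
        ConcreteCategory.congr_hom ((M.map θ.op).naturality η) y⟩

variable {M D}

lemma latching_zero (m : SimplexCategory) : latching M D m 0 = D (op m) := by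
  ext p z
  refine ⟨?_, Or.inl⟩
  rintro (h | ⟨n, θ, i, j, y, hij, hk, -⟩)
  · exact h
  · have : i.val < j.val := hij
    lia

lemma latching_le_succ (m : SimplexCategory) (k : ℕ) :
    latching M D m k ≤ latching M D m (k + 1) := by
  rintro p z (h | ⟨n, θ, i, j, y, hij, hk, h⟩)
  · exact Or.inl h
  · exact Or.inr ⟨n, θ, i, j, y, hij, hk.trans (Nat.le_succ _), h⟩

lemma predAbove_of_le' {m : ℕ} {k : Fin (m + 1)} {j : Fin (m + 2)} (h : j.val ≤ k) :
    (k.predAbove j).val = j := by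
  rw [Fin.predAbove_of_le_castSucc _ _ h]
  rfl

include hD in
/-- A simplex of `M_m` lies in the `k`-th latching subcomplex if and only if its `k`-th degeneracy
does; the face operator `δ (k + 1)`, which fixes the vertices `0, …, k`, recovers the simplex. -/
lemma latching_preimage (m : ℕ) (k : Fin (m + 1)) :
    (latching M D ⦋m + 1⦌ k).preimage (M.map (SimplexCategory.σ k).op) = latching M D ⦋m⦌ k := by
  have hσδ : ∀ {p} (z : (M.obj (op ⦋m⦌)).obj p), (M.map (SimplexCategory.δ k.succ).op).app p
      ((M.map (SimplexCategory.σ k).op).app p z) = z := fun z => by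
    rw [column_map_comp]
    exact column_map_id M _ SimplexCategory.δ_comp_σ_succ z
  have hσ : ∀ j : Fin (m + 2), j.val ≤ k → (SimplexCategory.σ k j : Fin (m + 1)).val = j :=
    fun j hj => predAbove_of_le' hj
  have hδ : ∀ j : Fin (m + 1), j.val ≤ k →
      (SimplexCategory.δ k.succ j : Fin (m + 2)) = j.castSucc :=
    fun j hj => Fin.succAbove_of_castSucc_lt _ _ (Fin.lt_def.2 (by simp; lia))
  ext p z
  constructor
  · rintro (h | ⟨n, θ, i, j, y, hij, hk, hθ, h⟩)
    · refine Or.inl ?_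
      have := hD (SimplexCategory.δ k.succ).op p h
      change (M.map (SimplexCategory.δ k.succ).op).app p
        ((M.map (SimplexCategory.σ k).op).app p z) ∈ (D (op ⦋m⦌)).obj p at this
      rwa [hσδ] at this
    · have hij' : i.val < j.val := hij
      have hkm := k.2
      refine Or.inr ⟨n, SimplexCategory.δ k.succ ≫ θ, ⟨i, by simp; lia⟩, ⟨j, by simp; lia⟩, y, hij,
        hk, ?_, ?_⟩
      · change θ (SimplexCategory.δ k.succ _) = θ (SimplexCategory.δ k.succ _)
        rw [hδ _ (by simp; lia), hδ _ (by simp; lia)]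
        exact hθ
      · rw [← column_map_comp, h]
        exact hσδ z
  · rintro (h | ⟨n, θ, i, j, y, hij, hk, hθ, rfl⟩)
    · exact Or.inl (hD (SimplexCategory.σ k).op p h)
    · have hij' : i.val < j.val := hij
      refine Or.inr ⟨n, SimplexCategory.σ k ≫ θ, i.castSucc, j.castSucc, y, hij, hk, ?_,
        (column_map_comp M _ _ _).symm⟩
      have hσ' : ∀ j : Fin (m + 1), j.val ≤ k →
          (SimplexCategory.σ k j.castSucc : Fin (m + 1)) = j := fun j hj => Fin.ext (hσ _ hj)
      change θ (SimplexCategory.σ k _) = θ (SimplexCategory.σ k _)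
      rw [hσ' _ hk, hσ' _ (hij'.le.trans hk)]
      exact hθ

include hD in
/-- By induction on `m` and `k`: the subcomplex with index `k + 1` of `M_{m+1}` arises from the one
with index `k` by attaching `M_m` along the degeneracy `σ_k`, and the part of `M_m` that is already
present is the `k`-th latching subcomplex, by `latching_preimage`. So the inclusion of the two
subcomplexes is acyclic, and cancellation gives the claim for `k + 1`. -/
lemma kanAcyclic_latching (h : ∀ m, KanAcyclic (D m).ι) (m k : ℕ) (hk : k ≤ m) :
    KanAcyclic (latching M D ⦋m⦌ k).ι := by
  induction m generalizing k with
  | zero =>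
    obtain rfl : k = 0 := by lia
    rw [latching_zero]
    exact h _
  | succ m ihm =>
    induction k with
    | zero =>
      rw [latching_zero]
      exact h _
    | succ k ihk =>
      have hkm : k < m + 1 := hk
      refine KanAcyclic.of_comp _ (Subcomplex.homOfLE (latching_le_succ ⦋m + 1⦌ k)) ?_
        (ihk hkm.le)
      refine KanAcyclic.of_attach (M.map (SimplexCategory.σ (⟨k, hkm⟩ : Fin (m + 1))).op) _ _ _
        ?_ ?_ ?_ ?_
      · rintro p _ ⟨y, rfl⟩
        refine Or.inr ⟨_, _, ⟨k, by simp; lia⟩, ⟨k + 1, by simp; lia⟩, y, by simp, le_rfl, ?_, rfl⟩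
        refine Fin.ext ?_
        change (Fin.predAbove _ _).val = (Fin.predAbove _ _).val
        rw [predAbove_of_le' (by simp), Fin.predAbove_of_castSucc_lt _ _ (Fin.lt_def.2 (by simp))]
        rfl
      · rintro p z (hz | ⟨n, θ, i, j, y, hij, hj, hθ, rfl⟩)
        · exact Or.inl (Or.inl hz)
        · have hij' : i.val < j.val := hij
          by_cases hjk : j.val ≤ k
          · exact Or.inl (Or.inr ⟨n, θ, i, j, y, hij, hjk, hθ, rfl⟩)
          by_cases hik : i.val = k
          · obtain ⟨θ', rfl⟩ := SimplexCategory.eq_σ_comp_of_not_injective' θ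
              (⟨k, hkm⟩ : Fin (m + 1)) (by
                refine (congrArg θ.toOrderHom ?_).trans (hθ.trans (congrArg θ.toOrderHom ?_))
                · exact Fin.ext hik.symm
                · exact Fin.ext (by simp; lia))
            exact Or.inr ⟨(M.map θ'.op).app p y, column_map_comp M _ _ _⟩
          · refine Or.inl (Or.inr ⟨n, θ, i, ⟨k, by simp; lia⟩, y, Fin.lt_def.2 (by simp; lia),
              le_rfl, ?_, rfl⟩)
            refine le_antisymm (θ.toOrderHom.monotone (Fin.le_def.2 (by simp; lia))) ?_
            rw [hθ]
            exact θ.toOrderHom.monotone (Fin.le_def.2 (by simp; lia))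
      · intro p a b _ hab
        have := congrArg ((M.map (SimplexCategory.δ (⟨k, hkm⟩ : Fin (m + 1)).succ).op).app p) hab
        rw [column_map_comp, column_map_comp] at this
        rwa [column_map_id M _ SimplexCategory.δ_comp_σ_succ,
          column_map_id M _ SimplexCategory.δ_comp_σ_succ] at this
      · have := latching_preimage hD m ⟨k, hkm⟩
        simp only at this
        rw [this]
        exact ihm k (by lia)

/-- The diagonal of a bisimplicial subset. -/
def diagonalSub : (diagonal M).Subcomplex where
  obj p := (D p).obj p
  map θ _ hz := (D _).map θ (hD θ _ hz)

/-- The filtration of the diagonal by the subcomplexes generated by `D` and `M_0, …, M_{m-1}`. -/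
def skeletal (m : ℕ) : (diagonal M).Subcomplex where
  obj p := {z | z ∈ (D p).obj p ∨ ∃ (n : ℕ) (_ : n < m) (θ : p.unop ⟶ ⦋n⦌)
    (y : (M.obj (op ⦋n⦌)).obj p), (M.map θ.op).app p y = z}
  map {p q} η := by
    rintro z (hz | ⟨n, hn, θ, y, rfl⟩)
    · exact Or.inl ((D _).map η (hD η _ hz))
    · refine Or.inr ⟨n, hn, η.unop ≫ θ, (M.obj _).map η y, ?_⟩
      have h1 := column_map_comp M η.unop θ y
      rw [Quiver.Hom.op_unop] at h1
      change _ = (M.obj q).map η ((M.map η).app p ((M.map θ.op).app p y))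
      exact (ConcreteCategory.congr_hom ((M.map (η.unop ≫ θ).op).naturality η) y).trans
        (congrArg ((M.obj q).map η) h1.symm)

variable (M) in
/-- The characteristic map of the `m`-th stage of the filtration. -/
def cell (m : ℕ) : M.obj (op ⦋m⦌) ⊗ Δ[m] ⟶ diagonal M where
  app p := ↾fun y => (M.map (stdSimplex.objEquiv y.2).op).app p y.1
  naturality p q η := by
    ext ⟨y, α⟩
    obtain ⟨θ, rfl⟩ := stdSimplex.objEquiv.symm.surjective α
    have h1 := column_map_comp M η.unop θ y
    rw [Quiver.Hom.op_unop] at h1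
    exact (ConcreteCategory.congr_hom ((M.map (η.unop ≫ θ).op).naturality η) y).trans
        (congrArg ((M.obj q).map η) h1.symm)

lemma mem_boundary_objEquiv_symm {m : ℕ} {p : SimplexCategoryᵒᵖ} (θ : p.unop ⟶ ⦋m⦌) :
    stdSimplex.objEquiv.symm θ ∈ (∂Δ[m] : (Δ[m] : SSet.{u}).Subcomplex).obj p ↔ ¬ Epi θ := by
  rw [SimplexCategory.epi_iff_surjective]
  rfl

lemma mem_latching_of_not_mono {m : ℕ} {n : SimplexCategory} (θ : ⦋m⦌ ⟶ n) (h : ¬ Mono θ)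
    {p : SimplexCategoryᵒᵖ} (y : (M.obj (op n)).obj p) :
    (M.map θ.op).app p y ∈ (latching M D ⦋m⦌ m).obj p := by
  have h' : ∃ i j, i < j ∧ θ i = θ j := by
    rw [SimplexCategory.mono_iff_injective] at h
    simp only [Function.Injective, not_forall] at h
    obtain ⟨i, j, hij, hne⟩ := h
    rcases lt_or_gt_of_ne hne with h | h
    · exact ⟨i, j, h, hij⟩
    · exact ⟨j, i, h, hij.symm⟩
  obtain ⟨i, j, hij, h'⟩ := h'
  exact Or.inr ⟨n, θ, i, j, y, hij, Nat.lt_succ_iff.1 j.2, h', rfl⟩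

include hD in
/-- The part of `M_m × Δ[m]` that the characteristic map sends to the earlier stages of the
filtration is a pushout-product. -/
lemma skeletal_preimage (m : ℕ) :
    (skeletal hD m).preimage (cell M m) = (latching M D ⦋m⦌ m).unionProd ∂Δ[m] := by
  ext p ⟨y, α⟩
  obtain ⟨θ, rfl⟩ := stdSimplex.objEquiv.symm.surjective α
  refine Iff.trans ?_ (Subcomplex.mem_unionProd_iff ..).symm
  refine Iff.trans ?_ (or_congr_left (mem_boundary_objEquiv_symm θ)).symm
  change (M.map θ.op).app p y ∈ (skeletal hD m).obj p ↔ _ ∨ y ∈ _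
  constructor
  · intro h
    by_cases hθ : Epi θ
    · right
      have := isSplitEpi_of_epi θ
      have hy : (M.map (section_ θ).op).app _ ((M.map θ.op).app p y) = y := by
        rw [column_map_comp]
        exact column_map_id M _ (IsSplitEpi.id θ) y
      rcases h with h | ⟨n, hn, η, y', h⟩
      · exact Or.inl (hy ▸ hD (section_ θ).op p h)
      · rw [← hy, ← h, column_map_comp]
        refine mem_latching_of_not_mono _ (fun h => ?_) _
        have := SimplexCategory.le_of_mono (section_ θ ≫ η)
        lia
    · exact Or.inl hθ
  · rintro (h | h)
    · obtain ⟨k, rfl⟩ : ∃ k, m = k + 1 := by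
        rcases m with - | k
        · exact absurd (SimplexCategory.epi_iff_surjective.2 fun x =>
            ⟨0, Subsingleton.elim (α := Fin 1) _ _⟩) h
        · exact ⟨k, rfl⟩
      obtain ⟨⟨d⟩⟩ := p
      obtain ⟨i, θ', rfl⟩ := SimplexCategory.eq_comp_δ_of_not_surjective θ
        (fun h' => h (SimplexCategory.epi_iff_surjective.2 h'))
      exact Or.inr ⟨k, k.lt_succ_self, θ', _, column_map_comp M _ _ y⟩
    · rcases h with h | ⟨n, η, i, j, y', hij, hj, hη, rfl⟩
      · exact Or.inl (hD θ.op p h)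
      · have : ¬ Function.Injective η.toOrderHom := fun h' => hij.ne (h' hη)
        rcases m with - | k
        · exact absurd (Subsingleton.elim (α := Fin 1) i j) hij.ne
        obtain ⟨l, η', rfl⟩ := SimplexCategory.eq_σ_comp_of_not_injective η this
        refine Or.inr ⟨k, k.lt_succ_self, θ ≫ SimplexCategory.σ l, (M.map η'.op).app p y', ?_⟩
        rw [column_map_comp, column_map_comp, Category.assoc]

include hD in
/-- The characteristic map is injective outside the part that belongs to the earlier stages. This is
the uniqueness in the Eilenberg–Zilber lemma, applied to the columns of `M`. -/
lemma cell_injective (m : ℕ) {p : SimplexCategoryᵒᵖ} (a b : (M.obj (op ⦋m⦌) ⊗ Δ[m]).obj p)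
    (ha : (cell M m).app p a ∉ (skeletal hD m).obj p)
    (hab : (cell M m).app p a = (cell M m).app p b) : a = b := by
  have key : ∀ a : (M.obj (op ⦋m⦌) ⊗ Δ[m]).obj p, (cell M m).app p a ∉ (skeletal hD m).obj p →
      ∃ (y : SSet.nonDegenerate (M.flip.obj p) m) (θ : p.unop ⟶ ⦋m⦌), Epi θ ∧
        a = (y.1, stdSimplex.objEquiv.symm θ) := by
    rintro ⟨y, α⟩ h
    obtain ⟨θ, rfl⟩ := stdSimplex.objEquiv.symm.surjective α
    have h' : (y, stdSimplex.objEquiv.symm θ) ∉ ((skeletal hD m).preimage (cell M m)).obj p := h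
    rw [skeletal_preimage] at h'
    replace h' := fun hc => h' ((Subcomplex.mem_unionProd_iff ..).2 hc)
    refine ⟨⟨y, ?_⟩, θ, ?_, rfl⟩
    · rintro ⟨n, hn, f, y', rfl⟩
      refine h' (Or.inr (mem_latching_of_not_mono f (fun hf => ?_) y'))
      have := SimplexCategory.le_of_mono f
      lia
    · by_contra hθ
      exact h' (Or.inl ((mem_boundary_objEquiv_symm θ).2 hθ))
  obtain ⟨y, θ, hθ, rfl⟩ := key a ha
  obtain ⟨y', θ', hθ', rfl⟩ := key b (hab ▸ ha)
  obtain ⟨⟨d⟩⟩ := p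
  have h1 := SSet.unique_nonDegenerate_simplex (X := M.flip.obj (op ⟨d⟩))
    ((M.map θ.op).app _ y.1) θ y rfl θ' y' hab
  have h2 := SSet.unique_nonDegenerate_map (X := M.flip.obj (op ⟨d⟩))
    ((M.map θ.op).app _ y.1) θ y rfl θ' y' hab
  rw [h1, h2]

/-- If every `D_m ⊂ M_m` is acyclic, so is the inclusion of the diagonals. -/
lemma kanAcyclic_diagonalSub (h : ∀ m, KanAcyclic (D m).ι) : KanAcyclic (diagonalSub hD).ι := by
  have hsucc : ∀ m, skeletal hD m ≤ skeletal hD (m + 1) := by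
    rintro m p z (hz | ⟨n, hn, h⟩)
    · exact Or.inl hz
    · exact Or.inr ⟨n, hn.trans m.lt_succ_self, h⟩
  have h0 : skeletal hD 0 = diagonalSub hD := by
    ext p z
    refine ⟨?_, Or.inl⟩
    rintro (hz | ⟨n, hn, -⟩)
    · exact hz
    · exact absurd hn (Nat.not_lt_zero n)
  rw [← h0]
  refine KanAcyclic.of_sequence (skeletal hD) hsucc (fun p z => ?_) fun m => ?_
  · obtain ⟨⟨d⟩⟩ := p
    exact ⟨d + 1, Or.inr ⟨d, d.lt_succ_self, 𝟙 _, z, column_map_id M _ rfl z⟩⟩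
  · refine KanAcyclic.of_attach (cell M m) _ _ _ ?_ ?_ (fun p a b => cell_injective hD m a b) ?_
    · rintro p _ ⟨y, rfl⟩
      exact Or.inr ⟨m, m.lt_succ_self, _, y.1, rfl⟩
    · rintro p z (hz | ⟨n, hn, θ, y, rfl⟩)
      · exact Or.inl (Or.inl hz)
      · rcases Nat.lt_succ_iff_lt_or_eq.1 hn with hn | rfl
        · exact Or.inl (Or.inr ⟨n, hn, θ, y, rfl⟩)
        · exact Or.inr ⟨(y, stdSimplex.objEquiv.symm θ), rfl⟩
    · rw [skeletal_preimage]
      exact (kanAcyclic_latching hD h m m le_rfl).unionProd _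

end Latching

/-! ### Singular simplicial sets of spaces are fibrant -/

section SingularKan

open Classical in
/-- The monotone retraction of `[d]` onto a nonempty subset: the largest element of the subset
below a given vertex, or the smallest element of the subset if there is none. -/
def retractOnto {d : ℕ} (S : Finset (Fin (d + 1))) (hS : S.Nonempty) : ⦋d⦌ ⟶ ⦋d⦌ :=
  SimplexCategory.Hom.mk ⟨fun l => if h : (S.filter (· ≤ l)).Nonempty then
    (S.filter (· ≤ l)).max' h else S.min' hS, fun l l' hl => by
      have hsub : S.filter (· ≤ l) ⊆ S.filter (· ≤ l') :=
        Finset.monotone_filter_right S fun _ _ h => le_trans h hl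
      dsimp only
      split_ifs with h h' h'
      · exact Finset.max'_subset h hsub
      · exact absurd (h.mono hsub) h'
      · exact S.min'_le _ (Finset.mem_filter.1 (Finset.max'_mem _ h')).1
      · exact le_rfl⟩

lemma retractOnto_mem {d : ℕ} (S : Finset (Fin (d + 1))) (hS : S.Nonempty) (l : Fin (d + 1)) :
    retractOnto S hS l ∈ S := by
  classical
  change (if h : (S.filter (· ≤ l)).Nonempty then (S.filter (· ≤ l)).max' h else S.min' hS) ∈ S
  split_ifs with h
  · exact (Finset.mem_filter.1 (Finset.max'_mem _ h)).1
  · exact S.min'_mem hS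

lemma retractOnto_of_mem {d : ℕ} (S : Finset (Fin (d + 1))) (hS : S.Nonempty) {l : Fin (d + 1)}
    (hl : l ∈ S) : retractOnto S hS l = l := by
  classical
  change (if h : (S.filter (· ≤ l)).Nonempty then (S.filter (· ≤ l)).max' h else S.min' hS) = l
  have hl' : l ∈ S.filter (· ≤ l) := Finset.mem_filter.2 ⟨hl, le_rfl⟩
  rw [dif_pos ⟨l, hl'⟩]
  exact le_antisymm (Finset.max'_le _ _ _ fun y hy => (Finset.mem_filter.1 hy).2)
    (Finset.le_max' _ _ hl')

/-- The value at a point of the topological simplex of a singular simplex. -/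
abbrev singEval {Z : TopCat.{u}} {n : SimplexCategoryᵒᵖ} (x : (TopCat.toSSet.obj Z).obj n) :
    C(Simp n, Z) := TopCat.toSSetObjEquiv Z n x

lemma singEval_map {Z : TopCat.{u}} {n m : SimplexCategoryᵒᵖ} (θ : n ⟶ m)
    (x : (TopCat.toSSet.obj Z).obj n) (s : Simp m) :
    singEval ((TopCat.toSSet.obj Z).map θ x) s = singEval x (stdSimplex.map θ.unop s) := rfl

lemma singEval_app_map {X : SSet.{u}} {Z : TopCat.{u}} (g : X ⟶ TopCat.toSSet.obj Z)
    {n m : SimplexCategoryᵒᵖ} (θ : n ⟶ m) (x : X.obj n) (s : Simp m) :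
    singEval (g.app m (X.map θ x)) s = singEval (g.app n x) (stdSimplex.map θ.unop s) := by
  have h : g.app m (X.map θ x) = (TopCat.toSSet.obj Z).map θ (g.app n x) :=
    ConcreteCategory.congr_hom (g.naturality θ) x
  rw [h]
  exact singEval_map θ (g.app n x) s

/-- The smallest barycentric coordinate, the `i`-th one excepted. -/
def minCoord {d : ℕ} (i : Fin (d + 2)) (x : Fin (d + 2) → ℝ) : ℝ :=
  (Finset.univ.erase i).inf' ⟨i.succAbove 0, by simp [Fin.succAbove_ne]⟩ x

lemma minCoord_le {d : ℕ} (i : Fin (d + 2)) (x : Fin (d + 2) → ℝ) {j : Fin (d + 2)} (hj : j ≠ i) :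
    minCoord i x ≤ x j := Finset.inf'_le _ (by simpa using hj)

lemma exists_eq_minCoord {d : ℕ} (i : Fin (d + 2)) (x : Fin (d + 2) → ℝ) :
    ∃ j, j ≠ i ∧ x j = minCoord i x := by
  obtain ⟨j, hj, h⟩ := Finset.exists_mem_eq_inf' (s := Finset.univ.erase i)
    ⟨i.succAbove 0, by simp [Fin.succAbove_ne]⟩ x
  exact ⟨j, by simpa using hj, h.symm⟩

lemma continuous_minCoord {d : ℕ} (i : Fin (d + 2)) : Continuous (minCoord i) :=
  Continuous.finset_inf'_apply _ fun j _ => continuous_apply j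

/-- The retraction of the topological simplex onto its `i`-th horn that moves every point away from
the barycenter of the face opposite to the vertex `i`, towards that vertex. -/
def hornRetract {d : ℕ} (i : Fin (d + 2)) (x : stdSimplex ℝ (Fin (d + 2))) :
    stdSimplex ℝ (Fin (d + 2)) :=
  ⟨fun l => x l - minCoord i x + if l = i then (d + 2) * minCoord i x else 0, by
    constructor
    · intro l
      dsimp only
      split_ifs with h
      · have h1 : 0 ≤ minCoord i x := by
          obtain ⟨j, -, h⟩ := exists_eq_minCoord i x
          exact h ▸ x.2.1 j
        have h2 := x.2.1 l
        change 0 ≤ x.1 l - _ + _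
        have : 0 ≤ (d : ℝ) * minCoord i x := by positivity
        nlinarith
      · rw [add_zero]
        exact sub_nonneg.2 (minCoord_le i x h)
    · rw [Finset.sum_add_distrib, Finset.sum_sub_distrib]
      have := x.2.2
      change ∑ l, x l = 1 at this
      simp [this]⟩

lemma hornRetract_apply {d : ℕ} (i : Fin (d + 2)) (x : stdSimplex ℝ (Fin (d + 2))) (l) :
    hornRetract i x l = x l - minCoord i x + if l = i then (d + 2) * minCoord i x else 0 := rfl

lemma continuous_hornRetract {d : ℕ} (i : Fin (d + 2)) : Continuous (hornRetract i) := by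
  refine Continuous.subtype_mk (continuous_pi fun l => ?_) _
  have h := (continuous_minCoord i).comp
    (continuous_subtype_val : Continuous (Subtype.val : stdSimplex ℝ (Fin (d + 2)) → _))
  refine (((continuous_apply l).comp continuous_subtype_val).sub h).add ?_
  split_ifs
  · exact continuous_const.mul h
  · exact continuous_const

lemma hornRetract_eq_self {d : ℕ} (i : Fin (d + 2)) (x : stdSimplex ℝ (Fin (d + 2)))
    {j : Fin (d + 2)} (hj : j ≠ i) (h : x j = 0) : hornRetract i x = x := by
  have h1 : minCoord i x = 0 := by
    refine le_antisymm (h ▸ minCoord_le i x hj) ?_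
    obtain ⟨j, -, h⟩ := exists_eq_minCoord i x
    exact h ▸ x.2.1 j
  refine stdSimplex.ext (funext fun l => ?_)
  rw [hornRetract_apply, h1]
  simp

lemma hornRetract_eq_zero {d : ℕ} (i : Fin (d + 2)) (x : stdSimplex ℝ (Fin (d + 2)))
    {j : Fin (d + 2)} (hj : j ≠ i) (h : x j = minCoord i x) : hornRetract i x j = 0 := by
  rw [hornRetract_apply, if_neg hj, h]
  simp

lemma map_eq_self_of_fixes {n : SimplexCategory} (r : n ⟶ n) (s : Simp (op n))
    (hr : ∀ l, s l ≠ 0 → r l = l) : stdSimplex.map r s = s :=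
  stdSimplex.ext (push_eq_self hr)

lemma mem_horn_objEquiv_symm {d : ℕ} {i : Fin (d + 2)} {p : SimplexCategoryᵒᵖ}
    (θ : p.unop ⟶ ⦋d + 1⦌) :
    stdSimplex.objEquiv.symm θ ∈ (Λ[d + 1, i] : (Δ[d + 1] : SSet.{u}).Subcomplex).obj p ↔
      ∃ j, j ≠ i ∧ ∀ k, θ k ≠ j := by
  obtain ⟨⟨c⟩⟩ := p
  refine (mem_horn_iff_notMem_range (n := d + 1) (d := c) _ i).trans ?_
  exact exists_congr fun j => ⟨fun ⟨h1, h⟩ => ⟨h1, fun k hk => h ⟨k, hk⟩⟩,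
    fun ⟨h1, h⟩ => ⟨h1, fun ⟨k, hk⟩ => h k hk⟩⟩

section

variable {Z : TopCat.{u}} {d : ℕ} {i : Fin (d + 2)}
  (f : (Λ[d + 1, i] : SSet.{u}) ⟶ TopCat.toSSet.obj Z)

/-- Two simplices of the horn that fix the support of a point have the same value there. -/
lemma horn_eval_eq (r r' : ⦋d + 1⦌ ⟶ ⦋d + 1⦌) (hr hr') (s : stdSimplex ℝ (Fin (d + 2)))
    (hs : ∀ l, s l ≠ 0 → r l = l) (hs' : ∀ l, s l ≠ 0 → r' l = l) :
    singEval (f.app (op ⦋d + 1⦌) ⟨stdSimplex.objEquiv.symm r, hr⟩) s =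
      singEval (f.app (op ⦋d + 1⦌) ⟨stdSimplex.objEquiv.symm r', hr'⟩) s := by
  have hne : (Finset.univ.filter fun l => s l ≠ 0).Nonempty := by
    by_contra h
    rw [Finset.not_nonempty_iff_eq_empty, Finset.filter_eq_empty_iff] at h
    have h1 : ∑ l, s l = 1 := s.2.2
    rw [Finset.sum_eq_zero fun l hl => not_not.1 (h hl)] at h1
    exact zero_ne_one h1
  let q := retractOnto _ hne
  have hq : stdSimplex.map q s = s := map_eq_self_of_fixes (n := ⦋d + 1⦌) q s fun l hl =>
    retractOnto_of_mem _ _ (by simpa using hl)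
  have key : ∀ r : ⦋d + 1⦌ ⟶ ⦋d + 1⦌, (∀ l, s l ≠ 0 → r l = l) → q ≫ r = q := fun r hr =>
    SimplexCategory.Hom.ext _ _ (OrderHom.ext _ _ (funext fun l => hr _
      (Finset.mem_filter.1 (retractOnto_mem _ hne l)).2))
  have key' : ∀ (r : ⦋d + 1⦌ ⟶ ⦋d + 1⦌) (hr), singEval (f.app (op ⦋d + 1⦌)
      ⟨stdSimplex.objEquiv.symm r, hr⟩) s = singEval (f.app (op ⦋d + 1⦌)
      ((Λ[d + 1, i] : SSet.{u}).map q.op ⟨stdSimplex.objEquiv.symm r, hr⟩)) s := fun r hr => by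
    refine (congrArg (singEval (f.app (op ⦋d + 1⦌) ⟨stdSimplex.objEquiv.symm r, hr⟩))
      hq.symm).trans ?_
    exact (singEval_app_map f q.op ⟨stdSimplex.objEquiv.symm r, hr⟩ s).symm
  have h : (Λ[d + 1, i] : SSet.{u}).map q.op ⟨stdSimplex.objEquiv.symm r, hr⟩ =
      (Λ[d + 1, i] : SSet.{u}).map q.op ⟨stdSimplex.objEquiv.symm r', hr'⟩ :=
    Subtype.ext (congrArg stdSimplex.objEquiv.symm ((key r hs).trans (key r' hs').symm))
  exact (key' r hr).trans ((congrArg (fun x => singEval (f.app (op ⦋d + 1⦌) x) s) h).trans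
    (key' r' hr').symm)

/-- The retraction of `[d + 1]` onto the complement of `j`. -/
abbrev skip (j : Fin (d + 2)) : ⦋d + 1⦌ ⟶ ⦋d + 1⦌ :=
  retractOnto (Finset.univ.erase j) ⟨j.succAbove 0, by simp [Fin.succAbove_ne]⟩

lemma skip_apply {j l : Fin (d + 2)} (h : l ≠ j) : skip j l = l :=
  retractOnto_of_mem _ _ (by simpa using h)

lemma skip_mem_horn {j : Fin (d + 2)} (hj : j ≠ i) :
    stdSimplex.objEquiv.symm (skip j) ∈ (Λ[d + 1, i] : (Δ[d + 1] : SSet.{u}).Subcomplex).obj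
      (op ⦋d + 1⦌) :=
  (mem_horn_objEquiv_symm (p := op ⦋d + 1⦌) (skip j)).2 ⟨j, hj, fun k =>
    Finset.ne_of_mem_erase (retractOnto_mem _ _ k)⟩

/-- The map on the topological simplex that the horn assigns to the retraction `skip j`. It
prescribes the extension on the set of points that `hornRetract i` moves to the `j`-th face. -/
def hornPart (j : Fin (d + 2)) (hj : j ≠ i) : C(stdSimplex ℝ (Fin (d + 2)), Z) :=
  singEval (f.app (op ⦋d + 1⦌) ⟨_, skip_mem_horn hj⟩)

/-- The extension to the topological simplex of a continuous map defined on the horn, by means of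
the retraction `hornRetract`. A coordinate `j` where the minimum is attained is chosen; by
`hornFill_eq` the choice does not matter. -/
def hornFill (x : stdSimplex ℝ (Fin (d + 2))) : Z :=
  hornPart f (exists_eq_minCoord i x).choose (exists_eq_minCoord i x).choose_spec.1
    (hornRetract i x)

lemma hornFill_eq {j : Fin (d + 2)} (hj : j ≠ i) (x : stdSimplex ℝ (Fin (d + 2)))
    (h : x j = minCoord i x) : hornFill f x = hornPart f j hj (hornRetract i x) := by
  have hx := (exists_eq_minCoord i x).choose_spec
  refine horn_eval_eq f _ _ _ _ _ (fun l hl => skip_apply ?_) fun l hl => skip_apply ?_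
  · rintro rfl
    exact hl (hornRetract_eq_zero i x hx.1 hx.2)
  · rintro rfl
    exact hl (hornRetract_eq_zero i x hj h)

lemma continuous_hornFill : Continuous (hornFill f) := by
  refine (locallyFinite_of_finite fun j : {j : Fin (d + 2) // j ≠ i} =>
    ({x | x j.1 = minCoord i x} : Set (stdSimplex ℝ (Fin (d + 2))))).continuous ?_ ?_ fun j => ?_
  · refine Set.eq_univ_of_forall fun x => Set.mem_iUnion.2 ?_
    obtain ⟨j, hj, h⟩ := exists_eq_minCoord i x
    exact ⟨⟨j, hj⟩, h⟩
  · intro j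
    exact isClosed_eq ((continuous_apply j.1).comp continuous_subtype_val)
      ((continuous_minCoord i).comp continuous_subtype_val)
  · refine ContinuousOn.congr (f := hornPart f j.1 j.2 ∘ hornRetract i) ?_
      fun x hx => hornFill_eq f j.2 x hx
    exact ((hornPart f j.1 j.2).continuous.comp (continuous_hornRetract i)).continuousOn

end

/-- The singular simplicial set of a space is a Kan complex. -/
instance kanComplex_toSSet (Z : TopCat.{u}) : KanComplex (TopCat.toSSet.obj Z) := by
  rw [KanComplex.iff]
  intro d i g hg
  let f := hg.desc
  let F : (TopCat.toSSet.obj Z).obj (op ⦋d + 1⦌) :=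
    (TopCat.toSSetObjEquiv Z (op ⦋d + 1⦌)).symm ⟨hornFill f, continuous_hornFill f⟩
  refine ⟨yonedaEquiv.symm F, fun j hj => ?_⟩
  rw [← hg.ι_desc j hj, ← horn.ι_ι i j hj, Category.assoc]
  congr 1
  ext p ⟨α, hα⟩
  obtain ⟨θ, rfl⟩ := stdSimplex.objEquiv.symm.surjective α
  obtain ⟨j, hj, hθ⟩ := (mem_horn_objEquiv_symm θ).1 hα
  apply (TopCat.toSSetObjEquiv Z p).injective
  ext s
  change hornFill f (stdSimplex.map θ s) = singEval (f.app p ⟨_, hα⟩) s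
  have h0 : stdSimplex.map θ s j = 0 := push_apply_eq_zero fun k hk => absurd hk (hθ k)
  have h1 := hornRetract_eq_self i (stdSimplex.map θ s) hj h0
  rw [hornFill_eq f hj _ ?_, h1]
  · have h2 : stdSimplex.objEquiv.symm (θ ≫ skip j) = stdSimplex.objEquiv.{u}.symm θ := by
      congr 1
      exact SimplexCategory.Hom.ext _ _ (OrderHom.ext _ _ (funext fun l => skip_apply (hθ l)))
    have h3 := ConcreteCategory.congr_hom (f.naturality θ.op) ⟨_, skip_mem_horn hj⟩
    have h4 : (Λ[d + 1, i] : SSet.{u}).map θ.op ⟨_, skip_mem_horn hj⟩ =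
      ⟨stdSimplex.objEquiv.symm θ, hα⟩ := Subtype.ext h2
    refine Eq.trans ?_ (congrArg (fun x => singEval (f.app p x) s) h4)
    exact congrArg (fun x => singEval x s) h3.symm
  · have := h0
    rw [← h1, hornRetract_apply, if_neg hj, add_zero, sub_eq_zero] at this
    exact this

end SingularKan

/-! ### Realizations of acyclic maps are homotopy equivalences -/

section Endpoints

variable {X Y : SSet.{u}}

/-- The homotopy of a pairing starts at the map given by the simplices of `Δ[1]` that are
constant with value `0`. -/
lemma Pairing.real_zero_realPoint (b : Pairing X Y) {n : SimplexCategoryᵒᵖ} (x : X.obj n)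
    (s : Simp n) :
    b.real (0, realPoint x s) = realPoint (b.app x (SimplexCategory.const _ _ 0)) s := by
  have ha : (1 : ℝ) - ((0 : unitInterval) : ℝ) = 1 := by simp
  have hi : InPrism (1 - ((0 : unitInterval) : ℝ)) s.1 (Fin.last n.unop.len) := by
    rw [ha]
    exact inPrism_last s.2
  rw [b.real_apply, b.fn_eq x s 0 hi]
  let δ : n.unop ⟶ SimplexCategory.mk (n.unop.len + 1) :=
    SimplexCategory.Hom.mk ⟨Fin.castSucc, fun _ _ h => h⟩
  have hs : prismPt (1 - ((0 : unitInterval) : ℝ)) s = stdSimplex.map δ s := by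
    refine stdSimplex.ext ?_
    have h1 : high 1 s.1 = 0 := funext fun j => high_one s.2 j
    have h2 : low 1 s.1 = s.1 := funext fun j => by
      have := high_one s.2 j
      rw [high] at this
      linarith
    change prismCoord _ s.1 = push Fin.castSucc s.1
    rw [ha, prismCoord, h1, h2, map_zero, add_zero]
  have e1 : δ ≫ degen n.unop (Fin.last n.unop.len) = 𝟙 _ :=
    SimplexCategory.Hom.ext _ _ (OrderHom.ext _ _ (funext fun l => by
      change Fin.predAbove (Fin.last n.unop.len) l.castSucc = l
      simp))
  have e2 : δ ≫ cutoff n.unop (Fin.last n.unop.len) = SimplexCategory.const _ _ 0 :=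
    SimplexCategory.Hom.ext _ _ (OrderHom.ext _ _ (funext fun l =>
      if_pos (Fin.castSucc_le_castSucc_iff.2 (Fin.le_last l))))
  have e3 : Y.map δ.op (b.prism x (Fin.last n.unop.len)) =
      b.app x (SimplexCategory.const _ _ 0) := by
    rw [Pairing.prism, b.naturality, ← ConcreteCategory.comp_apply, ← X.map_comp, ← op_comp, e1]
    simp only [op_id, X.map_id]
    exact congrArg _ e2
  rw [hs, ← e3]
  exact (realPoint_map δ.op _ s).symm

/-- The homotopy of a pairing ends at the map given by the simplices of `Δ[1]` that are
constant with value `1`. -/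
lemma Pairing.real_one_realPoint (b : Pairing X Y) {n : SimplexCategoryᵒᵖ} (x : X.obj n)
    (s : Simp n) :
    b.real (1, realPoint x s) = realPoint (b.app x (SimplexCategory.const _ _ 1)) s := by
  have ha : (1 : ℝ) - ((1 : unitInterval) : ℝ) = 0 := by simp
  have hi : InPrism (1 - ((1 : unitInterval) : ℝ)) s.1 (0 : Fin (n.unop.len + 1)) := by
    rw [ha]
    exact ⟨fun j _ => low_zero s.2.1 j, fun j hj => absurd hj (Fin.not_lt_zero j)⟩
  rw [b.real_apply, b.fn_eq x s 1 hi]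
  let δ : n.unop ⟶ SimplexCategory.mk (n.unop.len + 1) :=
    SimplexCategory.Hom.mk ⟨Fin.succ, fun _ _ h => Fin.succ_le_succ_iff.2 h⟩
  have hs : prismPt (1 - ((1 : unitInterval) : ℝ)) s = stdSimplex.map δ s := by
    refine stdSimplex.ext ?_
    have h1 : low 0 s.1 = 0 := funext fun j => low_zero s.2.1 j
    have h2 : high 0 s.1 = s.1 := funext fun j => by
      rw [high, low_zero s.2.1, sub_zero]
    change prismCoord _ s.1 = push Fin.succ s.1
    rw [ha, prismCoord, h1, h2, map_zero, zero_add]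
  have e1 : δ ≫ degen n.unop (0 : Fin (n.unop.len + 1)) = 𝟙 _ :=
    SimplexCategory.Hom.ext _ _ (OrderHom.ext _ _ (funext fun l => by
      change Fin.predAbove (0 : Fin (n.unop.len + 1)) l.succ = l
      simp))
  have e2 : δ ≫ cutoff n.unop (0 : Fin (n.unop.len + 1)) = SimplexCategory.const _ _ 1 :=
    SimplexCategory.Hom.ext _ _ (OrderHom.ext _ _ (funext fun l =>
      if_neg (c := l.succ ≤ (0 : Fin (n.unop.len + 1)).castSucc) (t := (0 : Fin 2))
        (e := (1 : Fin 2)) fun h => absurd (Fin.le_def.1 h) (by simp)))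
  have e3 : Y.map δ.op (b.prism x (0 : Fin (n.unop.len + 1))) =
      b.app x (SimplexCategory.const _ _ 1) := by
    rw [Pairing.prism, b.naturality, ← ConcreteCategory.comp_apply, ← X.map_comp, ← op_comp, e1]
    simp only [op_id, X.map_id]
    exact congrArg _ e2
  rw [hs, ← e3]
  exact (realPoint_map δ.op _ s).symm

/-- A homotopy `X ⊗ Δ[1] ⟶ Y`, as a pairing. -/
def Pairing.ofHom (h : X ⊗ Δ[1] ⟶ Y) : Pairing X Y where
  app {n} x α := h.app n (x, stdSimplex.objEquiv.symm α)
  naturality {n m} θ x α := by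
    let y : (X ⊗ Δ[1]).obj n := (x, stdSimplex.objEquiv.symm α)
    exact (ConcreteCategory.congr_hom (h.naturality θ) y).symm

end Endpoints

/-- A continuous map that has a homotopy inverse. -/
def IsHomotopyEquiv {X Y : Type u} [TopologicalSpace X] [TopologicalSpace Y] (f : C(X, Y)) : Prop :=
  ∃ g : C(Y, X), (g.comp f).Homotopic (.id X) ∧ (f.comp g).Homotopic (.id Y)

lemma IsHomotopyEquiv.comp {X Y Z : Type u} [TopologicalSpace X] [TopologicalSpace Y]
    [TopologicalSpace Z] {g : C(Y, Z)} {f : C(X, Y)} (hg : IsHomotopyEquiv g)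
    (hf : IsHomotopyEquiv f) : IsHomotopyEquiv (g.comp f) := by
  obtain ⟨f', h1, h2⟩ := hf
  obtain ⟨g', h3, h4⟩ := hg
  refine ⟨f'.comp g', ?_, ?_⟩
  · exact (((ContinuousMap.Homotopic.refl f').comp (h3.comp (.refl f)))).trans h1
  · exact (((ContinuousMap.Homotopic.refl g).comp (h2.comp (.refl g')))).trans h4

/-- The continuous map that realizes a map of simplicial sets. -/
abbrev topMap {X Y : SSet.{u}} (f : X ⟶ Y) : C(SSet.toTop.obj X, SSet.toTop.obj Y) :=
  TopCat.Hom.hom (SSet.toTop.map f)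

lemma topMap_realPoint {X Y : SSet.{u}} (f : X ⟶ Y) {n : SimplexCategoryᵒᵖ} (x : X.obj n)
    (s : Simp n) : topMap f (realPoint x s) = realPoint (f.app n x) s := realPoint_app f x s

/-- A pairing gives a homotopy between the realizations of its two ends. -/
lemma Pairing.homotopic {X Y : SSet.{u}} (b : Pairing X Y) (f g : X ⟶ Y)
    (hf : ∀ n (x : X.obj n), b.app x (SimplexCategory.const _ _ 0) = f.app n x)
    (hg : ∀ n (x : X.obj n), b.app x (SimplexCategory.const _ _ 1) = g.app n x) :
    (topMap f).Homotopic (topMap g) := by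
  refine ⟨⟨b.real, fun z => ?_, fun z => ?_⟩⟩
  · have : b.real.comp ((ContinuousMap.const _ 0).prodMk (ContinuousMap.id _)) = topMap f :=
      real_ext fun n x s => by
        refine (b.real_zero_realPoint x s).trans ?_
        rw [hf, topMap_realPoint]
    exact DFunLike.congr_fun this z
  · have : b.real.comp ((ContinuousMap.const _ 1).prodMk (ContinuousMap.id _)) = topMap g :=
      real_ext fun n x s => by
        refine (b.real_one_realPoint x s).trans ?_
        rw [hg, topMap_realPoint]
    exact DFunLike.congr_fun this z

namespace KanAcyclic

variable {A B : SSet.{u}} {i : A ⟶ B}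

/-- The lifting property for `L = Δ[0]` and `K` empty. -/
lemma exists_extension (hi : KanAcyclic i) {Z : SSet.{u}} [KanComplex Z] (g : A ⟶ Z) :
    ∃ w : B ⟶ Z, i ≫ w = g := by
  let f : ((⊥ : (Δ[0] : SSet.{u}).Subcomplex) : SSet.{u}) ⊗ B ⟶ Z :=
    { app := fun n => ↾fun y => y.1.2.elim
      naturality := fun n m θ => by ext ⟨⟨_, hy⟩, _⟩; exact hy.elim }
  obtain ⟨w, -, hw⟩ := hi Z Δ[0] ⊥ f (CartesianMonoidalCategory.snd _ _ ≫ g) (by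
    ext n ⟨⟨_, hy⟩, _⟩; exact hy.elim)
  let pt : ∀ n, (Δ[0] : SSet.{u}).obj n := fun n => stdSimplex.objEquiv.symm
    (SimplexCategory.const n.unop ⦋0⦌ 0)
  let j (X : SSet.{u}) : X ⟶ Δ[0] ⊗ X :=
    { app := fun n => ↾fun x => (pt n, x) }
  refine ⟨j B ≫ w, ?_⟩
  ext n a
  let y : (Δ[0] ⊗ A).obj n := (pt n, a)
  exact ConcreteCategory.congr_hom (NatTrans.congr_app hw n) y

/-- The lifting property for `L = Δ[1]` and `K = ∂Δ[1]`. -/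
lemma exists_homotopy_of_eq (hi : KanAcyclic i) {Z : SSet.{u}} [KanComplex Z] (f g : B ⟶ Z)
    (h : i ≫ f = i ≫ g) : ∃ H : B ⊗ Δ[1] ⟶ Z, endIncl 0 ≫ H = f ∧ endIncl 1 ≫ H = g := by
  let N : (Δ[1] : SSet.{u}).Subcomplex := ∂Δ[1]
  obtain ⟨w, hw, -⟩ := hi Z Δ[1] N ((β_ _ _).hom ≫ boundaryDesc f g)
    (CartesianMonoidalCategory.snd _ _ ≫ i ≫ f) (by
      ext n ⟨⟨α, hα⟩, a⟩
      rcases mem_boundary_one hα with rfl | rfl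
      · exact boundaryDesc_zero f g _ _
      · exact (boundaryDesc_one f g _ _).trans
          (ConcreteCategory.congr_hom (NatTrans.congr_app h n) a).symm)
  refine ⟨(β_ _ _).hom ≫ w, ?_, ?_⟩
  · ext n b
    let y : ((N : SSet.{u}) ⊗ B).obj n := (⟨endSimplex 0 n, endSimplex_mem_boundary 0 n⟩, b)
    exact (ConcreteCategory.congr_hom (NatTrans.congr_app hw n) y).trans
      (boundaryDesc_zero f g _ _)
  · ext n b
    let y : ((N : SSet.{u}) ⊗ B).obj n := (⟨endSimplex 1 n, endSimplex_mem_boundary 1 n⟩, b)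
    exact (ConcreteCategory.congr_hom (NatTrans.congr_app hw n) y).trans
      (boundaryDesc_one f g _ _)

/-- Maps to a singular simplicial set that are simplicially homotopic are adjoint to homotopic
continuous maps. -/
lemma homotopic_of_homotopy {X : SSet.{u}} {Z : TopCat.{u}} (H : X ⊗ Δ[1] ⟶ TopCat.toSSet.obj Z) :
    (TopCat.Hom.hom (realDesc (endIncl 0 ≫ H))).Homotopic
      (TopCat.Hom.hom (realDesc (endIncl 1 ≫ H))) := by
  have h1 : ∀ f : X ⟶ TopCat.toSSet.obj Z, TopCat.Hom.hom (realDesc f) =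
      (TopCat.Hom.hom (realDesc (𝟙 (TopCat.toSSet.obj Z)))).comp (topMap f) := fun f =>
    real_ext fun n x s => by
      refine (realDesc_realPoint f x s).trans ?_
      rw [ContinuousMap.comp_apply, topMap_realPoint]
      exact (realDesc_realPoint (𝟙 _) (f.app n x) s).symm
  rw [h1, h1]
  refine (ContinuousMap.Homotopic.refl _).comp ?_
  exact (Pairing.ofHom H).homotopic _ _ (fun n x => rfl) fun n x => rfl

/-- The realization of an acyclic map `A ⟶ B` is a homotopy equivalence. A homotopy inverse is
adjoint to an extension to `B` of the unit `A ⟶ Sing |A|`, which exists as `Sing |A|` is a Kan complex. -/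
lemma isHomotopyEquiv_topMap (hi : KanAcyclic i) : IsHomotopyEquiv (topMap i) := by
  obtain ⟨w, hw⟩ := hi.exists_extension (Z := TopCat.toSSet.obj (SSet.toTop.obj A))
    (sSetTopAdj.unit.app A)
  have hunit : ∀ X : SSet.{u}, TopCat.Hom.hom (realDesc (sSetTopAdj.unit.app X)) =
      .id (SSet.toTop.obj X) :=
    fun X => real_ext fun n x s => realDesc_realPoint _ x s
  have hr : (TopCat.Hom.hom (realDesc w)).comp (topMap i) = .id _ := by
    refine Eq.trans ?_ (hunit A)
    rw [← hw]
    refine real_ext fun n x s => ?_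
    rw [ContinuousMap.comp_apply, topMap_realPoint]
    exact (realDesc_realPoint w _ s).trans (realDesc_realPoint (i ≫ w) x s).symm
  refine ⟨TopCat.Hom.hom (realDesc w), by rw [hr], ?_⟩
  obtain ⟨H, h0, h1⟩ := hi.exists_homotopy_of_eq
    (Z := TopCat.toSSet.obj (SSet.toTop.obj B)) (w ≫ TopCat.toSSet.map (SSet.toTop.map i))
    (sSetTopAdj.unit.app B) (by
      rw [reassoc_of% hw]
      exact (sSetTopAdj.unit.naturality i).symm)
  have h2 := homotopic_of_homotopy H
  rw [h0, h1, hunit] at h2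
  refine Eq.subst (motive := fun f => ContinuousMap.Homotopic f (.id (SSet.toTop.obj B))) ?_ h2
  symm
  refine real_ext fun n x s => ?_
  rw [ContinuousMap.comp_apply]
  refine (congrArg (topMap i) (realDesc_realPoint w x s)).trans ?_
  exact (realDesc_realPoint (w ≫ TopCat.toSSet.map (SSet.toTop.map i)) x s).symm

end KanAcyclic

/-! ### Homotopy equivalences, weak equivalences and stable equivalences -/

section CubeHomotopy

variable {m : ℕ}

/-- Twice the distance of a point of the cube from its center, in the maximum norm. The boundary
of the cube is where it takes the value `1` (for `m > 0`). -/
def radius (z : Fin m → unitInterval) : ℝ := 2 * ‖fun i => (z i : ℝ) - 1 / 2‖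

/-- Stretch the cube from its center by the factor `1 + s`, and project the result to the cube. -/
def stretch (s : ℝ) (z : Fin m → unitInterval) : Fin m → unitInterval :=
  fun i => Set.projIcc 0 1 zero_le_one ((1 + s) * ((z i : ℝ) - 1 / 2) + 1 / 2)

lemma continuous_radius : Continuous (radius (m := m)) := by
  unfold radius
  fun_prop

lemma continuous_stretch {T : Type*} [TopologicalSpace T] {s : T → ℝ}
    {z : T → Fin m → unitInterval} (hs : Continuous s) (hz : Continuous z) :
    Continuous fun t => stretch (s t) (z t) := by
  unfold stretch
  refine continuous_pi fun i => continuous_projIcc.comp ?_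
  fun_prop

lemma radius_le_one (z : Fin m → unitInterval) : radius z ≤ 1 := by
  have : ‖fun i => (z i : ℝ) - 1 / 2‖ ≤ 1 / 2 :=
    (pi_norm_le_iff_of_nonneg (by norm_num)).2 fun i => by
      rw [Real.norm_eq_abs, abs_le]
      constructor <;> linarith [(z i).2.1, (z i).2.2]
  unfold radius
  linarith

lemma radius_eq_one {z : Fin m → unitInterval} (hz : z ∈ Cube.boundary (Fin m)) :
    radius z = 1 := by
  refine le_antisymm (radius_le_one z) ?_
  obtain ⟨i, hi⟩ := hz
  have h := norm_le_pi_norm (fun i => (z i : ℝ) - 1 / 2) i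
  have h' : ‖(z i : ℝ) - 1 / 2‖ = 1 / 2 := by
    rcases hi with hi | hi <;> rw [hi] <;> norm_num
  rw [h'] at h
  unfold radius
  linarith

lemma stretch_zero (z : Fin m → unitInterval) : stretch 0 z = z := by
  funext i
  have : (1 + 0) * ((z i : ℝ) - 1 / 2) + 1 / 2 = z i := by ring
  unfold stretch
  rw [this, Set.projIcc_val]

lemma stretch_mem_boundary {s : ℝ} (hs : 0 ≤ s) {z : Fin m → unitInterval}
    (h : 1 ≤ (1 + s) * radius z) : stretch s z ∈ Cube.boundary (Fin m) := by
  by_contra hc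
  have hlt : ∀ i, ‖(1 + s) * ((z i : ℝ) - 1 / 2)‖ < 1 / 2 := by
    intro i
    rw [Real.norm_eq_abs, abs_lt]
    constructor <;> by_contra hi
    · exact hc ⟨i, Or.inl (Set.projIcc_of_le_left zero_le_one (by linarith))⟩
    · exact hc ⟨i, Or.inr (Set.projIcc_of_right_le zero_le_one (by linarith))⟩
  have h2 := (pi_norm_lt_iff (x := fun i => (1 + s) * ((z i : ℝ) - 1 / 2)) (by norm_num)).2 hlt
  have h3 : (fun i => (1 + s) * ((z i : ℝ) - 1 / 2)) = (1 + s) • fun i => (z i : ℝ) - 1 / 2 := rfl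
  rw [h3, norm_smul, Real.norm_of_nonneg (by linarith)] at h2
  unfold radius at h
  linarith

variable {X : Type u} [TopologicalSpace X]

/-- A reparametrization of `[0, 1] × I^m`. It turns a homotopy of maps from the cube into a homotopy
relative to the boundary that ends at the same map, and that starts at a map depending only on
the start of the given homotopy and its values on the boundary. At time `t` the cube is stretched
by the factor `2 - t`; the part pushed out of the cube is sent to the boundary, at a time that
increases to `1` at the boundary of the original cube. -/
def squeeze (p : unitInterval × (Fin m → unitInterval)) : unitInterval × (Fin m → unitInterval) :=
  (Set.projIcc 0 1 zero_le_one (p.1 + max 0 ((1 + (1 - (p.1 : ℝ))) * radius p.2 - 1)),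
    stretch (1 - p.1) p.2)

lemma continuous_squeeze : Continuous (squeeze (m := m)) := by
  unfold squeeze
  refine (continuous_projIcc.comp ?_).prodMk (continuous_stretch (by fun_prop) (by fun_prop))
  have := (continuous_radius (m := m)).comp
    (continuous_snd : Continuous (Prod.snd : unitInterval × (Fin m → unitInterval) → _))
  simp only [Function.comp_def] at this
  fun_prop

lemma squeeze_one (z : Fin m → unitInterval) : squeeze (1, z) = (1, z) := by
  have h1 : (1 : ℝ) - ((1 : unitInterval) : ℝ) = 0 := by simp
  simp only [squeeze, h1, stretch_zero]
  refine Prod.ext (Set.projIcc_of_right_le zero_le_one ?_) rfl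
  have := le_max_left 0 ((1 + 0) * radius z - 1)
  rw [Set.Icc.coe_one]
  linarith

lemma squeeze_boundary (t : unitInterval) {z : Fin m → unitInterval}
    (hz : z ∈ Cube.boundary (Fin m)) :
    (squeeze (t, z)).1 = 1 ∧ (squeeze (t, z)).2 ∈ Cube.boundary (Fin m) := by
  have ht := t.2.2
  refine ⟨Set.projIcc_of_right_le zero_le_one ?_, stretch_mem_boundary (by linarith) ?_⟩
  · have := le_max_right 0 ((1 + (1 - (t : ℝ))) * radius z - 1)
    rw [radius_eq_one hz] at this ⊢
    linarith
  · rw [radius_eq_one hz]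
    linarith

lemma squeeze_zero (z : Fin m → unitInterval) :
    (squeeze (0, z)).1 = 0 ∨ (squeeze (0, z)).2 ∈ Cube.boundary (Fin m) := by
  have h1 : (1 : ℝ) - ((0 : unitInterval) : ℝ) = 1 := by simp
  by_cases h : 1 ≤ (1 + 1) * radius z
  · right
    change stretch (1 - ((0 : unitInterval) : ℝ)) z ∈ _
    rw [h1]
    exact stretch_mem_boundary zero_le_one h
  · left
    refine Set.projIcc_of_le_left zero_le_one ?_
    dsimp only
    rw [h1, max_eq_left (by linarith)]
    simp

lemma homotopicRel_squeeze {a b : C(Fin m → unitInterval, X)} (F : a.Homotopy b)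
    (hb : ∃ c, ∀ p ∈ Cube.boundary (Fin m), b p = c) :
    ContinuousMap.HomotopicRel ((F.toContinuousMap.comp ⟨squeeze, continuous_squeeze⟩).comp
      ((ContinuousMap.const _ 0).prodMk (.id _))) b (Cube.boundary (Fin m)) := by
  obtain ⟨c, hc⟩ := hb
  have key : ∀ (t : unitInterval) (z), z ∈ Cube.boundary (Fin m) → F (squeeze (t, z)) = c := by
    intro t z hz
    obtain ⟨h1, h2⟩ := squeeze_boundary t hz
    rw [show squeeze (t, z) = (1, (squeeze (t, z)).2) from Prod.ext h1 rfl, F.apply_one, hc _ h2]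
  refine ⟨⟨⟨F.toContinuousMap.comp ⟨squeeze, continuous_squeeze⟩, fun z => rfl, fun z => ?_⟩, ?_⟩⟩
  · change F (squeeze (1, z)) = b z
    rw [squeeze_one, F.apply_one]
  · intro t z hz
    exact (key t z hz).trans (key 0 z hz).symm

/-- Two homotopies that start at the same map and agree on the boundary of the cube end at maps
that are homotopic relative to the boundary. -/
lemma homotopicRel_of_start {a b b' : C(Fin m → unitInterval, X)} (F : a.Homotopy b)
    (F' : a.Homotopy b') (hb : ∃ c, ∀ p ∈ Cube.boundary (Fin m), b p = c)
    (h : ∀ t, ∀ p ∈ Cube.boundary (Fin m), F (t, p) = F' (t, p)) :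
    b.HomotopicRel b' (Cube.boundary (Fin m)) := by
  have hb' : ∃ c, ∀ p ∈ Cube.boundary (Fin m), b' p = c := by
    obtain ⟨c, hc⟩ := hb
    refine ⟨c, fun p hp => ?_⟩
    rw [← F'.apply_one, ← h 1 p hp, F.apply_one, hc p hp]
  have h1 := homotopicRel_squeeze F hb
  have h2 := homotopicRel_squeeze F' hb'
  refine h1.symm.trans (ContinuousMap.HomotopicRel.trans ?_ h2)
  refine Eq.subst (motive := fun f => ContinuousMap.HomotopicRel _ f _) ?_ (.refl _)
  ext z
  change F (squeeze (0, z)) = F' (squeeze (0, z))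
  rcases squeeze_zero z with hz | hz
  · rw [show squeeze (0, z) = (0, (squeeze (0, z)).2) from Prod.ext hz rfl, F.apply_zero,
      F'.apply_zero]
  · exact h _ _ hz

/-- Two homotopies that end at maps homotopic relative to the boundary and agree on the boundary
start at maps that are homotopic relative to the boundary. -/
lemma homotopicRel_of_end {a a' b b' : C(Fin m → unitInterval, X)} (F : a.Homotopy b)
    (F' : a'.Homotopy b') (hb : b.HomotopicRel b' (Cube.boundary (Fin m)))
    (ha : ∃ c, ∀ p ∈ Cube.boundary (Fin m), a p = c)
    (h : ∀ t, ∀ p ∈ Cube.boundary (Fin m), F (t, p) = F' (t, p)) :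
    a.HomotopicRel a' (Cube.boundary (Fin m)) := by
  obtain ⟨K⟩ := hb
  refine homotopicRel_of_start ((ContinuousMap.Homotopy.refl b).trans F.symm)
    (K.toHomotopy.trans F'.symm) ha fun t p hp => ?_
  rw [ContinuousMap.Homotopy.trans_apply, ContinuousMap.Homotopy.trans_apply]
  split_ifs with ht
  · exact (K.eq_fst _ hp).symm
  · exact h _ p hp

/-- The homotopy extension property of the boundary of the cube, for maps and homotopies that are
constant on the boundary. -/
lemma exists_homotopy_of_path (a : C(Fin m → unitInterval, X)) (γ : C(unitInterval, X))
    (ha : ∀ p ∈ Cube.boundary (Fin m), a p = γ 0) :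
    ∃ (b : C(Fin m → unitInterval, X)) (F : a.Homotopy b),
      ∀ t, ∀ p ∈ Cube.boundary (Fin m), F (t, p) = γ t := by
  -- At time `t` stretch the cube by the factor `1 + t`, and let the part pushed out of the cube run
  -- through the path `γ` up to time `t`.
  let F : unitInterval × (Fin m → unitInterval) → X := fun p =>
    if (1 + (p.1 : ℝ)) * radius p.2 ≤ 1 then a (stretch p.1 p.2) else
      γ (Set.projIcc 0 1 zero_le_one ((1 + (p.1 : ℝ)) * radius p.2 - 1))
  have hr := (continuous_radius (m := m)).comp
    (continuous_snd : Continuous (Prod.snd : unitInterval × (Fin m → unitInterval) → _))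
  simp only [Function.comp_def] at hr
  have hF : Continuous F := by
    refine Continuous.if_le ?_ ?_ (by fun_prop) continuous_const fun p hp => ?_
    · exact a.continuous.comp (continuous_stretch (by fun_prop) (by fun_prop))
    · exact γ.continuous.comp (continuous_projIcc.comp (by fun_prop))
    · rw [ha _ (stretch_mem_boundary p.1.2.1 hp.ge), hp, sub_self, Set.projIcc_left]
      rfl
  have hF0 : ∀ z, F (0, z) = a z := fun z => by
    have h : (1 + ((0 : unitInterval) : ℝ)) * radius z ≤ 1 := by
      simpa using radius_le_one z
    refine (if_pos h).trans ?_
    rw [show stretch ((0 : unitInterval) : ℝ) z = z from stretch_zero z]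
  refine ⟨⟨fun z => F (1, z), by fun_prop⟩, ⟨⟨F, hF⟩, hF0, fun z => rfl⟩, fun t p hp => ?_⟩
  change F (t, p) = γ t
  have h : (1 + (t : ℝ)) * radius p - 1 = t := by rw [radius_eq_one hp]; ring
  by_cases ht : (1 + (t : ℝ)) * radius p ≤ 1
  · have ht0 : t = 0 := le_antisymm (by rw [← Subtype.coe_le_coe, Set.Icc.coe_zero]; linarith) t.2.1
    subst ht0
    rw [hF0, ha p hp]
  · refine (if_neg ht).trans ?_
    dsimp only
    rw [h, Set.projIcc_val]

end CubeHomotopy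

section WeakEquivalence

variable {X Y : Type u} [TopologicalSpace X] [TopologicalSpace Y]

lemma piMap_bijective_iff (f : C(X, Y)) (m : ℕ) (x : X) :
    Function.Bijective (piMap f m x) ↔
      (∀ α β : GenLoop (Fin m) X x, GenLoop.Homotopic (loopMap f rfl α) (loopMap f rfl β) →
        GenLoop.Homotopic α β) ∧
      ∀ β : GenLoop (Fin m) Y (f x), ∃ α : GenLoop (Fin m) X x,
        GenLoop.Homotopic (loopMap f rfl α) β := by
  constructor
  · rintro ⟨h1, h2⟩
    refine ⟨fun α β h => ?_, fun β => ?_⟩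
    · exact Quotient.exact (h1 (Quotient.sound h : piMap f m x ⟦α⟧ = piMap f m x ⟦β⟧))
    · obtain ⟨α, hα⟩ := h2 (⟦β⟧ : Quotient (GenLoop.Homotopic.setoid _ _))
      obtain ⟨α, rfl⟩ := Quotient.exists_rep α
      exact ⟨α, Quotient.exact hα⟩
  · rintro ⟨h1, h2⟩
    refine ⟨fun a b h => ?_, fun b => ?_⟩
    · obtain ⟨α, rfl⟩ := Quotient.exists_rep a
      obtain ⟨β, rfl⟩ := Quotient.exists_rep b
      exact Quotient.sound (h1 α β (Quotient.exact h))
    · obtain ⟨β, rfl⟩ := Quotient.exists_rep b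
      obtain ⟨α, hα⟩ := h2 β
      exact ⟨(⟦α⟧ : Quotient (GenLoop.Homotopic.setoid _ _)), Quotient.sound hα⟩

/-- A map homotopic to the identity, by a homotopy that may move the basepoint, induces bijections
on homotopy groups. -/
lemma piMap_bijective_of_homotopic_id {h : C(X, X)} (hh : h.Homotopic (.id X)) (m : ℕ) (x : X) :
    Function.Bijective (piMap h m x) := by
  obtain ⟨H⟩ := hh
  have key : ∀ α : GenLoop (Fin m) X x, ∃ F : (loopMap h rfl α).1.Homotopy α.1,
      ∀ t, ∀ p ∈ Cube.boundary (Fin m), F (t, p) = H (t, x) := fun α =>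
    ⟨H.comp (.refl α.1), fun t p hp => congrArg (fun y => H (t, y)) (α.2 p hp)⟩
  refine (piMap_bijective_iff h m x).2 ⟨fun α β hαβ => ?_, fun β => ?_⟩
  · obtain ⟨F, hF⟩ := key α
    obtain ⟨G, hG⟩ := key β
    refine homotopicRel_of_end F.symm G.symm hαβ ⟨x, α.2⟩ fun t p hp => ?_
    exact (hF _ p hp).trans (hG _ p hp).symm
  · obtain ⟨a, F, hF⟩ := exists_homotopy_of_path β.1 (H.toContinuousMap.comp
      ((ContinuousMap.id _).prodMk (.const _ x))) fun p hp =>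
        (β.2 p hp).trans (H.apply_zero x).symm
    let α : GenLoop (Fin m) X x := ⟨a, fun p hp => by
      rw [← F.apply_one, hF 1 p hp]
      exact H.apply_one x⟩
    obtain ⟨G, hG⟩ := key α
    refine ⟨α, homotopicRel_of_end G F (.refl _) ⟨h x, (loopMap h rfl α).2⟩ fun t p hp => ?_⟩
    exact (hG t p hp).trans (hF t p hp).symm

/-- A homotopy equivalence is a weak equivalence. Both composites with a homotopy inverse are
bijective on homotopy groups, and so is the map, by the two-out-of-six property of bijections. -/
lemma isWeakEquiv_of_isHomotopyEquiv {f : C(X, Y)} (hf : IsHomotopyEquiv f) : IsWeakEquiv f := by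
  obtain ⟨g, hgf, hfg⟩ := hf
  refine ⟨⟨fun a b h => ?_, fun b => ?_⟩, fun m x => ?_⟩
  · obtain ⟨x, rfl⟩ := Quotient.exists_rep a
    obtain ⟨y, rfl⟩ := Quotient.exists_rep b
    have h1 : Joined (f x) (f y) := Quotient.exact h
    have h2 := h1.map g.continuous
    obtain ⟨H⟩ := hgf
    have h3 : ∀ x, Joined (g (f x)) x := fun x => ⟨H.evalAt x⟩
    exact Quotient.sound ((h3 x).symm.trans (h2.trans (h3 y)))
  · obtain ⟨y, rfl⟩ := Quotient.exists_rep b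
    obtain ⟨H⟩ := hfg
    exact ⟨(⟦g y⟧ : Quotient (pathSetoid X)), Quotient.sound (⟨H.evalAt y⟩ : Joined (f (g y)) y)⟩
  · have e1 : piMap (g.comp f) m x = piMap g m (f x) ∘ piMap f m x := by
      funext a
      obtain ⟨α, rfl⟩ := Quotient.exists_rep a
      rfl
    have e2 : piMap (f.comp g) m (f x) = piMap f m (g (f x)) ∘ piMap g m (f x) := by
      funext a
      obtain ⟨α, rfl⟩ := Quotient.exists_rep a
      rfl
    have h1 := piMap_bijective_of_homotopic_id hgf m x
    have h2 := piMap_bijective_of_homotopic_id hfg m (f x)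
    rw [e1] at h1
    rw [e2] at h2
    have h3 : Function.Bijective (piMap g m (f x)) :=
      ⟨h2.injective.of_comp, h1.surjective.of_comp⟩
    exact (Function.Bijective.of_comp_iff' h3 _).1 h1

end WeakEquivalence

section StableEquivalence

lemma IsWeakEquiv.loops {X Y : Type u} [TopologicalSpace X] [TopologicalSpace Y] {f : C(X, Y)}
    (hf : IsWeakEquiv f) {x : X} {y : Y} (h : f x = y) (m : ℕ) :
    (∀ α β : GenLoop (Fin m) X x, GenLoop.Homotopic (loopMap f h α) (loopMap f h β) →
        GenLoop.Homotopic α β) ∧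
      ∀ β : GenLoop (Fin m) Y y, ∃ α : GenLoop (Fin m) X x,
        GenLoop.Homotopic (loopMap f h α) β := by
  subst h
  exact (piMap_bijective_iff f m x).1 (hf.2 m x)

lemma suspLoop_homotopic (E : TopSpectrum.{u}) {k m : ℕ}
    {α β : GenLoop (Fin m) (E.space k) (E.pt k)} (h : GenLoop.Homotopic α β) :
    GenLoop.Homotopic (suspLoop E α) (suspLoop E β) := by
  obtain ⟨H⟩ := h
  refine ⟨⟨⟨(E.bond k).comp ⟨fun y => (y.2 0, H (y.1, fun i => y.2 i.succ)), by fun_prop⟩,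
    fun z => ?_, fun z => ?_⟩, fun t z hz => ?_⟩⟩
  · change E.bond k (z 0, H (0, _)) = E.bond k (z 0, _)
    rw [H.apply_zero]
  · change E.bond k (z 0, H (1, _)) = E.bond k (z 0, _)
    rw [H.apply_one]
  · change E.bond k (z 0, H (t, _)) = E.bond k (z 0, _)
    obtain ⟨i, hi⟩ := hz
    induction i using Fin.cases with
    | zero =>
      rcases hi with h | h
      · rw [h, E.bond_zero, E.bond_zero]
      · rw [h, E.bond_one, E.bond_one]
    | succ i => rw [H.eq_fst t (x := fun i => z i.succ) ⟨i, hi⟩]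

/-- A levelwise weak equivalence of spectra is a stable equivalence. -/
lemma isStableEquiv_of_levelwise {E E' : TopSpectrum.{u}} (f : E.Hom E')
    (hf : ∀ k, IsWeakEquiv (f.map k)) : f.IsStableEquiv := by
  have hl := fun k m => (hf k).loops (f.map_pt k) m
  choose g hg using fun (k m : ℕ) => (hl k m).2
  intro n
  have hsound : ∀ {k m : ℕ} (h : (m : ℤ) = k + n) (α β : GenLoop (Fin m) (E.space k) (E.pt k)),
      GenLoop.Homotopic α β → (Quot.mk (StableLoop.Rel E n) ⟨k, m, h, α⟩ : StablePi E n) =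
        Quot.mk _ ⟨k, m, h, β⟩ := fun h α β hαβ => Quot.sound (.homotopic h α β hαβ)
  -- The inverse lifts a loop at its own level, up to homotopy.
  let ψ : StablePi E' n → StablePi E n := Quot.lift
    (fun β => Quot.mk _ ⟨β.level, β.dim, β.dim_eq, g β.level β.dim β.loop⟩) (by
      rintro _ _ (⟨h, α, β, hαβ⟩ | @⟨k, m, h, h', β⟩)
      · exact hsound h _ _ ((hl _ _).1 _ _ ((hg _ _ α).trans (hαβ.trans (hg _ _ β).symm)))
      · refine (Quot.sound (.susp h h' (g k m β))).trans (hsound h' _ _ ((hl _ _).1 _ _ ?_))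
        have e : loopMap (f.map (k + 1)) (f.map_pt (k + 1)) (suspLoop E (g k m β)) =
            suspLoop E' (loopMap (f.map k) (f.map_pt k) (g k m β)) := by
          ext y
          exact f.map_bond _ _ _
        rw [e]
        exact (suspLoop_homotopic E' (hg k m β)).trans (hg _ _ _).symm)
  refine ⟨Function.LeftInverse.injective (g := ψ) ?_, ?_⟩
  · rintro ⟨k, m, h, α⟩
    exact hsound h _ _ ((hl k m).1 _ _ (hg k m _))
  · rintro ⟨k, m, h, β⟩
    exact ⟨Quot.mk _ ⟨k, m, h, g k m β⟩, Quot.sound (.homotopic h _ _ (hg k m β))⟩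

end StableEquivalence

/-! ### Acyclic maps of bisimplicial sets -/

section DiagonalMap

variable {N M : SimplicialObject SSet.{u}}

/-- The map of diagonals induced by a map of bisimplicial sets. -/
def diagonalMap (i : N ⟶ M) : diagonal N ⟶ diagonal M where
  app p := (i.app p).app p
  naturality p q θ := by
    ext x
    have h1 := ConcreteCategory.congr_hom (NatTrans.congr_app (i.naturality θ) p) x
    have h2 := ConcreteCategory.congr_hom ((i.app q).naturality θ) ((N.map θ).app p x)
    exact h2.trans (congrArg ((M.obj q).map θ) h1)

/-- A map of simplicial sets that is bijective in each dimension is an isomorphism. -/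
lemma isIso_of_bijective {A B : SSet.{u}} (j : A ⟶ B)
    (hj : ∀ n, Function.Bijective (j.app n)) : IsIso j := by
  have : ∀ n, IsIso (j.app n) := fun n => (isIso_iff_bijective _).2 (hj n)
  exact NatIso.isIso_of_isIso_app j

/-- An injective map is acyclic if the inclusion of a subcomplex whose simplices are exactly its
values is. -/
lemma KanAcyclic.of_range {A B : SSet.{u}} (i : A ⟶ B) (hi : ∀ n, Function.Injective (i.app n))
    (D : B.Subcomplex) (hD : ∀ n x, i.app n x ∈ D.obj n)
    (hD' : ∀ n (y : B.obj n), y ∈ D.obj n → ∃ x, i.app n x = y) (h : KanAcyclic D.ι) :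
    KanAcyclic i := by
  have hr : Subcomplex.range i ≤ D := by
    intro n y hy
    obtain ⟨x, rfl⟩ := hy
    exact hD n x
  have : IsIso (Subcomplex.lift i hr) := isIso_of_bijective _ fun n =>
    ⟨fun _ _ h => hi n (congrArg Subtype.val h), fun y => by
      obtain ⟨x, hx⟩ := hD' n y.1 y.2
      exact ⟨x, Subtype.ext hx⟩⟩
  have h2 := (KanAcyclic.of_isIso (Subcomplex.lift i hr)).comp h
  rwa [Subcomplex.lift_ι] at h2

/-- A dimensionwise acyclic monomorphism of bisimplicial sets is acyclic on diagonals. -/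
lemma kanAcyclic_diagonalMap (i : N ⟶ M) (hi : ∀ p q, Function.Injective ((i.app p).app q))
    (h : ∀ p, KanAcyclic (Subcomplex.range (i.app p)).ι) : KanAcyclic (diagonalMap i) := by
  have hD : ∀ {n m : SimplexCategoryᵒᵖ} (θ : n ⟶ m),
      Subcomplex.range (i.app n) ≤ (Subcomplex.range (i.app m)).preimage (M.map θ) := by
    rintro n m θ q _ ⟨x, rfl⟩
    exact ⟨(N.map θ).app q x,
      ConcreteCategory.congr_hom (NatTrans.congr_app (i.naturality θ) q) x⟩
  exact KanAcyclic.of_range _ (fun p => hi p p) (diagonalSub hD) (fun p x => ⟨x, rfl⟩)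
    (fun p y hy => hy) (kanAcyclic_diagonalSub hD h)

/-- If `q` is a retraction of an acyclic map `s`, it realizes to a homotopy equivalence, and so does
its composite with an acyclic map `i`. -/
lemma KanAcyclic.isHomotopyEquiv_comp_retraction {D M H : SSet.{u}} {i : D ⟶ M} {s : H ⟶ M}
    (hi : KanAcyclic i) (hs : KanAcyclic s) (q : M ⟶ H) (hq : s ≫ q = 𝟙 H) :
    IsHomotopyEquiv (topMap (i ≫ q)) := by
  have h1 : (topMap q).comp (topMap s) = .id _ := by
    change TopCat.Hom.hom (SSet.toTop.map s ≫ SSet.toTop.map q) = _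
    rw [← SSet.toTop.map_comp, hq, SSet.toTop.map_id]
    rfl
  have hq' : IsHomotopyEquiv (topMap q) := by
    obtain ⟨g, -, hg⟩ := hs.isHomotopyEquiv_topMap
    refine ⟨topMap s, ?_, by rw [h1]⟩
    have h2 : (topMap q).Homotopic g := by
      have := (ContinuousMap.Homotopic.refl (topMap q)).comp hg
      rw [← ContinuousMap.comp_assoc, h1] at this
      exact this.symm
    exact ((ContinuousMap.Homotopic.refl (topMap s)).comp h2).trans hg
  have h3 : topMap (i ≫ q) = (topMap q).comp (topMap i) := by
    change TopCat.Hom.hom (SSet.toTop.map (i ≫ q)) = _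
    rw [SSet.toTop.map_comp]
    rfl
  rw [h3]
  exact hq'.comp hi.isHomotopyEquiv_topMap

end DiagonalMap

end Simplicial

/-! ### Families of categories and their cones -/

lemma not_one_le_zero : ¬ (1 : Fin 2) ≤ 0 := by decide

section NerveHomotopy

open MonoidalCategory SSet Simplicial

variable {C E : Type u} [SmallCategory C] [SmallCategory E]

/-- The simplicial homotopy given by a functor on `[1] × C`, that is, by a natural
transformation. -/
def nerveHomotopy (Θ : Fin 2 × C ⥤ E) : nerve C ⊗ Δ[1] ⟶ nerve E where
  app n := ↾fun y => (Functor.prod' (stdSimplex.objEquiv y.2).toOrderHom.monotone.functor y.1 ⋙ Θ :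
    ComposableArrows E n.unop.len)
  naturality _ _ _ := rfl

/-- An end of a functor on `[1] × C`. -/
abbrev endFunctor (Θ : Fin 2 × C ⥤ E) (e : Fin 2) : C ⥤ E :=
  Functor.prod' ((Functor.const C).obj e) (𝟭 C) ⋙ Θ

lemma endIncl_nerveHomotopy (Θ : Fin 2 × C ⥤ E) (e : Fin 2) :
    endIncl e ≫ nerveHomotopy Θ = nerveMap (endFunctor Θ e) := rfl

end NerveHomotopy

/-- A small category with a function on objects that is constant along morphisms: a family of
categories indexed by the set `base`. -/
structure Graded : Type (u + 1) where
  carrier : Type u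
  [cat : SmallCategory carrier]
  base : Type u
  deg : carrier → base
  deg_eq : ∀ {x y : carrier}, (x ⟶ y) → deg x = deg y

attribute [instance] Graded.cat

namespace Graded

/-- A morphism of families of categories: a functor together with a compatible map of the index
sets. -/
@[ext]
structure Hom (P Q : Graded.{u}) where
  functor : P.carrier ⥤ Q.carrier
  map : P.base → Q.base
  deg_obj : ∀ x, Q.deg (functor.obj x) = map (P.deg x)

instance : Category Graded.{u} where
  Hom := Hom
  id P := ⟨𝟭 _, id, fun _ => rfl⟩
  comp F G := ⟨F.functor ⋙ G.functor, G.map ∘ F.map, fun x =>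
    (G.deg_obj _).trans (congrArg G.map (F.deg_obj x))⟩

/-- The disjoint union of the cones on the members of a family of categories: a terminal object
`pt a` is added to the category of objects of degree `a`. -/
inductive Cone (P : Graded.{u}) : Type u
  | of (x : P.carrier)
  | pt (a : P.base)

namespace Cone

variable {P Q : Graded.{u}}

/-- The morphisms of the cone: those of the family, and exactly one morphism from each object of
degree `a` to `pt a`. -/
def Hom : P.Cone → P.Cone → Type u
  | of x, of y => x ⟶ y
  | of x, pt a => ULift (PLift (P.deg x = a))
  | pt _, of _ => PEmpty
  | pt a, pt b => ULift (PLift (a = b))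

/-- Composition in the cone. -/
def comp : ∀ {x y z : P.Cone}, Hom x y → Hom y z → Hom x z
  | of x, of _, of z, f, g => (f ≫ g : (x : P.carrier) ⟶ z)
  | of _, of _, pt _, f, g => ⟨⟨(P.deg_eq f).trans g.down.down⟩⟩
  | of _, pt _, pt _, f, g => ⟨⟨f.down.down.trans g.down.down⟩⟩
  | pt _, pt _, pt _, f, g => ⟨⟨f.down.down.trans g.down.down⟩⟩

instance : SmallCategory P.Cone where
  Hom := Hom
  id
    | of x => 𝟙 x
    | pt _ => ⟨⟨rfl⟩⟩
  comp := comp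
  id_comp {x y} f := by
    cases x <;> cases y
    · exact P.cat.id_comp f
    · rfl
    · exact f.elim
    · rfl
  comp_id {x y} f := by
    cases x <;> cases y
    · exact P.cat.comp_id f
    · rfl
    · exact f.elim
    · rfl
  assoc {x y z w} f g h := by
    cases x <;> cases y <;> cases z <;> cases w <;>
      first
        | exact P.cat.assoc f g h
        | rfl
        | exact PEmpty.elim f
        | exact PEmpty.elim g
        | exact PEmpty.elim h

instance (x : P.Cone) (a : P.base) : Subsingleton (x ⟶ pt a) := by
  cases x
  · exact inferInstanceAs (Subsingleton (ULift (PLift _)))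
  · exact inferInstanceAs (Subsingleton (ULift (PLift _)))

lemma hom_heq {x y x' y' : P.Cone} {a : P.base} (hx : x = x') (hy : y = pt a) (hy' : y' = pt a)
    (f : x ⟶ y) (g : x' ⟶ y') : HEq f g := by
  subst hx hy hy'
  exact heq_of_eq (Subsingleton.elim _ _)

/-- The inclusion of the family of categories in its cone. -/
def incl (P : Graded.{u}) : P.carrier ⥤ P.Cone where
  obj := of
  map f := f

/-- The degree of an object of the cone. -/
def deg : P.Cone → P.base
  | of x => P.deg x
  | pt a => a

lemma deg_eq {x y : P.Cone} (f : x ⟶ y) : deg x = deg y := by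
  cases x <;> cases y
  · exact P.deg_eq f
  · exact f.down.down
  · exact f.elim
  · exact f.down.down

/-- The functor on cones induced by a map of families. -/
def map (F : P ⟶ Q) : P.Cone ⥤ Q.Cone where
  obj
    | of x => of (F.functor.obj x)
    | pt a => pt (F.map a)
  map {x y} f := match x, y, f with
    | of _, of _, f => F.functor.map f
    | of x, pt _, f => ⟨⟨(F.deg_obj x).trans (congrArg F.map f.down.down)⟩⟩
    | pt _, pt _, f => ⟨⟨congrArg F.map f.down.down⟩⟩
  map_id x := by
    cases x
    · exact F.functor.map_id _
    · rfl
  map_comp {x y z} f g := by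
    cases x <;> cases y <;> cases z <;>
      first | exact F.functor.map_comp f g | rfl | exact f.elim | exact g.elim

lemma deg_map_obj (F : P ⟶ Q) (x : P.Cone) : deg ((map F).obj x) = F.map (deg x) := by
  cases x
  · exact F.deg_obj _
  · rfl

/-- The morphism from an object of the cone to the cone point of its degree. -/
def toTip : ∀ x : P.Cone, x ⟶ pt (deg x)
  | of _ => ⟨⟨rfl⟩⟩
  | pt _ => ⟨⟨rfl⟩⟩

lemma map_id (P : Graded.{u}) : map (𝟙 P) = 𝟭 P.Cone :=
  Functor.hext (by rintro (_ | _) <;> rfl) (by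
    rintro (_ | _) (_ | _) f <;> first | rfl | exact f.elim)

lemma map_comp {R : Graded.{u}} (F : P ⟶ Q) (G : Q ⟶ R) : map (F ≫ G) = map F ⋙ map G :=
  Functor.hext (by rintro (_ | _) <;> rfl) (by
    rintro (_ | _) (_ | _) f <;> first | rfl | exact f.elim)

end Cone

/-- The nerve of a family of categories. -/
def nerveFunctor : Graded.{u} ⥤ SSet.{u} where
  obj P := nerve P.carrier
  map F := nerveMap F.functor

/-- The nerve of the cone. -/
def coneNerve : Graded.{u} ⥤ SSet.{u} where
  obj P := nerve P.Cone
  map F := nerveMap (Cone.map F)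
  map_id P := by rw [Cone.map_id]; rfl
  map_comp F G := by rw [Cone.map_comp]; rfl

/-- The index set of a family of categories, as a constant simplicial set. -/
def baseFunctor : Graded.{u} ⥤ SSet.{u} where
  obj P := (Functor.const _).obj P.base
  map F := (Functor.const _).map (↾F.map)

/-- The nerve of a family of categories is contained in that of the cone. -/
def nerveIncl : nerveFunctor.{u} ⟶ coneNerve where
  app P := nerveMap (Cone.incl P)
  naturality _ _ _ := rfl

/-- The index set is contained in the nerve of the cone, as the set of cone points. -/
def baseIncl : baseFunctor.{u} ⟶ coneNerve where
  app P := { app := fun n => ↾fun a => ((Functor.const _).obj (Cone.pt a) :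
    ComposableArrows P.Cone n.unop.len) }
  naturality _ _ _ := rfl

/-- The projection of the nerve of the cone onto the index set. -/
def coneProj : coneNerve.{u} ⟶ baseFunctor where
  app P :=
    { app := fun n => ↾fun x => Cone.deg (x.obj 0)
      naturality := fun n m θ => by
        ext x
        exact (Cone.deg_eq (x.map (homOfLE (Fin.zero_le _)))).symm }
  naturality P Q F := by
    ext n x
    exact Cone.deg_map_obj F _

/-- The homotopy that pushes the cone to its cone points. -/
def toPt (P : Graded.{u}) : Fin 2 × P.Cone ⥤ P.Cone where
  obj
    | (0, x) => x
    | (1, x) => .pt (Cone.deg x)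
  map {x y} f := match x, y, f with
    | (0, _), (0, _), f => f.2
    | (0, x), (1, y), f => (Cone.toTip x ≫ ⟨⟨Cone.deg_eq f.2⟩⟩ : x ⟶ .pt (Cone.deg y))
    | (1, _), (1, _), f => ⟨⟨Cone.deg_eq f.2⟩⟩
    | (1, _), (0, _), f => absurd (leOfHom f.1) not_one_le_zero
  map_id := by
    rintro ⟨e, x⟩
    fin_cases e
    · rfl
    · exact Subsingleton.elim _ _
  map_comp := by
    rintro ⟨e, x⟩ ⟨e', y⟩ ⟨e'', z⟩ f g
    fin_cases e'' <;> fin_cases e' <;> fin_cases e <;>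
      first | rfl | exact Subsingleton.elim _ _ | exact absurd (leOfHom f.1) not_one_le_zero |
        exact absurd (leOfHom g.1) not_one_le_zero


section Deformation

open MonoidalCategory SSet Simplicial Limits

/-- A natural transformation between self-maps of a category that is constant on the image of `i`
and connects the identity to a functor with values in that image. -/
lemma kanAcyclic_range_of_functor {A : SSet.{u}} {E : Type u} [SmallCategory E]
    (i : A ⟶ nerve E) (e e' : Fin 2) (Θ : Fin 2 × E ⥤ E)
    (h0 : ∀ n b, ∃ a, i.app n a = (nerveMap (endFunctor Θ e)).app n b)
    (h1 : endFunctor Θ e' = 𝟭 E)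
    (hi : ∀ n a α, (nerveHomotopy Θ).app n (i.app n a, α) = i.app n a) :
    KanAcyclic (Subcomplex.range i).ι := by
  refine KanAcyclic.of_deformation e e' _ (nerveHomotopy Θ) h0 ?_ ?_
  · rw [endIncl_nerveHomotopy, h1]
    rfl
  · ext n ⟨⟨_, a, rfl⟩, α⟩
    exact hi n a α

lemma baseIncl_injective (P : Graded.{u}) (n : SimplexCategoryᵒᵖ) :
    Function.Injective ((baseIncl.app P).app n) :=
  Function.LeftInverse.injective (g := (coneProj.app P).app n) fun _ => rfl

lemma endFunctor_toPt_zero (P : Graded.{u}) : endFunctor (toPt P) 0 = 𝟭 P.Cone := rfl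

/-- The set of cone points is a deformation retract of the cone, since they are terminal. -/
lemma kanAcyclic_baseIncl (P : Graded.{u}) :
    KanAcyclic (Subcomplex.range (baseIncl.app P)).ι := by
  refine kanAcyclic_range_of_functor (baseIncl.app P) 1 0 (toPt P)
    (fun n (b : Fin (n.unop.len + 1) ⥤ P.Cone) => ?_) (endFunctor_toPt_zero P) (fun n a α => ?_)
  · have h (k) : (Cone.pt (Cone.deg (b.obj 0)) : P.Cone) = .pt (Cone.deg (b.obj k)) :=
      congrArg Cone.pt (Cone.deg_eq (b.map (homOfLE (Fin.zero_le k))))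
    exact ⟨Cone.deg (b.obj 0), Functor.hext (C := Fin (n.unop.len + 1)) (D := P.Cone) h
      fun k l f => Cone.hom_heq (h k) rfl (h l).symm _ _⟩
  · have h : ∀ e, (toPt P).obj (e, Cone.pt a) = Cone.pt a := by
      intro e
      fin_cases e <;> rfl
    exact Functor.hext (C := Fin (n.unop.len + 1)) (D := P.Cone) (fun k => h _)
      fun k l f => Cone.hom_heq (h _) (h _) rfl _ _

end Deformation

/-- Terminal objects of the members of a family of categories. -/
structure Terminals (P : Graded.{u}) where
  obj : P.base → P.carrier
  deg_obj : ∀ a, P.deg (obj a) = a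
  hom : ∀ x a, P.deg x = a → (x ⟶ obj a)
  subsingleton : ∀ x a, Subsingleton (x ⟶ obj a)

namespace Terminals

open Cone

variable {P : Graded.{u}} (T : P.Terminals)

instance (x : P.Cone) (a : P.base) : Subsingleton (x ⟶ of (T.obj a)) := by
  cases x
  · exact T.subsingleton _ _
  · exact inferInstanceAs (Subsingleton PEmpty)

/-- The retraction of the cone that sends the cone points to the terminal objects. -/
def retraction : P.Cone ⥤ P.carrier where
  obj
    | of x => x
    | pt a => T.obj a
  map {x y} f := match x, y, f with
    | of _, of _, f => f
    | of x, pt a, f => T.hom x a f.down.down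
    | pt a, pt b, f => T.hom (T.obj a) b ((T.deg_obj a).trans f.down.down)
  map_id x := by
    cases x
    · rfl
    · exact (T.subsingleton _ _).elim _ _
  map_comp {x y z} f g := by
    cases z
    · cases y
      · cases x
        · rfl
        · exact PEmpty.elim f
      · exact PEmpty.elim g
    · exact (T.subsingleton _ _).elim _ _

/-- The homotopy from the retraction to the identity, on objects. The case distinction on the object
comes first, so that the homotopy is constant on the objects `of x` by definition. -/
def collapseObj : P.Cone → Fin 2 → P.Cone
  | of x, _ => of x
  | pt a, 0 => of (T.obj a)
  | pt a, 1 => pt a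

/-- The homotopy from the retraction to the identity, on morphisms. -/
def collapseMap : ∀ (x y : P.Cone) (e e' : Fin 2), e ≤ e' → (x ⟶ y) →
    (T.collapseObj x e ⟶ T.collapseObj y e')
  | of _, of _, _, _, _, f => f
  | of x, pt a, _, 0, _, f => T.hom x a f.down.down
  | of _, pt _, _, 1, _, f => f
  | pt _, of _, _, _, _, f => PEmpty.elim f
  | pt a, pt b, 0, 0, _, f => T.hom (T.obj a) b ((T.deg_obj a).trans f.down.down)
  | pt a, pt _, 0, 1, _, f => ⟨⟨(T.deg_obj a).trans f.down.down⟩⟩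
  | pt _, pt _, 1, 0, h, _ => absurd h not_one_le_zero
  | pt _, pt _, 1, 1, _, f => f

instance (x : P.Cone) (a : P.base) : ∀ e, Subsingleton (x ⟶ T.collapseObj (pt a) e)
  | 0 => inferInstanceAs (Subsingleton (x ⟶ of (T.obj a)))
  | 1 => inferInstanceAs (Subsingleton (x ⟶ pt a))

/-- The homotopy from the retraction to the identity. -/
def collapse : Fin 2 × P.Cone ⥤ P.Cone where
  obj x := T.collapseObj x.2 x.1
  map {x y} f := T.collapseMap x.2 y.2 x.1 y.1 (leOfHom f.1) f.2
  map_id := by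
    rintro ⟨e, x | a⟩
    · rfl
    · exact Subsingleton.elim (α := _ ⟶ T.collapseObj (pt a) e) _ _
  map_comp := by
    rintro ⟨e, x⟩ ⟨e', y⟩ ⟨e'', z | c⟩ f g
    · cases y
      · cases x
        · rfl
        · exact PEmpty.elim f.2
      · exact PEmpty.elim g.2
    · exact Subsingleton.elim (α := _ ⟶ T.collapseObj (pt c) e'') _ _

lemma endFunctor_collapse_zero : endFunctor T.collapse 0 = T.retraction ⋙ incl P :=
  Functor.hext (by rintro (_ | _) <;> rfl) (by
    rintro (_ | _) (_ | _) f <;> first | rfl | exact PEmpty.elim f)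

lemma endFunctor_collapse_one : endFunctor T.collapse 1 = 𝟭 P.Cone :=
  Functor.hext (by rintro (_ | _) <;> rfl) (by
    rintro (_ | _) (_ | _) f <;> first | rfl | exact PEmpty.elim f)

lemma nerveIncl_injective {P : Graded.{u}} (T : P.Terminals) (n : SimplexCategoryᵒᵖ) :
    Function.Injective ((nerveIncl.app P).app n) :=
  Function.LeftInverse.injective (g := (nerveMap T.retraction).app n) fun _ => rfl

/-- If the members of a family of categories have terminal objects, the family is a deformation
retract of its cone. -/
lemma kanAcyclic_nerveIncl {P : Graded.{u}} (T : P.Terminals) :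
    KanAcyclic (SSet.Subcomplex.range (nerveIncl.app P)).ι := by
  refine kanAcyclic_range_of_functor (nerveIncl.app P) 0 1 T.collapse
    (fun n b => ⟨(nerveMap T.retraction).app n b, ?_⟩) T.endFunctor_collapse_one
    (fun n a α => rfl)
  rw [endFunctor_collapse_zero]
  rfl

end Terminals

/-- The map from the diagonal of the nerves of a simplicial family of categories to its simplicial
set of indices. -/
def diagonalDeg (S : SimplicialObject Graded.{u}) :
    diagonal (S ⋙ nerveFunctor) ⟶ diagonal (S ⋙ baseFunctor) :=
  diagonalMap (Functor.whiskerLeft S nerveIncl) ≫ diagonalMap (Functor.whiskerLeft S coneProj)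

/-- The realization lemma for a simplicial family of categories with terminal objects. The terminal
objects are not required to be compatible with the simplicial structure. -/
lemma isHomotopyEquiv_diagonalDeg (S : SimplicialObject Graded.{u})
    (T : ∀ p, (S.obj p).Terminals) : IsHomotopyEquiv (topMap (diagonalDeg S)) :=
  KanAcyclic.isHomotopyEquiv_comp_retraction
    (kanAcyclic_diagonalMap _ (fun p q => Terminals.nerveIncl_injective (T p) q)
      fun p => Terminals.kanAcyclic_nerveIncl (T p))
    (kanAcyclic_diagonalMap (Functor.whiskerLeft S baseIncl)
      (fun p q => baseIncl_injective (S.obj p) q) fun p => kanAcyclic_baseIncl (S.obj p)) _ rfl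

lemma isHomotopyEquiv_deg {P : Graded.{u}} (T : P.Terminals) :
    IsHomotopyEquiv (topMap (nerveIncl.app P ≫ coneProj.app P)) :=
  KanAcyclic.isHomotopyEquiv_comp_retraction
    (KanAcyclic.of_range _ (Terminals.nerveIncl_injective T)
      (SSet.Subcomplex.range (nerveIncl.app P)) (fun _ x => ⟨x, rfl⟩)
      (fun _ _ hy => hy) (Terminals.kanAcyclic_nerveIncl T))
    (KanAcyclic.of_range (baseIncl.app P) (baseIncl_injective P)
      (SSet.Subcomplex.range (baseIncl.app P)) (fun _ x => ⟨x, rfl⟩)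
      (fun _ _ hy => hy) (kanAcyclic_baseIncl P)) _ rfl

end Graded

/-! ### The elements represented by tuples -/

section Total

variable {A : Type u} [AddCommGroup A]

lemma EAval_eq_under {c : WithInitial (EObj A)} (h : c ≠ .star) : EAval c = (under c h).val := by
  cases c with
  | of a => rfl
  | star => exact absurd rfl h

lemma finsum_subtype_of_eq_zero {α M : Type*} [AddCommMonoid M] (p : α → Prop) (f : α → M)
    (h : ∀ a, ¬ p a → f a = 0) : ∑ᶠ a : {a // p a}, f a = ∑ᶠ a, f a := by
  rw [finsum_subtype_eq_finsum_cond]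
  refine finsum_congr fun a => ?_
  by_cases ha : p a
  · simp [ha]
  · simp [ha, h a ha]

lemma finsum_fiberwise {α β M : Type*} [AddCommMonoid M] [Finite α] [Finite β] (g : α → β)
    (f : α → M) : ∑ᶠ b, ∑ᶠ a : {a // g a = b}, f a = ∑ᶠ a, f a := by
  classical
  have := Fintype.ofFinite α
  have := Fintype.ofFinite β
  simp only [finsum_eq_sum_of_fintype]
  exact Fintype.sum_fiberwise g f

lemma finsum_under {I : Type} [Finite I] (a : I → WithInitial (EObj A)) :
    ∑ᶠ i : {i // a i ≠ .star}, (under (a i) i.2).val = ∑ᶠ i, EAval (a i) := by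
  rw [← finsum_subtype_of_eq_zero (fun i => a i ≠ .star) (fun i => EAval (a i))
    fun i hi => by rw [not_not.1 hi]; rfl]
  exact finsum_congr fun i => (EAval_eq_under i.2).symm

/-- A family in `EA_*` is covering if and only if the values of its sources add up to the value
of the target. -/
lemma isCover_EAstar_iff {I : Type} [Finite I] {b : (EAstar A).carrier}
    (a : I → (EAstar A).carrier) (f : ∀ i, a i ⟶ b) :
    (EAstar A).IsCover a f ↔ ∑ᶠ i, EAval (a i) = EAval b := by
  by_cases hb : b = .star
  · refine iff_of_true (fun hb' => absurd hb hb') ?_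
    subst hb
    have h : a = fun _ => .star := funext fun i => (EAstar A).eq_base (f i)
    rw [h]
    exact finsum_zero
  · rw [EAval_eq_under hb]
    exact ⟨fun h => (finsum_under a).symm.trans (h hb), fun h _ => (finsum_under a).trans h⟩

instance (c d : (EAstar A).carrier) : Subsingleton (c ⟶ d) := by
  cases c <;> cases d
  · exact inferInstanceAs (Subsingleton PUnit)
  · exact inferInstanceAs (Subsingleton PEmpty)
  · exact inferInstanceAs (Subsingleton PUnit)
  · exact inferInstanceAs (Subsingleton PUnit)

lemma nonempty_hom_of_ne_base (c : (EAstar A).carrier) {d : (EAstar A).carrier}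
    (hd : d ≠ (EAstar A).base) : Nonempty (c ⟶ d) := by
  cases d
  · cases c
    · exact ⟨(⟨⟩ : PUnit)⟩
    · exact ⟨(⟨⟩ : PUnit)⟩
  · exact absurd rfl hd

variable {X Y : Pointed.{0}}

/-- The element `a` of the summand at `x` of `X ⊗ A`, and `0` if `x` is the basepoint. -/
def summand (x : X) (a : A) : {x : X // x ≠ X.point} →₀ A :=
  Finsupp.subtypeDomain (· ≠ X.point) (Finsupp.single x a)

lemma summand_point (a : A) : summand X.point a = 0 := by
  ext y
  exact Finsupp.single_eq_of_ne y.2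

lemma summand_of_ne {x : X} (hx : x ≠ X.point) (a : A) :
    summand x a = Finsupp.single ⟨x, hx⟩ a := by
  classical
  ext y
  simp [summand, Finsupp.single_apply, Subtype.ext_iff]

/-- The inclusion of a summand, as an additive map. -/
def summandHom (x : X) : A →+ ({x : X // x ≠ X.point} →₀ A) :=
  (Finsupp.subtypeDomainAddMonoidHom (p := (· ≠ X.point))).comp (Finsupp.singleAddHom x)

lemma summand_apply (x : X) (a : A) (y : {x : X // x ≠ X.point}) :
    summand x a y = ∑ᶠ _ : x = y.1, a := by
  classical
  rw [finsum_eq_if]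
  exact Finsupp.single_apply

/-- The element of `X ⊗ A` given by an object `(x, a)` of `X ∧ EA_*`; it is `0` for the
basepoint. -/
def entry (P : SmashObj X (EAstar A)) : {x : X // x ≠ X.point} →₀ A :=
  summand P.label (EAval P.obj)

lemma entry_base : entry (smash X (EAstar A)).base = 0 := summand_point _

/-- The element `(∑_{x_i = x} a_i)_x` of `X ⊗ A` given by a tuple `{(x_i, a_i)}`. -/
def total (w : Cov (smash X (EAstar A))) : {x : X // x ≠ X.point} →₀ A :=
  ∑ᶠ i, entry (w.tuple i)

lemma total_empty : total (Cov.empty (smash X (EAstar A))) = 0 :=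
  (finsum_congr fun _ => entry_base).trans finsum_zero

lemma finite_support_entry (w : Cov (smash X (EAstar A))) :
    (Function.support fun i => entry (w.tuple i)).Finite :=
  w.finite.subset fun i hi h => hi (by change entry _ = 0; rw [h, entry_base])

lemma total_apply (w : Cov (smash X (EAstar A))) (x : {x : X // x ≠ X.point}) :
    total w x = ∑ᶠ i : {i : ℕ // (w.tuple i).label = x.1}, EAval (w.tuple i).obj := by
  have h := (Finsupp.applyAddHom (M := A) x).map_finsum (finite_support_entry w)
  refine h.trans ?_
  rw [finsum_subtype_eq_finsum_cond (f := fun i => EAval (w.tuple i).obj)]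
  exact finsum_congr fun i => summand_apply _ _ _

lemma total_eq_finsum_idx (w : Cov (smash X (EAstar A))) :
    total w = ∑ᶠ i : w.Idx, entry (w.at i) :=
  (finsum_subtype_of_eq_zero (fun i => w.tuple i ≠ (smash X (EAstar A)).base)
    (fun i => entry (w.tuple i)) fun i hi => by rw [not_not.1 hi, entry_base]).symm

lemma label_ne_point {P : SmashObj X (EAstar A)} (h : P ≠ (smash X (EAstar A)).base) :
    P.label ≠ X.point := fun hP => h (SmashObj.ext hP (P.compat.1 hP))

/-- A morphism in the category of covers does not change the sums, since in each of its covering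
families the labels are constant and the values of the sources add up to that of the target. -/
lemma total_eq_of_hom {w v : Cov (smash X (EAstar A))} (f : w ⟶ v) : total w = total v := by
  rw [total_eq_finsum_idx, total_eq_finsum_idx, ← finsum_fiberwise f.idx]
  refine finsum_congr fun j => ?_
  have h : ∑ᶠ i : {i // f.idx i = j}, EAval (w.at i.1).obj = EAval (v.at j).obj :=
    (isCover_EAstar_iff _ fun i : {i // f.idx i = j} => (f.map i.1 j i.2).hom).1 (f.cover j)
  have h2 : ∀ i : {i // f.idx i = j}, entry (w.at i.1) =
      summandHom (v.at j).label (EAval (w.at i.1).obj) := fun i => by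
    have := (f.map i.1 j i.2).label_eq.resolve_left (label_ne_point i.1.2)
    change summand (w.at i.1).label _ = _
    rw [this]
    rfl
  rw [finsum_congr h2, ← AddMonoidHom.map_finsum _ (Set.toFinite _), h]
  rfl

lemma tensor_map_summand (f : X ⟶ Y) (x : X) (a : A) :
    ((tensor A).map f).toFun (summand x a) = summand (f.toFun x) a := by
  by_cases h : x = X.point
  · subst h
    rw [summand_point, f.map_point, summand_point]
    exact ((tensor A).map f).map_point
  · rw [summand_of_ne h]
    change Finsupp.subtypeDomain (· ≠ Y.point) (Finsupp.mapDomain _ (Finsupp.single _ a)) = _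
    rw [Finsupp.mapDomain_single]
    rfl

/-- The map `X ⊗ A ⟶ Y ⊗ A` induced by a map of pointed sets, as an additive map. -/
def tensorHom (f : X ⟶ Y) : ({x : X // x ≠ X.point} →₀ A) →+ ({y : Y // y ≠ Y.point} →₀ A) :=
  (Finsupp.subtypeDomainAddMonoidHom (p := (· ≠ Y.point))).comp
    (Finsupp.mapDomain.addMonoidHom fun x : {x : X // x ≠ X.point} => f.toFun x.1)

lemma tensor_map_entry (f : X ⟶ Y) (P : SmashObj X (EAstar A)) :
    ((tensor A).map f).toFun (entry P) = entry (smashObjMap f P) := by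
  refine (tensor_map_summand f _ _).trans ?_
  by_cases h : f.toFun P.label = Y.point
  · change summand _ _ = summand (f.toFun P.label) _
    rw [h, summand_point, summand_point]
  · exact congrArg (fun c => summand (f.toFun P.label) (EAval c)) (smashObjMap_obj_of_ne f h).symm

lemma total_map (f : X ⟶ Y) (w : Cov (smash X (EAstar A))) :
    total ((Cov.map (smashMap f (EAstar A))).obj w) = ((tensor A).map f).toFun (total w) := by
  refine Eq.trans ?_ ((tensorHom f).map_finsum (finite_support_entry w)).symm
  exact finsum_congr fun i => (tensor_map_entry f (w.tuple i)).symm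

end Total

/-! ### The map of Γ-spaces -/

section Terminal

variable {A : Type u} [AddCommGroup A] {X : FinPtd}

/-- The entry at `x` of the tuple that represents an element of `X ⊗ A`. -/
def singleEntry (x : {x : X.obj // x ≠ X.obj.point}) (a : A) : SmashObj X.obj (EAstar A) :=
  ⟨x.1, .of ⟨a⟩, iff_of_false x.2 fun h => nomatch h⟩

lemma singleEntry_ne_base (x : {x : X.obj // x ≠ X.obj.point}) (a : A) :
    singleEntry x a ≠ (smash X.obj (EAstar A)).base :=
  fun h => x.2 (congrArg SmashObj.label h)

/-- A numbering of the finite set of non-basepoint elements of `X`. -/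
def numbering (X : FinPtd) : {x : X.obj // x ≠ X.obj.point} ≃
    Fin (Nat.card {x : X.obj // x ≠ X.obj.point}) :=
  Finite.equivFin _

open Classical in
/-- The tuple `{(x, a_x)}` with one entry for each non-basepoint element `x` of `X`. There is an
entry also where `a_x = 0`: the object `(x, 0)` is not the basepoint. -/
def fullTuple (a : {x : X.obj // x ≠ X.obj.point} →₀ A) : Cov (smash X.obj (EAstar A)) where
  tuple i := if h : i < Nat.card {x : X.obj // x ≠ X.obj.point} then
    singleEntry ((numbering X).symm ⟨i, h⟩) (a ((numbering X).symm ⟨i, h⟩))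
    else (smash X.obj (EAstar A)).base
  finite := (Set.finite_Iio (Nat.card {x : X.obj // x ≠ X.obj.point})).subset fun i hi => by
    by_contra h
    exact hi (dif_neg h)

variable (a : {x : X.obj // x ≠ X.obj.point} →₀ A)

lemma fullTuple_numbering (x : {x : X.obj // x ≠ X.obj.point}) :
    (fullTuple a).tuple (numbering X x) = singleEntry x (a x) := by
  refine (dif_pos (numbering X x).2).trans ?_
  exact congrArg (fun y => singleEntry y (a y)) ((numbering X).symm_apply_apply x)

/-- The index of the entry of `fullTuple a` at `x`. -/
def fullIdx (x : {x : X.obj // x ≠ X.obj.point}) : (fullTuple a).Idx :=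
  ⟨numbering X x, fun h => singleEntry_ne_base x (a x) ((fullTuple_numbering a x).symm.trans h)⟩

lemma at_fullIdx (x : {x : X.obj // x ≠ X.obj.point}) :
    (fullTuple a).at (fullIdx a x) = singleEntry x (a x) := fullTuple_numbering a x

lemma fullIdx_surjective : Function.Surjective (fullIdx a) := by
  rintro ⟨i, hi⟩
  have h : i < Nat.card {x : X.obj // x ≠ X.obj.point} := by
    by_contra h
    exact hi (dif_neg h)
  exact ⟨(numbering X).symm ⟨i, h⟩, Subtype.ext (by simp [fullIdx])⟩

lemma label_at_eq_iff (j : (fullTuple a).Idx) (x : {x : X.obj // x ≠ X.obj.point}) :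
    ((fullTuple a).at j).label = x.1 ↔ fullIdx a x = j := by
  obtain ⟨y, rfl⟩ := fullIdx_surjective a j
  rw [at_fullIdx]
  refine ⟨fun h => congrArg _ (Subtype.ext h.symm), fun h => ?_⟩
  have := congrArg (fun j => ((fullTuple a).at j).label) h
  simp only [at_fullIdx] at this
  exact this.symm

lemma total_fullTuple : total (fullTuple a) = a := by
  rw [total_eq_finsum_idx, ← finsum_comp_equiv (Equiv.ofBijective (fullIdx a)
    ⟨fun x y h => Subtype.ext (((label_at_eq_iff a _ y).2 h.symm).symm.trans
      ((label_at_eq_iff a _ x).2 rfl)).symm, fullIdx_surjective a⟩)]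
  have := Fintype.ofFinite {x : X.obj // x ≠ X.obj.point}
  rw [finsum_eq_sum_of_fintype]
  refine Eq.trans ?_ (Finsupp.univ_sum_single a)
  refine Finset.sum_congr rfl fun x _ => ?_
  change entry ((fullTuple a).at (fullIdx a x)) = _
  rw [at_fullIdx]
  exact summand_of_ne x.2 _

/-- The label of an entry of a tuple. -/
def labelAt (w : Cov (smash X.obj (EAstar A))) (i : w.Idx) : {x : X.obj // x ≠ X.obj.point} :=
  ⟨(w.at i).label, label_ne_point i.2⟩

lemma idx_hom_fullTuple {w : Cov (smash X.obj (EAstar A))} (f : w ⟶ fullTuple a) (i : w.Idx) :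
    f.idx i = fullIdx a (labelAt w i) := by
  refine ((label_at_eq_iff a _ _).1 ?_).symm
  exact ((f.map i _ rfl).label_eq.resolve_left (label_ne_point i.2)).symm

lemma subsingleton_hom_fullTuple (w : Cov (smash X.obj (EAstar A))) :
    Subsingleton (w ⟶ fullTuple a) :=
  ⟨fun f g => CovHom.ext'
    (fun i => (idx_hom_fullTuple a f i).trans (idx_hom_fullTuple a g i).symm)
    fun _ _ _ _ => SmashHom.ext (Subsingleton.elim _ _)⟩

lemma obj_ne_base {P : SmashObj X.obj (EAstar A)} (h : P ≠ (smash X.obj (EAstar A)).base) :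
    P.obj ≠ (EAstar A).base := fun hP => label_ne_point h (P.compat.2 hP)

/-- A morphism of `X ∧ EA_*` between objects with the same label. -/
def entryHom {P Q : SmashObj X.obj (EAstar A)} (hQ : Q ≠ (smash X.obj (EAstar A)).base)
    (h : P.label = Q.label) : SmashHom P Q :=
  ⟨(nonempty_hom_of_ne_base P.obj (obj_ne_base hQ)).some, Or.inr h⟩

/-- The morphism from a tuple to the tuple of its sums. -/
def homFullTuple (w : Cov (smash X.obj (EAstar A))) (h : total w = a) : w ⟶ fullTuple a where
  idx i := fullIdx a (labelAt w i)
  map i j hij := entryHom j.2 ((label_at_eq_iff a _ _).2 hij).symm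
  cover j := by
    refine (isCover_EAstar_iff _ fun i : {i // fullIdx a (labelAt w i) = j} =>
      (entryHom (P := w.at i.1) j.2 ((label_at_eq_iff a _ _).2 i.2).symm).hom).2 ?_
    obtain ⟨x, rfl⟩ := fullIdx_surjective a j
    have h2 : EAval ((fullTuple a).at (fullIdx a x)).obj = a x := by rw [at_fullIdx]; rfl
    have h3 := total_apply w x
    rw [h] at h3
    refine Eq.trans ?_ (h2.trans h3).symm
    refine finsum_eq_of_bijective (fun i => ⟨i.1.1, ?_⟩) ?_ fun i => rfl
    · exact ((label_at_eq_iff a _ _).2 i.2).symm.trans (by rw [at_fullIdx]; rfl)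
    · refine ⟨fun i i' h => Subtype.ext (Subtype.ext (congrArg (fun i => i.1) h)), fun i => ?_⟩
      refine ⟨⟨⟨i.1, fun h => x.2 (i.2.symm.trans (congrArg SmashObj.label h))⟩, ?_⟩, rfl⟩
      exact congrArg (fullIdx a) (Subtype.ext i.2)

end Terminal

section Family

variable (A : Type u) [AddCommGroup A]

/-- The category of covers of `X ∧ EA_*`, as a family of categories indexed by `X ⊗ A`. -/
def coverFamily : FinPtd ⥤ Graded.{u} where
  obj X :=
    { carrier := Cov (smash X.obj (EAstar A))
      base := {x : X.obj // x ≠ X.obj.point} →₀ A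
      deg := total
      deg_eq := total_eq_of_hom }
  map f := ⟨Cov.map (smashMap f.hom (EAstar A)), ((tensor A).map f.hom).toFun, total_map f.hom⟩
  map_id X := Graded.Hom.ext (congrArg Cov.map ((smashing (EAstar A)).map_id X.obj))
    (congrArg Pointed.Hom.toFun ((tensor A).map_id X.obj))
  map_comp f g := Graded.Hom.ext (congrArg Cov.map ((smashing (EAstar A)).map_comp f.hom g.hom))
    (congrArg Pointed.Hom.toFun ((tensor A).map_comp f.hom g.hom))

/-- The tuples with one entry for each non-basepoint element of `X` are terminal objects. -/
def terminalsCoverFamily (X : FinPtd) : ((coverFamily A).obj X).Terminals where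
  obj := fullTuple
  deg_obj := total_fullTuple
  hom w a h := homFullTuple a w h
  subsingleton w a := subsingleton_hom_fullTuple a w

/-- The map of Γ-spaces that sends a tuple to its sums. On simplices it is given by the first
object, as all objects of a simplex have the same sums. -/
def totalMap : (gammaK (EAstar A)).functor ⟶ (gammaH A).functor where
  app X :=
    { app n := ⟨fun x : ComposableArrows (Cov (smash X.obj (EAstar A))) n.unop.len =>
        total x.left, total_empty (A := A) (X := X.obj)⟩
      naturality n _ _ := Pointed.Hom.ext (funext fun
        (x : ComposableArrows (Cov (smash X.obj (EAstar A))) n.unop.len) =>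
        (total_eq_of_hom (CategoryTheory.Functor.map x (homOfLE (Fin.zero_le _)))).symm) }
  naturality X _ f := NatTrans.ext (funext fun n => Pointed.Hom.ext (funext fun
    (x : ComposableArrows (Cov (smash X.obj (EAstar A))) n.unop.len) =>
      total_map f.hom x.left))

lemma isHomotopyEquiv_totalMap (X : FinPtd) : IsHomotopyEquiv (realMap ((totalMap A).app X)) :=
  Graded.isHomotopyEquiv_deg (terminalsCoverFamily A X)

lemma isHomotopyEquiv_levelMap_totalMap (k : ℕ) :
    IsHomotopyEquiv (realMap (levelMap (totalMap A) k)) :=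
  Graded.isHomotopyEquiv_diagonalDeg (sphere k ⋙ coverFamily A)
    fun p => terminalsCoverFamily A ((sphere k).obj p)

end Family

end CoverK

end

theorem mainTheorem4 (A : Type u) [AddCommGroup A] :
    ∃ φ : (CoverK.gammaK (CoverK.EAstar A)).functor ⟶ (CoverK.gammaH A).functor,
      (∀ (X : CoverK.FinPtd) (w : CoverK.Cov (CoverK.smash X.obj (CoverK.EAstar A)))
          (x : {x : X.obj // x ≠ X.obj.point}),
        CoverK.tensorCoord
            (((φ.app X).app (op (SimplexCategory.mk 0))).toFun (ComposableArrows.mk₀ w)) x =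
          ∑ᶠ i : {i : ℕ // (w.tuple i).label = x.1}, CoverK.EAval (w.tuple i).obj) ∧
      (∀ X : CoverK.FinPtd, CoverK.IsWeakEquiv (CoverK.realMap (φ.app X))) ∧
      CoverK.TopSpectrum.Hom.IsStableEquiv (E := CoverK.KTheory (CoverK.EAstar A))
        (E' := CoverK.EMSpectrum A) (CoverK.spectrumMap φ) :=
  ⟨CoverK.totalMap A, fun _ w x => CoverK.total_apply w x,
    fun X => CoverK.isWeakEquiv_of_isHomotopyEquiv (CoverK.isHomotopyEquiv_totalMap A X),
    CoverK.isStableEquiv_of_levelwise _ fun k => CoverK.isWeakEquiv_of_isHomotopyEquiv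
      (CoverK.isHomotopyEquiv_levelMap_totalMap A k)⟩
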